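/- **Sectional curvature densities for products.** For a compact Riemannian manifold $M$ of dimension $m\ge 2$ let $\rho^M$ denote its sectional curvature density: the probability measure on $\mathbb R$ which is the distribution of the sectional curvature $(p,\Sigma)\mapsto \sec_{R_p}(\Sigma)$, considered as a random variable on the bundle $\mathrm{Gr}_2TM$ of tangent $2$-planes with its normalized volume (the Riemannian volume of $M$ in $p$, the volume of the Fubini–Study metric of $\mathrm{Gr}_2T_pM$ in $\Sigma$). The densities below are understood as measures, which may have atoms. Let $m,n\ge 2$ be integers. There is a unique family $(\rho^{m,n}_{\mu,\nu})_{\mu,\nu\in\mathbb R}$ of probability measures on $\mathbb R$, depending measurably on $(\mu,\nu)$, such that $\rho^{m,n}_{\mu,\nu}$ is supported in the convex hull $[\min\{\mu,\nu,0\},\max\{\mu,\nu,0\}]$ of $\mu,\nu,0$ and such that for all nonempty compact (smooth) Riemannian manifolds $M$ and $N$ of dimensions $m$ and $n$ the Riemannian product $M\times N$ has the sectional curvature density $$\rho^{M\times N}\;=\;\int_{\mathbb R\times\mathbb R}\rho^{m,n}_{\mu,\nu}\;\rho^M(d\mu)\,\rho^N(d\nu).$$ Explicitly, $\rho^{m,n}_{\mu,\nu}$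 is the law of $x^2\mu+y^2\nu$ under the probability measure $$\frac{(m+n-2)!}{(m-2)!\,(n-2)!}\;x^{m-2}\,y^{n-2}\,dx\,dy\qquad\text{on}\qquad \Delta_2=\{(x,y)\mid x,y\ge 0,\ x+y\le 1\}.$$ For $\nu=0$ and every $\mu\ne 0$ the measure $\rho^{m,n}_{\mu,0}$ has the Lebesgue density $$\frac{(m+n-2)!}{(m-2)!\,(n-1)!}\;\sqrt{\tfrac s\mu}^{\,m-3}\Big(1-\sqrt{\tfrac s\mu}\Big)^{n-1}\frac{1}{2|\mu|}$$ on the interval with end points $0$ and $\mu$, and vanishes outside of this interval. The last formula may be used for $n=1$, too: for $m \ge 2$ and $\mu\ne0$ let $\rho^{m,1}_{\mu,0}$ be the measure with this density for $n=1$, and let $\rho^{m,1}_{0,0}$ be the Dirac measure at $0$. These are probability measures depending measurably on $\mu$, and $\rho^{M\times N}=\int_{\mathbb R}\rho^{m,1}_{\mu,0}\,\rho^M(d\mu)$ for every nonempty compact Riemannian manifold $M$ of dimension $m$ and every nonempty compact Riemannian manifold $N$ of dimension $1$, in particular for a circle. -/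

import Mathlib

open MeasureTheory ProbabilityTheory Bundle Manifold
open scoped ContDiff Nat

universe u v

noncomputable section

/-! ## Planes in a Euclidean vector space -/

section Planes

/-- The Grassmannian of two-dimensional linear subspaces of a Euclidean vector space `V`. -/
def Plane (V : Type*) [NormedAddCommGroup V] [InnerProductSpace ℝ V] : Type _ :=
  {W : Submodule ℝ V // Module.finrank ℝ W = 2}

variable (V : Type*) [NormedAddCommGroup V] [InnerProductSpace ℝ V] [FiniteDimensional ℝ V]

/-- The embedding `Σ ↦ pr_Σ` of the Grassmannian into the endomorphisms of `V`. The orthogonal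
projection `pr_Σ` is recorded by its matrix in an orthonormal basis of `V`, divided by `√2`, so that
the Euclidean norm of the matrix is the norm of the scalar product `½ tr (A ∘ B)` on symmetric
endomorphisms. -/
def Plane.embedding (S : Plane V) :
    EuclideanSpace ℝ (Fin (Module.finrank ℝ V) × Fin (Module.finrank ℝ V)) :=
  WithLp.toLp 2 fun ij =>
    inner ℝ (stdOrthonormalBasis ℝ V ij.1) (S.1.starProjection (stdOrthonormalBasis ℝ V ij.2)) / √2

theorem Plane.embedding_injective : Function.Injective (Plane.embedding V) := by
  intro S T h
  have hST : S.1.starProjection = T.1.starProjection := by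
    have hb : ∀ j, S.1.starProjection (stdOrthonormalBasis ℝ V j) =
        T.1.starProjection (stdOrthonormalBasis ℝ V j) := by
      intro j
      refine InnerProductSpace.ext_inner_left_basis (𝕜 := ℝ) (stdOrthonormalBasis ℝ V).toBasis fun i => ?_
      have := congrArg (fun z => z.ofLp (i, j)) h
      have h2 : (√2 : ℝ) ≠ 0 := by positivity
      simpa [Plane.embedding, div_left_inj' h2] using this
    refine ContinuousLinearMap.coe_injective ((stdOrthonormalBasis ℝ V).toBasis.ext fun j => ?_)
    simpa using hb j
  apply Subtype.ext
  rw [← Submodule.range_starProjection S.1, ← Submodule.range_starProjection T.1, hST]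

/-- The distance on the Grassmannian induced by its embedding into the Euclidean space of symmetric
endomorphisms. The Riemannian metric induced by this embedding is the Fubini--Study metric. -/
instance Plane.instMetricSpace : MetricSpace (Plane V) :=
  MetricSpace.induced (Plane.embedding V) (Plane.embedding_injective V) inferInstance

instance Plane.instMeasurableSpace : MeasurableSpace (Plane V) := borel (Plane V)

instance Plane.instBorelSpace : BorelSpace (Plane V) := ⟨rfl⟩

/-- The volume of the Fubini--Study metric on the Grassmannian of planes, a submanifold of dimension
`2 (dim V - 2)` of the Euclidean space of symmetric endomorphisms: the Hausdorff measure of this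
dimension. (Mathlib's Hausdorff measure is a constant multiple of the Riemannian volume, the
constant depending on the dimension only; it disappears on normalization.) -/
def fubiniStudyVolume : Measure (Plane V) :=
  μH[((2 * (Module.finrank ℝ V - 2) : ℕ) : ℝ)]

variable {V}

/-- The sectional curvature of the curvature tensor `R` on the plane spanned by `X` and `Y`:
`⟪R(Y, X) X, Y⟫ / (⟪X, X⟫ ⟪Y, Y⟫ - ⟪X, Y⟫ ^ 2)`. Here `X, Y` is any basis of the plane; for an
algebraic curvature tensor the quotient does not depend on it. -/
def sectionalCurvature (R : V → V → V → V) (S : Plane V) : ℝ :=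
  let b := Module.finBasisOfFinrankEq ℝ S.1 S.2
  let X : V := b 0
  let Y : V := b 1
  inner ℝ (R Y X X) Y / (inner ℝ X X * inner ℝ Y Y - inner ℝ X Y ^ 2)

end Planes

/-! ## The Levi-Civita connection and curvature in coordinates -/

section Coordinates

variable {E : Type*} [NormedAddCommGroup E] [NormedSpace ℝ E]

/-- The Christoffel symbols of a metric `G` given on an open subset of `E`: `Γ_y(v, w)` is the
vector such that, for all `z`,
`G_y (Γ_y(v, w), z) = ½ (∂_v G (w, z) + ∂_w G (v, z) - ∂_z G (v, w))`.
Thus `∇_v W = ∂_v W + Γ(v, W)` is the Levi-Civita connection. -/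
def christoffel (G : E → E →L[ℝ] E →L[ℝ] ℝ) (y v w : E) : E :=
  (G y).inverse ((1 / 2 : ℝ) •
    (fderiv ℝ G y v w + fderiv ℝ G y w v - ((fderiv ℝ G y).flip v).flip w))

/-- The curvature tensor `R(u, v) w = ∇_u ∇_v w - ∇_v ∇_u w` (for constant fields `u`, `v`, `w`) of
the Levi-Civita connection of `G`. -/
def coordCurvature (G : E → E →L[ℝ] E →L[ℝ] ℝ) (y u v w : E) : E :=
  fderiv ℝ (fun y' => christoffel G y' v w) y u - fderiv ℝ (fun y' => christoffel G y' u w) y v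
    + christoffel G y u (christoffel G y v w) - christoffel G y v (christoffel G y u w)

end Coordinates

/-! ## Riemannian manifolds -/

/-- A smooth Riemannian metric on the manifold `M`. -/
abbrev SmoothMetric {E : Type*} [NormedAddCommGroup E] [NormedSpace ℝ E] {H : Type*}
    [TopologicalSpace H] (I : ModelWithCorners ℝ E H) (M : Type*) [TopologicalSpace M]
    [ChartedSpace H M] [IsManifold I ∞ M] :=
  ContMDiffRiemannianMetric I ∞ E (fun p : M => TangentSpace I p)

namespace SmoothMetric

section Curvature

variable {E : Type*} [NormedAddCommGroup E] [NormedSpace ℝ E]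
  {H : Type*} [TopologicalSpace H] {I : ModelWithCorners ℝ E H}
  {M : Type*} [TopologicalSpace M] [ChartedSpace H M] [IsManifold I ∞ M] (g : SmoothMetric I M)

/-- The metric `g` in the coordinates of the preferred chart around `p`, that is its pull-back under
the inverse of this chart. -/
def inChart (p : M) (y : E) : E →L[ℝ] E →L[ℝ] ℝ :=
  let D : E →L[ℝ] TangentSpace I ((extChartAt I p).symm y) :=
    mfderiv 𝓘(ℝ, E) I (extChartAt I p).symm y
  (D.precomp ℝ).comp ((g.inner ((extChartAt I p).symm y)).comp D)

/-- The curvature tensor of `g` at the point `p`, computed in the preferred chart around `p`, whose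
derivative at `p` is the identification of the tangent space at `p` with `E`. -/
def curvatureTensor (p : M) :
    TangentSpace I p → TangentSpace I p → TangentSpace I p → TangentSpace I p :=
  coordCurvature (E := E) (g.inChart p) (extChartAt I p p)

variable [FiniteDimensional ℝ E] [MeasurableSpace E] [BorelSpace E] [MeasurableSpace M]

/-- The Riemannian volume on the domain of the preferred chart around `p`: the image under the
inverse of the chart of `√(det (g_ij)) dy`. -/
def chartVolume (p : M) : Measure M :=
  let b := Module.finBasis ℝ E
  Measure.map (extChartAt I p).symm
    ((b.addHaar.withDensity fun y =>
      ENNReal.ofReal √(Matrix.of fun i j => g.inChart p y (b i) (b j)).det).restrict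
        (extChartAt I p).target)

/-- The Riemannian volume of `M`: the smallest measure which is at least the Riemannian volume of
each chart domain. As the measures on the chart domains agree on overlaps, it restricts to each of
them. -/
def volumeMeasure : Measure M := ⨆ p : M, g.chartVolume p

/-- The image on the real line, under the sectional curvature, of the volume of the bundle
`Gr₂ TM` of tangent planes: integrate over `p ∈ M` the image of the Fubini--Study volume of the
Grassmannian of planes in the Euclidean space `(T_p M, g_p)`. -/
def curvatureVolume : Measure ℝ :=
  g.volumeMeasure.bind fun p =>
    letI : RiemannianBundle (fun p : M => TangentSpace I p) := ⟨g.toRiemannianMetric⟩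
    haveI : FiniteDimensional ℝ (TangentSpace I p) := inferInstanceAs (FiniteDimensional ℝ E)
    (fubiniStudyVolume (TangentSpace I p)).map (sectionalCurvature (g.curvatureTensor p))

/-- The sectional curvature density of `(M, g)`: the distribution of the sectional curvature,
considered as a random variable on `Gr₂ TM` with its normalized volume. -/
def curvatureDistribution : Measure ℝ :=
  (g.curvatureVolume Set.univ)⁻¹ • g.curvatureVolume

end Curvature

/-! ## The Riemannian product -/

section Product

variable {E : Type*} [NormedAddCommGroup E] [NormedSpace ℝ E]
  {H : Type*} [TopologicalSpace H] {I : ModelWithCorners ℝ E H}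
  {M : Type*} [TopologicalSpace M] [ChartedSpace H M] [IsManifold I ∞ M]
  {E' : Type*} [NormedAddCommGroup E'] [NormedSpace ℝ E']
  {H' : Type*} [TopologicalSpace H'] {I' : ModelWithCorners ℝ E' H'}
  {N : Type*} [TopologicalSpace N] [ChartedSpace H' N] [IsManifold I' ∞ N]

theorem contMDiff_pullback (g : SmoothMetric I M) {f : N → M} (hf : ContMDiff I' I ∞ f) :
    ContMDiff I' (I'.prod 𝓘(ℝ, E' →L[ℝ] E' →L[ℝ] ℝ)) ∞
    (fun z : N => TotalSpace.mk' (E' →L[ℝ] E' →L[ℝ] ℝ)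
      (E := fun z : N => TangentSpace I' z →L[ℝ] TangentSpace I' z →L[ℝ] ℝ) z
      (((mfderiv I' I f z).precomp ℝ).comp ((g.inner (f z)).comp (mfderiv I' I f z)))) := by
  have : IsManifold I (∞ + 1) M := inferInstanceAs (IsManifold I ∞ M)
  have : IsManifold I' (∞ + 1) N := inferInstanceAs (IsManifold I' ∞ N)
  intro z₀
  have hA := ContMDiffAt.mfderiv_const (m := ∞) (n := ∞) (hf z₀) le_rfl
  have hG := ((contMDiffAt_hom_bundle _).1 (g.contMDiff (f z₀))).2.comp z₀ (hf z₀)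
  rw [contMDiffAt_hom_bundle]
  refine ⟨contMDiffAt_id, ?_⟩
  refine ((hA.clm_precomp (F₃ := ℝ)).clm_comp (hG.clm_comp hA)).congr_of_eventuallyEq ?_
  have hN : (trivializationAt E' (TangentSpace I' (M := N)) z₀).baseSet ∈ nhds z₀ :=
    (trivializationAt E' (TangentSpace I') z₀).open_baseSet.mem_nhds
      (FiberBundle.mem_baseSet_trivializationAt' z₀)
  have hM : f ⁻¹' (trivializationAt E (TangentSpace I (M := M)) (f z₀)).baseSet ∈ nhds z₀ :=
    hf.continuous.continuousAt.preimage_mem_nhds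
      ((trivializationAt E (TangentSpace I) (f z₀)).open_baseSet.mem_nhds
        (FiberBundle.mem_baseSet_trivializationAt' _))
  filter_upwards [hN, hM] with z hz hz'
  have hz' : f z ∈ (trivializationAt E (TangentSpace I (M := M)) (f z₀)).baseSet := hz'
  ext v w
  rw [inCoordinates_apply_eq₂ hz hz (Set.mem_univ _)]
  simp only [ContinuousLinearMap.comp_apply, Function.comp_apply,
    ContinuousLinearMap.precomp_apply]
  rw [inCoordinates_apply_eq₂ hz' hz' (Set.mem_univ _)]
  simp [inTangentCoordinates, ContinuousLinearMap.inCoordinates,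
    Trivialization.symm_linearMapAt _ hz', Trivialization.symmL_apply _ hz]

theorem inner_self_nonneg (g : SmoothMetric I M) (p : M) (v : TangentSpace I p) :
    0 ≤ g.inner p v v := by
  rcases eq_or_ne v 0 with rfl | hv
  · simp
  · exact (g.pos _ v hv).le

theorem isVonNBounded_prod (g : SmoothMetric I M) (h : SmoothMetric I' N) (z : M × N) :
    Bornology.IsVonNBounded ℝ {v : TangentSpace (I.prod I') z |
      g.inner z.1 v.1 v.1 + h.inner z.2 v.2 v.2 < 1} := by
  have h1 := (g.isVonNBounded z.1).image
    (ContinuousLinearMap.inl ℝ (TangentSpace I z.1) (TangentSpace I' z.2))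
  have h2 := (h.isVonNBounded z.2).image
    (ContinuousLinearMap.inr ℝ (TangentSpace I z.1) (TangentSpace I' z.2))
  refine (h1.add h2).subset ?_
  rintro ⟨v, w⟩ hvw
  have hvw : g.inner z.1 v v + h.inner z.2 w w < 1 := hvw
  refine ⟨_, ⟨v, ?_, rfl⟩, _, ⟨w, ?_, rfl⟩, ?_⟩
  · exact lt_of_le_of_lt (le_add_of_nonneg_right (h.inner_self_nonneg _ w)) hvw
  · exact lt_of_le_of_lt (le_add_of_nonneg_left (g.inner_self_nonneg _ v)) hvw
  · exact Prod.ext (add_zero v) (zero_add w)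

set_option synthInstance.maxHeartbeats 200000 in
set_option maxHeartbeats 1000000 in
/-- The Riemannian product metric on `M × N`:
`(g ⊕ h)_(p, q) (X, Y) = g_p (pr_M X, pr_M Y) + h_q (pr_N X, pr_N Y)`. -/
def prod (g : SmoothMetric I M) (h : SmoothMetric I' N) : SmoothMetric (I.prod I') (M × N) where
  inner z :=
    ((mfderiv (I.prod I') I Prod.fst z).precomp ℝ).comp
      ((g.inner z.1).comp (mfderiv (I.prod I') I Prod.fst z)) +
    ((mfderiv (I.prod I') I' Prod.snd z).precomp ℝ).comp
      ((h.inner z.2).comp (mfderiv (I.prod I') I' Prod.snd z))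
  symm z v w := congrArg₂ (· + ·) (g.symm _ _ _) (h.symm _ _ _)
  pos z v hv := by
    rw [mfderiv_fst, mfderiv_snd]
    change 0 < g.inner z.1 v.1 v.1 + h.inner z.2 v.2 v.2
    by_cases h1 : v.1 = 0
    · have h2 : v.2 ≠ 0 := fun h2 => hv (Prod.ext h1 h2)
      exact add_pos_of_nonneg_of_pos (g.inner_self_nonneg _ _) (h.pos _ _ h2)
    · exact add_pos_of_pos_of_nonneg (g.pos _ _ h1) (h.inner_self_nonneg _ _)
  isVonNBounded z := by
    rw [mfderiv_fst, mfderiv_snd]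
    exact isVonNBounded_prod g h z
  contMDiff := (contMDiff_pullback g contMDiff_fst).add_section (contMDiff_pullback h contMDiff_snd)

theorem prod_inner (g : SmoothMetric I M) (h : SmoothMetric I' N) (z : M × N)
    (v w : TangentSpace (I.prod I') z) :
    (g.prod h).inner z v w = g.inner z.1 v.1 w.1 + h.inner z.2 v.2 w.2 := by
  change (g.inner z.1 (mfderiv (I.prod I') I Prod.fst z v) (mfderiv (I.prod I') I Prod.fst z w) +
    h.inner z.2 (mfderiv (I.prod I') I' Prod.snd z v) (mfderiv (I.prod I') I' Prod.snd z w) : ℝ) = _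
  rw [mfderiv_fst, mfderiv_snd]
  rfl

end Product

end SmoothMetric

/-! ## The probability measures attached to products -/

/-- The probability measure `(m+n-2)! / ((m-2)! (n-2)!) x ^ (m-2) y ^ (n-2) dx dy` on the simplex
`{(x, y) | x, y ≥ 0, x + y ≤ 1}`. -/
def simplexMeasure (m n : ℕ) : Measure (ℝ × ℝ) :=
  (volume.restrict {z : ℝ × ℝ | 0 ≤ z.1 ∧ 0 ≤ z.2 ∧ z.1 + z.2 ≤ 1}).withDensity fun z =>
    ENNReal.ofReal (((m + n - 2)! : ℝ) / ((m - 2)! * (n - 2)!) * z.1 ^ (m - 2) * z.2 ^ (n - 2))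

/-- The measure on the real line with the density
`(m+n-2)! / ((m-2)! (n-1)!) √(s/μ) ^ (m-3) (1 - √(s/μ)) ^ (n-1) / (2 |μ|)`
on the interval with end points `0` and `μ ≠ 0`. For `m = 2` the first power is `√(s/μ)⁻¹`. -/
def axisMeasure (m n : ℕ) (μ : ℝ) : Measure ℝ :=
  (volume.restrict (Set.uIcc 0 μ)).withDensity fun s =>
    ENNReal.ofReal (((m + n - 2)! : ℝ) / ((m - 2)! * (n - 1)!) *
      √(s / μ) ^ ((m : ℤ) - 3) * (1 - √(s / μ)) ^ (n - 1) * (1 / (2 * |μ|)))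

/-- The kernel `ρ` computes the sectional curvature density of the Riemannian product `M × N` from
those of `M` and `N`, for all nonempty compact Riemannian manifolds `M` and `N` of dimensions `m` and
`n`: `ρ^{M × N} = ∫ ρ_{μ, ν} ρ^M(dμ) ρ^N(dν)`. -/
def ComputesProductCurvature (m n : ℕ) (ρ : Kernel (ℝ × ℝ) ℝ) : Prop :=
  ∀ (M : Type u) [TopologicalSpace M] [ChartedSpace (EuclideanSpace ℝ (Fin m)) M]
    [IsManifold (𝓡 m) ∞ M] [T2Space M] [CompactSpace M] [Nonempty M]
    [MeasurableSpace M] [BorelSpace M] (g : SmoothMetric (𝓡 m) M)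
    (N : Type v) [TopologicalSpace N] [ChartedSpace (EuclideanSpace ℝ (Fin n)) N]
    [IsManifold (𝓡 n) ∞ N] [T2Space N] [CompactSpace N] [Nonempty N]
    [MeasurableSpace N] [BorelSpace N] (h : SmoothMetric (𝓡 n) N),
    (g.prod h).curvatureDistribution =
      (g.curvatureDistribution.prod h.curvatureDistribution).bind ρ

end

set_option linter.unusedSectionVars false

noncomputable section

section UniformlyDistributed

open Filter Topology Metric

variable {X : Type*} [PseudoMetricSpace X] [SecondCountableTopology X] [MeasurableSpace X]
  [BorelSpace X]

omit [BorelSpace X] in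
theorem measure_ball_pos_of_homogeneous {μ : Measure X} (hμ0 : μ ≠ 0)
    (hμ : ∀ x y r, μ (ball x r) = μ (ball y r)) (x : X) {r : ℝ} (hr : 0 < r) :
    0 < μ (ball x r) := by
  refine pos_iff_ne_zero.2 fun h0 => hμ0 ?_
  obtain ⟨t, ht, hcov⟩ := TopologicalSpace.countable_cover_nhds (fun y : X => ball_mem_nhds y hr)
  rw [← Measure.measure_univ_eq_zero, ← hcov]
  exact (measure_biUnion_null_iff ht).2 fun y _ => (hμ y x r).trans h0

theorem measure_open_le_liminf {μ ν : Measure X} [IsFiniteMeasure μ] [IsFiniteMeasure ν]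
    (hν0 : ν ≠ 0) (hμ : ∀ x y r, μ (ball x r) = μ (ball y r))
    (hν : ∀ x y r, ν (ball x r) = ν (ball y r)) (x₀ : X) {U : Set X} (hU : IsOpen U) :
    μ U ≤ liminf (fun n : ℕ => μ (ball x₀ (1 / (n + 1 : ℝ))) / ν (ball x₀ (1 / (n + 1 : ℝ)))) atTop
      * ν U := by
  set r : ℕ → ℝ := fun n => 1 / (n + 1 : ℝ) with hr
  have hr0 : ∀ n, 0 < r n := fun n => by positivity
  have hk0 : ∀ n, ν (ball x₀ (r n)) ≠ 0 := fun n =>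
    (measure_ball_pos_of_homogeneous hν0 hν x₀ (hr0 n)).ne'
  have hkt : ∀ n, ν (ball x₀ (r n)) ≠ ⊤ := fun n => measure_ne_top _ _
  have hmeas : ∀ n, MeasurableSet {z : X × X | dist z.1 z.2 < r n} := fun n =>
    (isOpen_lt continuous_dist continuous_const).measurableSet
  have hset : ∀ n x, (Prod.mk x ⁻¹' {z : X × X | dist z.1 z.2 < r n}) = ball x (r n) := by
    intro n x; ext y; simp [dist_comm]
  have hset' : ∀ n x, ((fun y => (y, x)) ⁻¹' {z : X × X | dist z.1 z.2 < r n}) = ball x (r n) := by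
    intro n x; ext y; simp
  have hm : ∀ n, Measurable fun x => ν.restrict U (ball x (r n)) / ν (ball x₀ (r n)) := by
    intro n
    have := measurable_measure_prodMk_left (ν := ν.restrict U) (hmeas n)
    simp only [hset] at this
    exact this.div_const _
  have hlim : ∀ x ∈ U, 1 ≤ liminf (fun n => ν.restrict U (ball x (r n)) / ν (ball x₀ (r n))) atTop := by
    intro x hx
    obtain ⟨ε, hε, hsub⟩ := Metric.isOpen_iff.1 hU x hx
    refine le_liminf_of_le (by isBoundedDefault) ?_
    have : Tendsto r atTop (𝓝 0) := tendsto_one_div_add_atTop_nhds_zero_nat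
    filter_upwards [this.eventually (gt_mem_nhds hε)] with n hn
    rw [Measure.restrict_apply measurableSet_ball,
      Set.inter_eq_left.2 ((ball_subset_ball hn.le).trans hsub), hν x x₀,
      ENNReal.div_self (hk0 n) (hkt n)]
  calc μ U = ∫⁻ _ in U, 1 ∂μ := by simp
    _ ≤ ∫⁻ x in U, liminf (fun n => ν.restrict U (ball x (r n)) / ν (ball x₀ (r n))) atTop ∂μ :=
        setLIntegral_mono' hU.measurableSet hlim
    _ ≤ liminf (fun n => ∫⁻ x in U, ν.restrict U (ball x (r n)) / ν (ball x₀ (r n)) ∂μ) atTop :=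
        lintegral_liminf_le hm
    _ ≤ liminf (fun n => μ (ball x₀ (r n)) / ν (ball x₀ (r n)) * ν U) atTop := by
        refine liminf_le_liminf (Eventually.of_forall fun n => ?_)
        have e1 : ∫⁻ x in U, ν.restrict U (ball x (r n)) / ν (ball x₀ (r n)) ∂μ =
            (∫⁻ x in U, ν.restrict U (ball x (r n)) ∂μ) / ν (ball x₀ (r n)) := by
          simp only [div_eq_mul_inv]
          exact lintegral_mul_const' _ _ (ENNReal.inv_ne_top.2 (hk0 n))
        have e2 : ∫⁻ x in U, ν.restrict U (ball x (r n)) ∂μ =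
            ∫⁻ x in U, μ.restrict U (ball x (r n)) ∂ν := by
          have h1 := Measure.prod_apply (μ := μ.restrict U) (ν := ν.restrict U) (hmeas n)
          have h2 := Measure.prod_apply_symm (μ := μ.restrict U) (ν := ν.restrict U) (hmeas n)
          simp only [hset] at h1
          simp only [hset'] at h2
          exact h1.symm.trans h2
        have e3 : ∫⁻ x in U, μ.restrict U (ball x (r n)) ∂ν ≤ μ (ball x₀ (r n)) * ν U := by
          calc _ ≤ ∫⁻ _ in U, μ (ball x₀ (r n)) ∂ν :=
                lintegral_mono fun x => (Measure.restrict_le_self _).trans (hμ x x₀ _).le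
            _ = _ := by simp
        rw [e1, e2, ENNReal.div_eq_inv_mul, ENNReal.div_eq_inv_mul, mul_assoc]
        gcongr
    _ = _ := by
        rw [ENNReal.liminf_mul_const_of_ne_top (measure_ne_top _ _), mul_comm]

theorem eq_smul_of_homogeneous {μ ν : Measure X} [IsFiniteMeasure μ] [IsFiniteMeasure ν]
    (hμ0 : μ ≠ 0) (hν0 : ν ≠ 0) (hμ : ∀ x y r, μ (ball x r) = μ (ball y r))
    (hν : ∀ x y r, ν (ball x r) = ν (ball y r)) :
    ∃ c : ENNReal, μ = c • ν := by
  have hne : Nonempty X := by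
    by_contra h
    rw [not_nonempty_iff] at h
    exact hμ0 (Measure.eq_zero_of_isEmpty μ)
  obtain ⟨x₀⟩ := hne
  set a : ℕ → ENNReal := fun n => μ (ball x₀ (1 / (n + 1 : ℝ))) with ha
  set b : ℕ → ENNReal := fun n => ν (ball x₀ (1 / (n + 1 : ℝ))) with hb
  have hr0 : ∀ n : ℕ, 0 < 1 / (n + 1 : ℝ) := fun n => by positivity
  have ha0 : ∀ n, a n ≠ 0 := fun n => (measure_ball_pos_of_homogeneous hμ0 hμ x₀ (hr0 n)).ne'
  have hb0 : ∀ n, b n ≠ 0 := fun n => (measure_ball_pos_of_homogeneous hν0 hν x₀ (hr0 n)).ne'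
  have hat : ∀ n, a n ≠ ⊤ := fun n => measure_ne_top _ _
  have hbt : ∀ n, b n ≠ ⊤ := fun n => measure_ne_top _ _
  have hcc : liminf (fun n => a n / b n) atTop * liminf (fun n => b n / a n) atTop ≤ 1 := by
    refine (ENNReal.le_liminf_mul).trans ?_
    have : ((fun n => a n / b n) * fun n => b n / a n) = fun _ => 1 := by
      funext n
      simp only [Pi.mul_apply]
      rw [div_eq_mul_inv, div_eq_mul_inv, mul_assoc, ← mul_assoc (b n)⁻¹,
        ENNReal.inv_mul_cancel (hb0 n) (hbt n), one_mul, ENNReal.mul_inv_cancel (ha0 n) (hat n)]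
    rw [this]
    simp
  set c := liminf (fun n => a n / b n) atTop with hc
  have key : ∀ U : Set X, IsOpen U → μ U = c * ν U := by
    intro U hU
    refine le_antisymm (measure_open_le_liminf hν0 hμ hν x₀ hU) ?_
    calc c * ν U ≤ c * (liminf (fun n => b n / a n) atTop * μ U) := by
          gcongr
          exact measure_open_le_liminf hμ0 hν hμ x₀ hU
      _ = c * liminf (fun n => b n / a n) atTop * μ U := (mul_assoc _ _ _).symm
      _ ≤ 1 * μ U := by gcongr
      _ = μ U := one_mul _
  refine ⟨c, ?_⟩
  refine ext_of_generate_finite {U | IsOpen U} BorelSpace.measurable_eq isPiSystem_isOpen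
    (fun U hU => ?_) ?_
  · simpa using key U hU
  · simpa using key _ isOpen_univ

end UniformlyDistributed

section GramDeterminant

variable {V : Type*} [NormedAddCommGroup V] [InnerProductSpace ℝ V]

/-- The squared area of the parallelogram spanned by two vectors. -/
def gramDet (X Y : V) : ℝ := inner ℝ X X * inner ℝ Y Y - inner ℝ X Y ^ 2

theorem gramDet_nonneg (X Y : V) : 0 ≤ gramDet X Y := by
  have := real_inner_mul_inner_self_le X Y
  unfold gramDet
  nlinarith

theorem continuous_gramDet : Continuous fun z : V × V => gramDet z.1 z.2 := by
  unfold gramDet; fun_prop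

theorem gramDet_comb (X Y : V) (a b c d : ℝ) :
    gramDet (a • X + b • Y) (c • X + d • Y) = (a * d - b * c) ^ 2 * gramDet X Y := by
  simp only [gramDet, inner_add_left, inner_add_right, real_inner_smul_left, real_inner_smul_right,
    real_inner_comm X Y]
  ring

theorem linearIndependent_of_gramDet_ne_zero {X Y : V} (h : gramDet X Y ≠ 0) :
    LinearIndependent ℝ ![X, Y] := by
  rw [LinearIndependent.pair_iff]
  intro s t hst
  have h1 : inner ℝ X (s • X + t • Y) = 0 := by rw [hst, inner_zero_right]
  have h2 : inner ℝ Y (s • X + t • Y) = 0 := by rw [hst, inner_zero_right]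
  simp only [inner_add_right, real_inner_smul_right, real_inner_comm X Y] at h1 h2
  unfold gramDet at h
  constructor
  · refine (mul_eq_zero.1 (?_ : s * (inner ℝ X X * inner ℝ Y Y - inner ℝ X Y ^ 2) = 0)).resolve_right h
    linear_combination (inner ℝ Y Y) * h1 - (inner ℝ X Y) * h2
  · refine (mul_eq_zero.1 (?_ : t * (inner ℝ X X * inner ℝ Y Y - inner ℝ X Y ^ 2) = 0)).resolve_right h
    linear_combination (inner ℝ X X) * h2 - (inner ℝ X Y) * h1

theorem gramDet_ne_zero_of_linearIndependent {X Y : V} (h : LinearIndependent ℝ ![X, Y]) :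
    gramDet X Y ≠ 0 := by
  intro h0
  rw [LinearIndependent.pair_iff] at h
  have hz : (inner ℝ Y Y : ℝ) • X + (-inner ℝ X Y : ℝ) • Y = 0 := by
    rw [← inner_self_eq_zero (𝕜 := ℝ)]
    simp only [inner_add_left, inner_add_right, real_inner_smul_left, real_inner_smul_right,
      real_inner_comm X Y]
    unfold gramDet at h0
    linear_combination (inner ℝ Y Y) * h0
  have hY := (h _ _ hz).1
  rw [inner_self_eq_zero] at hY
  have := (h 0 1 (by simp [hY])).2
  exact one_ne_zero this

theorem finrank_span_pair_of_gramDet_ne_zero {X Y : V} (h : gramDet X Y ≠ 0) :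
    Module.finrank ℝ (Submodule.span ℝ {X, Y}) = 2 := by
  have := finrank_span_eq_card (linearIndependent_of_gramDet_ne_zero h)
  rwa [Matrix.range_cons, Matrix.range_cons, Matrix.range_empty, Set.union_empty,
    Set.singleton_union, Fintype.card_fin] at this

/-- The plane spanned by two linearly independent vectors. -/
def Plane.ofPair (X Y : V) (h : gramDet X Y ≠ 0) : Plane V :=
  ⟨Submodule.span ℝ {X, Y}, finrank_span_pair_of_gramDet_ne_zero h⟩

theorem Plane.eq_ofPair (S : Plane V) {X Y : V} (hX : X ∈ S.1) (hY : Y ∈ S.1)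
    (h : gramDet X Y ≠ 0) : S = Plane.ofPair X Y h := by
  have hfin : FiniteDimensional ℝ S.1 := FiniteDimensional.of_finrank_pos (by rw [S.2]; norm_num)
  refine Subtype.ext (Submodule.eq_of_le_of_finrank_eq ?_ ?_).symm
  · rw [Plane.ofPair, Submodule.span_le]
    rintro z (rfl | rfl) <;> assumption
  · exact (Plane.ofPair X Y h).2.trans S.2.symm

/-- The plane spanned by two vectors, with a fixed value if they are linearly dependent. -/
def pairSpan [Nonempty (Plane V)] (z : V × V) : Plane V :=
  open Classical in
  if h : gramDet z.1 z.2 ≠ 0 then Plane.ofPair z.1 z.2 h else Classical.arbitrary _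

theorem pairSpan_of_ne [Nonempty (Plane V)] {z : V × V} (h : gramDet z.1 z.2 ≠ 0) :
    pairSpan z = Plane.ofPair z.1 z.2 h := dif_pos h

theorem Plane.exists_orthonormal (S : Plane V) : ∃ X Y : V, X ∈ S.1 ∧ Y ∈ S.1 ∧
    inner ℝ X X = (1 : ℝ) ∧ inner ℝ Y Y = (1 : ℝ) ∧ inner ℝ X Y = (0 : ℝ) := by
  have hfin : FiniteDimensional ℝ S.1 := FiniteDimensional.of_finrank_pos (by rw [S.2]; norm_num)
  let b := (stdOrthonormalBasis ℝ S.1).reindex (finCongr S.2)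
  have hb := b.orthonormal
  rw [orthonormal_iff_ite] at hb
  refine ⟨b 0, b 1, (b 0).2, (b 1).2, ?_, ?_, ?_⟩
  · exact (hb 0 0).trans (if_pos rfl)
  · exact (hb 1 1).trans (if_pos rfl)
  · exact (hb 0 1).trans (if_neg (by decide))

/-- The orthogonal projection to the span of two linearly independent vectors. -/
def pairProj (X Y v : V) : V :=
  (gramDet X Y)⁻¹ • ((inner ℝ Y Y * inner ℝ X v - inner ℝ X Y * inner ℝ Y v) • X +
    (inner ℝ X X * inner ℝ Y v - inner ℝ X Y * inner ℝ X v) • Y)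

variable [FiniteDimensional ℝ V]

theorem starProjection_ofPair {X Y : V} (h : gramDet X Y ≠ 0) (v : V) :
    (Plane.ofPair X Y h).1.starProjection v = pairProj X Y v := by
  refine Submodule.eq_starProjection_of_mem_of_inner_eq_zero ?_ ?_
  · refine Submodule.smul_mem _ _ (Submodule.add_mem _ (Submodule.smul_mem _ _ ?_)
      (Submodule.smul_mem _ _ ?_))
    · exact Submodule.subset_span (by simp)
    · exact Submodule.subset_span (by simp)
  · intro w hw
    obtain ⟨a, b, rfl⟩ := Submodule.mem_span_pair.1 hw
    simp only [pairProj, inner_sub_left, inner_add_right, real_inner_smul_right, inner_add_left,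
      real_inner_smul_left, real_inner_comm X Y, real_inner_comm v]
    have h' : (inner ℝ X X * inner ℝ Y Y - inner ℝ X Y ^ 2 : ℝ) ≠ 0 := h
    unfold gramDet
    rw [real_inner_comm X v, real_inner_comm Y v]
    field_simp
    ring

end GramDeterminant

section PlaneMetric

variable {V : Type*} [NormedAddCommGroup V] [InnerProductSpace ℝ V] [FiniteDimensional ℝ V]

theorem Plane.isometry_embedding : Isometry (Plane.embedding V) := fun _ _ => rfl

theorem Plane.dist_sq_eq {ι : Type*} [Fintype ι] (b : OrthonormalBasis ι ℝ V) (S T : Plane V) :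
    dist S T ^ 2 = (1 / 2) * ∑ j, ‖S.1.starProjection (b j) - T.1.starProjection (b j)‖ ^ 2 := by
  set e := stdOrthonormalBasis ℝ V with he
  set A : V →L[ℝ] V := S.1.starProjection - T.1.starProjection with hA
  have hsymm : ∀ u v, inner ℝ (A u) v = (inner ℝ u (A v) : ℝ) := by
    intro u v
    simp [hA, inner_sub_left, inner_sub_right, Submodule.inner_starProjection_left_eq_right]
  have hstd : dist S T ^ 2 = (1 / 2) * ∑ j, ‖A (e j)‖ ^ 2 := by
    rw [← Plane.isometry_embedding.dist_eq, EuclideanSpace.dist_eq, Real.sq_sqrt (by positivity),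
      Fintype.sum_prod_type, Finset.sum_comm, Finset.mul_sum]
    refine Finset.sum_congr rfl fun j _ => ?_
    rw [← e.sum_sq_norm_inner_right, Finset.mul_sum]
    refine Finset.sum_congr rfl fun i _ => ?_
    simp only [Plane.embedding, hA, sub_apply, inner_sub_right, Real.dist_eq,
      sq_abs, Real.norm_eq_abs, ← he]
    rw [← sub_div, div_pow, Real.sq_sqrt (by norm_num)]
    ring
  rw [hstd]
  congr 1
  calc ∑ j, ‖A (e j)‖ ^ 2 = ∑ j, ∑ i, ‖(inner ℝ (b i) (A (e j)) : ℝ)‖ ^ 2 :=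
        Finset.sum_congr rfl fun j _ => (b.sum_sq_norm_inner_right _).symm
    _ = ∑ i, ∑ j, ‖(inner ℝ (e j) (A (b i)) : ℝ)‖ ^ 2 := by
        rw [Finset.sum_comm]
        refine Finset.sum_congr rfl fun i _ => Finset.sum_congr rfl fun j _ => ?_
        rw [← hsymm, real_inner_comm]
    _ = ∑ i, ‖A (b i)‖ ^ 2 := Finset.sum_congr rfl fun i _ => e.sum_sq_norm_inner_right _
    _ = _ := rfl

theorem Plane.norm_starProjection_sub_le (S T : Plane V) (v : V) :
    ‖S.1.starProjection v - T.1.starProjection v‖ ≤ √2 * dist S T * ‖v‖ := by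
  rcases eq_or_ne v 0 with rfl | hv
  · simp
  have hn : ‖v‖ ≠ 0 := norm_ne_zero_iff.2 hv
  obtain ⟨u, b, hub, hb⟩ := Orthonormal.exists_orthonormalBasis_extension
    (𝕜 := ℝ) (v := {(‖v‖⁻¹ • v : V)}) (by
      simp [norm_smul, hn])
  have hmem : (‖v‖⁻¹ • v : V) ∈ u := hub rfl
  have h1 := Plane.dist_sq_eq b S T
  have h2 : ‖S.1.starProjection (‖v‖⁻¹ • v) - T.1.starProjection (‖v‖⁻¹ • v)‖ ^ 2 ≤
      ∑ j, ‖S.1.starProjection (b j) - T.1.starProjection (b j)‖ ^ 2 := by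
    have := Finset.single_le_sum (f := fun j => ‖S.1.starProjection (b j) - T.1.starProjection (b j)‖ ^ 2)
      (fun j _ => by positivity) (Finset.mem_univ (⟨_, hmem⟩ : u))
    simpa [hb] using this
  have h3 : ‖S.1.starProjection (‖v‖⁻¹ • v) - T.1.starProjection (‖v‖⁻¹ • v)‖ ≤ √2 * dist S T := by
    refine abs_le_of_sq_le_sq' (a := _) (b := _) ?_ (by positivity) |>.2
    rw [mul_pow, Real.sq_sqrt (by norm_num)]
    linarith
  rw [map_smul, map_smul, ← smul_sub, norm_smul, norm_inv, norm_norm, inv_mul_le_iff₀ (by positivity)] at h3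
  linarith

instance : SecondCountableTopology (Plane V) :=
  Plane.isometry_embedding.isEmbedding.secondCountableTopology

theorem Plane.continuous_starProjection (v : V) :
    Continuous fun S : Plane V => S.1.starProjection v := by
  refine Metric.continuous_iff.2 fun T ε hε => ⟨ε / (√2 * (‖v‖ + 1)), by positivity, fun S hS => ?_⟩
  rw [dist_eq_norm]
  refine (Plane.norm_starProjection_sub_le S T v).trans_lt ?_
  rw [lt_div_iff₀ (by positivity)] at hS
  have : 0 ≤ √2 * dist S T := by positivity
  nlinarith

theorem Plane.continuousAt_iff {T : Type*} [TopologicalSpace T] {f : T → Plane V} {t : T} :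
    ContinuousAt f t ↔ ∀ v, ContinuousAt (fun s => (f s).1.starProjection v) t := by
  refine ⟨fun h v => (Plane.continuous_starProjection v).continuousAt.comp h, fun h => ?_⟩
  rw [Plane.isometry_embedding.isEmbedding.continuousAt_iff]
  refine (PiLp.continuous_toLp 2 _).continuousAt.comp (continuousAt_pi.2 fun ij => ?_)
  exact (continuousAt_const.inner (h _)).div_const _

theorem continuousAt_pairSpan [Nonempty (Plane V)] {z : V × V} (hz : gramDet z.1 z.2 ≠ 0) :
    ContinuousAt pairSpan z := by
  rw [Plane.continuousAt_iff]
  intro v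
  have h1 : ContinuousAt (fun w : V × V => pairProj w.1 w.2 v) z := by
    refine ContinuousAt.smul (continuous_gramDet.continuousAt.inv₀ hz) ?_
    fun_prop
  refine h1.congr ?_
  filter_upwards [continuous_gramDet.continuousAt.eventually_ne hz] with w hw
  rw [pairSpan_of_ne hw, starProjection_ofPair]

theorem measurable_pairSpan [Nonempty (Plane V)] [MeasurableSpace V] [BorelSpace V] :
    Measurable (pairSpan (V := V)) := by
  have hU : IsOpen {z : V × V | gramDet z.1 z.2 ≠ 0} :=
    isOpen_ne_fun continuous_gramDet continuous_const
  classical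
  refine measurable_of_restrict_of_restrict_compl hU.measurableSet ?_ ?_
  · refine Continuous.measurable (continuousOn_iff_continuous_domRestrict.1 fun z hz => ?_)
    exact (continuousAt_pairSpan hz).continuousWithinAt
  · convert measurable_const (a := (Classical.arbitrary (Plane V)))
    rename_i z
    exact dif_neg z.2

/-- The image of a plane under a linear isometry. -/
def Plane.map {V' : Type*} [NormedAddCommGroup V'] [InnerProductSpace ℝ V'] (L : V ≃ₗᵢ[ℝ] V')
    (S : Plane V) : Plane V' :=
  ⟨S.1.map (L.toLinearEquiv : V →ₗ[ℝ] V'), by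
    rw [LinearEquiv.finrank_map_eq]; exact S.2⟩

theorem Plane.isometry_map {V' : Type*} [NormedAddCommGroup V'] [InnerProductSpace ℝ V']
    [FiniteDimensional ℝ V'] (L : V ≃ₗᵢ[ℝ] V') : Isometry (Plane.map L) := by
  refine Isometry.of_dist_eq fun S T => ?_
  have h : dist (Plane.map L S) (Plane.map L T) ^ 2 = dist S T ^ 2 := by
    rw [Plane.dist_sq_eq (stdOrthonormalBasis ℝ V), Plane.dist_sq_eq ((stdOrthonormalBasis ℝ V).map L)]
    congr 1
    refine Finset.sum_congr rfl fun j _ => ?_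
    have key : ∀ (S : Plane V) (v : V), (Plane.map L S).1.starProjection (L v) =
        L (S.1.starProjection v) := by
      intro S v
      have := Submodule.starProjection_map_apply L S.1 (L v)
      rw [L.symm_apply_apply] at this
      exact this
    rw [OrthonormalBasis.map_apply, key, key, ← map_sub, L.norm_map]
  exact (sq_eq_sq₀ dist_nonneg dist_nonneg).1 h

omit [FiniteDimensional ℝ V] in
theorem Plane.map_symm_map {V' : Type*} [NormedAddCommGroup V'] [InnerProductSpace ℝ V']
    (L : V ≃ₗᵢ[ℝ] V') (S : Plane V) : Plane.map L.symm (Plane.map L S) = S := by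
  apply Subtype.ext
  ext x
  simp [Plane.map]

/-- The isometry of Grassmannians induced by a linear isometry. -/
def Plane.mapEquiv {V' : Type*} [NormedAddCommGroup V'] [InnerProductSpace ℝ V']
    [FiniteDimensional ℝ V'] (L : V ≃ₗᵢ[ℝ] V') : Plane V ≃ᵢ Plane V' where
  toFun := Plane.map L
  invFun := Plane.map L.symm
  left_inv := Plane.map_symm_map L
  right_inv := Plane.map_symm_map L.symm
  isometry_toFun := Plane.isometry_map L

theorem map_fubiniStudyVolume {V' : Type*} [NormedAddCommGroup V'] [InnerProductSpace ℝ V']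
    [FiniteDimensional ℝ V'] (L : V ≃ₗᵢ[ℝ] V') :
    (fubiniStudyVolume V).map (Plane.map L) = fubiniStudyVolume V' := by
  have h : Module.finrank ℝ V' = Module.finrank ℝ V := L.toLinearEquiv.finrank_eq.symm
  unfold fubiniStudyVolume
  rw [h]
  exact (Plane.mapEquiv L).map_hausdorffMeasure _

omit [FiniteDimensional ℝ V] in
theorem gramDet_map {V' : Type*} [NormedAddCommGroup V'] [InnerProductSpace ℝ V']
    (L : V ≃ₗᵢ[ℝ] V') (X Y : V) : gramDet (L X) (L Y) = gramDet X Y := by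
  simp [gramDet]

omit [FiniteDimensional ℝ V] in
theorem Plane.map_ofPair {V' : Type*} [NormedAddCommGroup V'] [InnerProductSpace ℝ V']
    (L : V ≃ₗᵢ[ℝ] V') {X Y : V} (h : gramDet X Y ≠ 0) :
    Plane.map L (Plane.ofPair X Y h) = Plane.ofPair (L X) (L Y) (by rwa [gramDet_map]) := by
  refine Plane.eq_ofPair _ ?_ ?_ _
  · exact Submodule.mem_map_of_mem (Submodule.subset_span (by simp))
  · exact Submodule.mem_map_of_mem (Submodule.subset_span (by simp))

theorem Plane.exists_map_eq (S T : Plane V) : ∃ L : V ≃ₗᵢ[ℝ] V, Plane.map L S = T := by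
  let f : S.1 ≃ₗᵢ[ℝ] T.1 := ((stdOrthonormalBasis ℝ S.1).reindex (finCongr S.2)).repr.trans
    ((stdOrthonormalBasis ℝ T.1).reindex (finCongr T.2)).repr.symm
  let L : V ≃ₗᵢ[ℝ] V :=
    ((T.1.subtypeₗᵢ.comp f.toLinearIsometry).extend).toLinearIsometryEquiv rfl
  refine ⟨L, Subtype.ext (Submodule.eq_of_le_of_finrank_eq ?_ ((Plane.map L S).2.trans T.2.symm))⟩
  rintro _ ⟨x, hx, rfl⟩
  have h : L x = f ⟨x, hx⟩ :=
    LinearIsometry.extend_apply (T.1.subtypeₗᵢ.comp f.toLinearIsometry) ⟨x, hx⟩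
  change L x ∈ T.1
  rw [h]
  exact (f ⟨x, hx⟩).2

end PlaneMetric

section GrassmannianVolume

open Topology Metric

variable {V : Type*} [NormedAddCommGroup V] [InnerProductSpace ℝ V] [FiniteDimensional ℝ V]

omit [FiniteDimensional ℝ V] in
theorem norm_eq_one_of_inner_self {X : V} (h : inner ℝ X X = (1 : ℝ)) : ‖X‖ = 1 := by
  rwa [real_inner_self_eq_norm_sq, pow_eq_one_iff_of_nonneg (norm_nonneg _) two_ne_zero] at h

instance : CompactSpace (Plane V) := by
  rcases isEmpty_or_nonempty (Plane V) with h | h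
  · infer_instance
  let K : Set (V × V) := {z | inner ℝ z.1 z.1 = (1 : ℝ) ∧ inner ℝ z.2 z.2 = (1 : ℝ) ∧
    inner ℝ z.1 z.2 = (0 : ℝ)}
  have hne : ∀ z ∈ K, gramDet z.1 z.2 ≠ 0 := by
    rintro z ⟨h1, h2, h3⟩
    rw [gramDet, h1, h2, h3]
    norm_num
  have hK : IsCompact K := by
    refine (isCompact_closedBall (0 : V × V) 1).of_isClosed_subset ?_ ?_
    · refine IsClosed.inter ?_ (IsClosed.inter ?_ ?_) <;>
        exact isClosed_eq (by fun_prop) continuous_const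
    · rintro ⟨x, y⟩ ⟨h1, h2, h3⟩
      have hx : ‖x‖ = 1 := by
        exact norm_eq_one_of_inner_self h1
      have hy : ‖y‖ = 1 := by
        exact norm_eq_one_of_inner_self h2
      simp [Prod.norm_def, hx, hy]
  have himg : pairSpan '' K = Set.univ := by
    refine Set.eq_univ_of_forall fun S => ?_
    obtain ⟨X, Y, hX, hY, h1, h2, h3⟩ := S.exists_orthonormal
    have hmem : (X, Y) ∈ K := ⟨h1, h2, h3⟩
    refine ⟨(X, Y), hmem, ?_⟩
    rw [pairSpan_of_ne (hne _ hmem)]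
    exact (S.eq_ofPair hX hY (hne _ hmem)).symm
  refine ⟨himg ▸ hK.image_of_continuousOn fun z hz => ?_⟩
  exact (continuousAt_pairSpan (hne z hz)).continuousWithinAt

variable (V) in
theorem nonempty_plane (h : 2 ≤ Module.finrank ℝ V) : Nonempty (Plane V) := by
  have hb := (stdOrthonormalBasis ℝ V).orthonormal
  rw [orthonormal_iff_ite] at hb
  refine ⟨Plane.ofPair (stdOrthonormalBasis ℝ V ⟨0, by omega⟩)
    (stdOrthonormalBasis ℝ V ⟨1, by omega⟩) ?_⟩
  rw [gramDet, hb, hb, hb]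
  simp

omit [FiniteDimensional ℝ V] in
theorem norm_sub_le_of_dual_pair {e₁ e₂ X X' Y' : V} (he₁ : ‖e₁‖ = 1) (he₂ : ‖e₂‖ = 1)
    (hX₁ : inner ℝ e₁ X = (1 : ℝ)) (hX₂ : inner ℝ e₂ X = (0 : ℝ))
    (hX₁' : inner ℝ e₁ X' = (1 : ℝ)) (hX₂' : inner ℝ e₂ X' = (0 : ℝ))
    (hY₁' : inner ℝ e₁ Y' = (0 : ℝ)) (hY₂' : inner ℝ e₂ Y' = (1 : ℝ))
    (hX' : ‖X'‖ ≤ 2) (hY' : ‖Y'‖ ≤ 2) {p : V} (hp : p ∈ Submodule.span ℝ {X', Y'}) :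
    ‖X - X'‖ ≤ 5 * ‖X - p‖ := by
  obtain ⟨α, β, rfl⟩ := Submodule.mem_span_pair.1 hp
  set r := X - (α • X' + β • Y') with hr
  have h1 : |1 - α| ≤ ‖r‖ := by
    have : inner ℝ e₁ r = 1 - α := by
      simp [hr, inner_sub_right, inner_add_right, real_inner_smul_right, hX₁, hX₁', hY₁']
    have h := abs_real_inner_le_norm e₁ r
    rwa [this, he₁, one_mul] at h
  have h2 : |β| ≤ ‖r‖ := by
    have : inner ℝ e₂ r = -β := by
      simp [hr, inner_sub_right, inner_add_right, real_inner_smul_right, hX₂, hX₂', hY₂']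
    have h := abs_real_inner_le_norm e₂ r
    rwa [this, he₂, one_mul, abs_neg] at h
  have h3 : X - X' = r + (-(1 - α) • X' + β • Y') := by rw [hr]; module
  rw [h3]
  calc ‖r + (-(1 - α) • X' + β • Y')‖ ≤ ‖r‖ + (‖-(1 - α) • X'‖ + ‖β • Y'‖) :=
        (norm_add_le _ _).trans (by gcongr; exact norm_add_le _ _)
    _ = ‖r‖ + (|1 - α| * ‖X'‖ + |β| * ‖Y'‖) := by
        rw [norm_smul, norm_smul, norm_neg, Real.norm_eq_abs, Real.norm_eq_abs]
    _ ≤ ‖r‖ + (‖r‖ * 2 + ‖r‖ * 2) := by gcongr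
    _ = _ := by ring

omit [FiniteDimensional ℝ V] in
theorem exists_graph_chart (S₀ : Plane V) :
    ∃ (e₁ e₂ : V), ‖e₁‖ = 1 ∧ ‖e₂‖ = 1 ∧ inner ℝ e₁ e₂ = (0 : ℝ) ∧ S₀.1 = Submodule.span ℝ {e₁, e₂} := by
  obtain ⟨X, Y, hX, hY, h1, h2, h3⟩ := S₀.exists_orthonormal
  have hne : gramDet X Y ≠ 0 := by
    rw [gramDet, h1, h2, h3]; norm_num
  refine ⟨X, Y, ?_, ?_, h3, ?_⟩
  · exact norm_eq_one_of_inner_self h1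
  · exact norm_eq_one_of_inner_self h2
  · exact congrArg Subtype.val (S₀.eq_ofPair hX hY hne)

section GraphChart

variable (e₁ e₂ : V)

/-- The orthogonal complement of the span of two vectors. -/
abbrev pairCompl : Submodule ℝ V := (Submodule.span ℝ {e₁, e₂})ᗮ

variable {e₁ e₂}

omit [FiniteDimensional ℝ V] in
theorem inner_pairCompl_left (a : pairCompl e₁ e₂) : inner ℝ e₁ (a : V) = (0 : ℝ) :=
  (Submodule.mem_orthogonal _ _).1 a.2 _ (Submodule.subset_span (by simp))

omit [FiniteDimensional ℝ V] in
theorem inner_pairCompl_right (a : pairCompl e₁ e₂) : inner ℝ e₂ (a : V) = (0 : ℝ) :=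
  (Submodule.mem_orthogonal _ _).1 a.2 _ (Submodule.subset_span (by simp))

omit [FiniteDimensional ℝ V] in
theorem gramDet_graph_ne_zero (h₁ : ‖e₁‖ = 1) (h₂ : ‖e₂‖ = 1) (h₁₂ : inner ℝ e₁ e₂ = (0 : ℝ))
    (a b : pairCompl e₁ e₂) : gramDet (e₁ + a) (e₂ + b) ≠ 0 := by
  have ha := inner_pairCompl_left a
  have ha' := inner_pairCompl_right a
  have hb := inner_pairCompl_left b
  have hb' := inner_pairCompl_right b
  refine gramDet_ne_zero_of_linearIndependent (LinearIndependent.pair_iff.2 fun s t hst => ?_)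
  have i1 : inner ℝ e₁ (s • (e₁ + (a : V)) + t • (e₂ + (b : V))) = 0 := by rw [hst, inner_zero_right]
  have i2 : inner ℝ e₂ (s • (e₁ + (a : V)) + t • (e₂ + (b : V))) = 0 := by rw [hst, inner_zero_right]
  simp only [inner_add_right, real_inner_smul_right, ha, ha', hb, hb', h₁₂, real_inner_comm e₁ e₂,
    real_inner_self_eq_norm_sq, h₁, h₂] at i1 i2
  exact ⟨by linarith, by linarith⟩

/-- The parametrization of the planes which are graphs over the span of `e₁`, `e₂`. -/
def graphPlane [Nonempty (Plane V)] (z : pairCompl e₁ e₂ × pairCompl e₁ e₂) : Plane V :=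
  pairSpan (e₁ + z.1, e₂ + z.2)

theorem exists_lipschitzOnWith_graphPlane [Nonempty (Plane V)] (h₁ : ‖e₁‖ = 1) (h₂ : ‖e₂‖ = 1)
    (h₁₂ : inner ℝ e₁ e₂ = (0 : ℝ)) :
    ∃ K, ∃ t ∈ 𝓝 (0 : pairCompl e₁ e₂ × pairCompl e₁ e₂),
      LipschitzOnWith K (graphPlane (e₁ := e₁) (e₂ := e₂)) t := by
  have hcd : ContDiffAt ℝ 1 (fun z => Plane.embedding V (graphPlane (e₁ := e₁) (e₂ := e₂) z)) 0 := by
    rw [contDiffAt_piLp]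
    intro ij
    have : (fun z => (Plane.embedding V (graphPlane (e₁ := e₁) (e₂ := e₂) z)).ofLp ij) = fun z =>
        inner ℝ (stdOrthonormalBasis ℝ V ij.1)
          (pairProj (e₁ + (z.1 : V)) (e₂ + (z.2 : V)) (stdOrthonormalBasis ℝ V ij.2)) / √2 := by
      funext z
      rw [graphPlane, pairSpan_of_ne (gramDet_graph_ne_zero h₁ h₂ h₁₂ z.1 z.2)]
      exact congrArg (fun v => inner ℝ (stdOrthonormalBasis ℝ V ij.1) v / √2)
        (starProjection_ofPair _ _)
    rw [this]
    have hA : ContDiff ℝ 1 fun z : pairCompl e₁ e₂ × pairCompl e₁ e₂ => e₁ + (z.1 : V) :=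
      contDiff_const.add ((pairCompl e₁ e₂).subtypeL.contDiff.comp contDiff_fst)
    have hB : ContDiff ℝ 1 fun z : pairCompl e₁ e₂ × pairCompl e₁ e₂ => e₂ + (z.2 : V) :=
      contDiff_const.add ((pairCompl e₁ e₂).subtypeL.contDiff.comp contDiff_snd)
    refine ContDiffAt.div_const (contDiffAt_const.inner ℝ ?_) _
    unfold pairProj
    refine ContDiffAt.smul (ContDiffAt.inv ?_ (gramDet_graph_ne_zero h₁ h₂ h₁₂ _ _)) ?_
    · unfold gramDet
      exact (((hA.inner ℝ hA).mul (hB.inner ℝ hB)).sub ((hA.inner ℝ hB).pow 2)).contDiffAt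
    · refine ContDiff.contDiffAt (ContDiff.add (ContDiff.smul ?_ hA) (ContDiff.smul ?_ hB))
      · exact ((hB.inner ℝ hB).mul (hA.inner ℝ contDiff_const)).sub
          ((hA.inner ℝ hB).mul (hB.inner ℝ contDiff_const))
      · exact ((hA.inner ℝ hA).mul (hB.inner ℝ contDiff_const)).sub
          ((hA.inner ℝ hB).mul (hA.inner ℝ contDiff_const))
  obtain ⟨K, t, ht, hK⟩ := hcd.exists_lipschitzOnWith
  exact ⟨K, t, ht, fun x hx y hy => hK hx hy⟩

theorem graphPlane_image_mem_nhds [Nonempty (Plane V)] (h₁ : ‖e₁‖ = 1) (h₂ : ‖e₂‖ = 1)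
    (h₁₂ : inner ℝ e₁ e₂ = (0 : ℝ)) (S₀ : Plane V) (hS₀ : S₀.1 = Submodule.span ℝ {e₁, e₂})
    {t : Set (pairCompl e₁ e₂ × pairCompl e₁ e₂)} (ht : t ∈ 𝓝 0) :
    graphPlane '' t ∈ 𝓝 S₀ := by
  let m : V → V → Plane V → ℝ := fun u v S => inner ℝ u (S.1.starProjection v)
  have hm : ∀ u v, Continuous (m u v) := fun u v =>
    continuous_const.inner (Plane.continuous_starProjection v)
  let δ : Plane V → ℝ := fun S => m e₁ e₁ S * m e₂ e₂ S - m e₁ e₂ S * m e₂ e₁ S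
  have hδ : Continuous δ := ((hm _ _).mul (hm _ _)).sub ((hm _ _).mul (hm _ _))
  have hP₁ : S₀.1.starProjection e₁ = e₁ :=
    Submodule.starProjection_eq_self_iff.2 (hS₀ ▸ Submodule.subset_span (by simp))
  have hP₂ : S₀.1.starProjection e₂ = e₂ :=
    Submodule.starProjection_eq_self_iff.2 (hS₀ ▸ Submodule.subset_span (by simp))
  have i11 : inner ℝ e₁ e₁ = (1 : ℝ) := by rw [real_inner_self_eq_norm_sq, h₁]; norm_num
  have i22 : inner ℝ e₂ e₂ = (1 : ℝ) := by rw [real_inner_self_eq_norm_sq, h₂]; norm_num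
  have i21 : inner ℝ e₂ e₁ = (0 : ℝ) := by rw [real_inner_comm, h₁₂]
  have hδ0 : δ S₀ = 1 := by simp only [δ, m, hP₁, hP₂, i11, i22, i21, h₁₂]; norm_num
  let f₁ : Plane V → V := fun S => (δ S)⁻¹ •
    (m e₂ e₂ S • S.1.starProjection e₁ - m e₂ e₁ S • S.1.starProjection e₂)
  let f₂ : Plane V → V := fun S => (δ S)⁻¹ •
    (m e₁ e₁ S • S.1.starProjection e₂ - m e₁ e₂ S • S.1.starProjection e₁)
  have hδn : ∀ᶠ S in 𝓝 S₀, δ S ≠ 0 := hδ.continuousAt.eventually_ne (by rw [hδ0]; norm_num)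
  have hf₁ : ContinuousAt f₁ S₀ := (hδ.continuousAt.inv₀ (by rw [hδ0]; norm_num)).smul
    (((hm _ _).smul (Plane.continuous_starProjection _)).sub
      ((hm _ _).smul (Plane.continuous_starProjection _))).continuousAt
  have hf₂ : ContinuousAt f₂ S₀ := (hδ.continuousAt.inv₀ (by rw [hδ0]; norm_num)).smul
    (((hm _ _).smul (Plane.continuous_starProjection _)).sub
      ((hm _ _).smul (Plane.continuous_starProjection _))).continuousAt
  let q : V →L[ℝ] pairCompl e₁ e₂ := (pairCompl e₁ e₂).orthogonalProjectionOnto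
  let G : Plane V → pairCompl e₁ e₂ × pairCompl e₁ e₂ := fun S => (q (f₁ S), q (f₂ S))
  have hq : ∀ v : V, inner ℝ e₁ v = (0 : ℝ) → inner ℝ e₂ v = (0 : ℝ) → v ∈ pairCompl e₁ e₂ := by
    intro v hv₁ hv₂ w hw
    obtain ⟨a, b, rfl⟩ := Submodule.mem_span_pair.1 hw
    rw [inner_add_left, real_inner_smul_left, real_inner_smul_left, hv₁, hv₂]
    ring
  have hqe₁ : q e₁ = 0 := Submodule.orthogonalProjectionOnto_eq_zero_iff.2
    (Submodule.le_orthogonal_orthogonal _ (Submodule.subset_span (by simp)))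
  have hqe₂ : q e₂ = 0 := Submodule.orthogonalProjectionOnto_eq_zero_iff.2
    (Submodule.le_orthogonal_orthogonal _ (Submodule.subset_span (by simp)))
  have hqv : ∀ (e v : V), q e = 0 → (v - e) ∈ pairCompl e₁ e₂ → e + (q v : V) = v := by
    intro e v he hv
    have : (q (v - e) : V) = v - e := Submodule.starProjection_eq_self_iff.2 hv
    rw [map_sub, he, sub_zero] at this
    rw [this]; abel
  have hGc : ContinuousAt G S₀ :=
    (q.continuous.continuousAt.comp hf₁).prodMk (q.continuous.continuousAt.comp hf₂)
  have hG0 : G S₀ = 0 := by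
    have e1 : f₁ S₀ = e₁ := by simp only [f₁, hδ0, m, hP₁, hP₂, i22, i21]; simp
    have e2 : f₂ S₀ = e₂ := by simp only [f₂, hδ0, m, hP₁, hP₂, i11, h₁₂]; simp
    simp only [G, e1, e2, hqe₁, hqe₂]; rfl
  filter_upwards [hδn, hGc.preimage_mem_nhds (by rw [hG0]; exact ht)] with S hS hSt
  refine ⟨G S, hSt, ?_⟩
  have hg₁ : e₁ + (q (f₁ S) : V) = f₁ S := by
    refine hqv _ _ hqe₁ (hq _ ?_ ?_)
    · simp only [f₁, inner_sub_right, real_inner_smul_right, i11]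
      change (δ S)⁻¹ * (m e₂ e₂ S * m e₁ e₁ S - m e₂ e₁ S * m e₁ e₂ S) - 1 = 0
      have : m e₂ e₂ S * m e₁ e₁ S - m e₂ e₁ S * m e₁ e₂ S = δ S := by simp only [δ]; ring
      rw [this, inv_mul_cancel₀ hS, sub_self]
    · simp only [f₁, inner_sub_right, real_inner_smul_right, i21]
      change (δ S)⁻¹ * (m e₂ e₂ S * m e₂ e₁ S - m e₂ e₁ S * m e₂ e₂ S) - 0 = 0
      ring
  have hg₂ : e₂ + (q (f₂ S) : V) = f₂ S := by
    refine hqv _ _ hqe₂ (hq _ ?_ ?_)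
    · simp only [f₂, inner_sub_right, real_inner_smul_right, h₁₂]
      change (δ S)⁻¹ * (m e₁ e₁ S * m e₁ e₂ S - m e₁ e₂ S * m e₁ e₁ S) - 0 = 0
      ring
    · simp only [f₂, inner_sub_right, real_inner_smul_right, i22]
      change (δ S)⁻¹ * (m e₁ e₁ S * m e₂ e₂ S - m e₁ e₂ S * m e₂ e₁ S) - 1 = 0
      have : m e₁ e₁ S * m e₂ e₂ S - m e₁ e₂ S * m e₂ e₁ S = δ S := rfl
      rw [this, inv_mul_cancel₀ hS, sub_self]
  have hne := gramDet_graph_ne_zero h₁ h₂ h₁₂ (G S).1 (G S).2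
  rw [graphPlane, pairSpan_of_ne hne]
  refine (S.eq_ofPair ?_ ?_ hne).symm
  · change e₁ + (q (f₁ S) : V) ∈ S.1
    rw [hg₁]
    exact Submodule.smul_mem _ _ (Submodule.sub_mem _
      (Submodule.smul_mem _ _ (Submodule.starProjection_apply_mem _ _))
      (Submodule.smul_mem _ _ (Submodule.starProjection_apply_mem _ _)))
  · change e₂ + (q (f₂ S) : V) ∈ S.1
    rw [hg₂]
    exact Submodule.smul_mem _ _ (Submodule.sub_mem _
      (Submodule.smul_mem _ _ (Submodule.starProjection_apply_mem _ _))
      (Submodule.smul_mem _ _ (Submodule.starProjection_apply_mem _ _)))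

theorem dist_le_dist_graphPlane [Nonempty (Plane V)] (h₁ : ‖e₁‖ = 1) (h₂ : ‖e₂‖ = 1)
    (h₁₂ : inner ℝ e₁ e₂ = (0 : ℝ)) {z z' : pairCompl e₁ e₂ × pairCompl e₁ e₂}
    (hz : ‖z‖ ≤ 1) (hz' : ‖z'‖ ≤ 1) :
    dist z z' ≤ 20 * dist (graphPlane z) (graphPlane z') := by
  have hne := gramDet_graph_ne_zero h₁ h₂ h₁₂ z.1 z.2
  have hne' := gramDet_graph_ne_zero h₁ h₂ h₁₂ z'.1 z'.2
  have i11 : inner ℝ e₁ e₁ = (1 : ℝ) := by rw [real_inner_self_eq_norm_sq, h₁]; norm_num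
  have i22 : inner ℝ e₂ e₂ = (1 : ℝ) := by rw [real_inner_self_eq_norm_sq, h₂]; norm_num
  have i21 : inner ℝ e₂ e₁ = (0 : ℝ) := by rw [real_inner_comm, h₁₂]
  have hle : ∀ (e : V) (a : pairCompl e₁ e₂), ‖e‖ = 1 → ‖a‖ ≤ 1 → ‖e + (a : V)‖ ≤ 2 := by
    intro e a he ha
    calc _ ≤ ‖e‖ + ‖(a : V)‖ := norm_add_le _ _
      _ ≤ 1 + 1 := add_le_add he.le ha
      _ = 2 := by norm_num
  have hz1 := (norm_fst_le z).trans hz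
  have hz2 := (norm_snd_le z).trans hz
  have hz1' := (norm_fst_le z').trans hz'
  have hz2' := (norm_snd_le z').trans hz'
  set S := graphPlane z with hS
  set S' := graphPlane z' with hS'
  have hSe : S.1 = Submodule.span ℝ {e₁ + (z.1 : V), e₂ + (z.2 : V)} := by
    rw [hS, graphPlane, pairSpan_of_ne hne]; rfl
  have hSe' : S'.1 = Submodule.span ℝ {e₁ + (z'.1 : V), e₂ + (z'.2 : V)} := by
    rw [hS', graphPlane, pairSpan_of_ne hne']; rfl
  have hproj : ∀ X ∈ S.1, ‖X‖ ≤ 2 → ‖X - S'.1.starProjection X‖ ≤ 4 * dist S S' := by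
    intro X hX hX2
    have := Plane.norm_starProjection_sub_le S S' X
    rw [Submodule.starProjection_eq_self_iff.2 hX] at this
    have hs : √2 ≤ 2 := by rw [Real.sqrt_le_left (by norm_num)]; norm_num
    calc _ ≤ √2 * dist S S' * ‖X‖ := this
      _ ≤ 2 * dist S S' * 2 := by gcongr
      _ = _ := by ring
  rw [Prod.dist_eq]
  refine max_le ?_ ?_
  · have hX : e₁ + (z.1 : V) ∈ S.1 := hSe ▸ Submodule.subset_span (by simp)
    have key := norm_sub_le_of_dual_pair (X := e₁ + (z.1 : V)) (X' := e₁ + (z'.1 : V))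
      (Y' := e₂ + (z'.2 : V)) h₁ h₂
      (by rw [inner_add_right, inner_pairCompl_left, i11, add_zero])
      (by rw [inner_add_right, inner_pairCompl_right, i21, add_zero])
      (by rw [inner_add_right, inner_pairCompl_left, i11, add_zero])
      (by rw [inner_add_right, inner_pairCompl_right, i21, add_zero])
      (by rw [inner_add_right, inner_pairCompl_left, h₁₂, add_zero])
      (by rw [inner_add_right, inner_pairCompl_right, i22, add_zero])
      (hle _ _ h₁ hz1') (hle _ _ h₂ hz2')
      (p := S'.1.starProjection (e₁ + (z.1 : V)))
      (hSe'.le (Submodule.starProjection_apply_mem S'.1 (e₁ + (z.1 : V))))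
    have h4 := hproj _ hX (hle _ _ h₁ hz1)
    have : dist z.1 z'.1 = ‖e₁ + (z.1 : V) - (e₁ + (z'.1 : V))‖ := by
      rw [add_sub_add_left_eq_sub, dist_eq_norm]; rfl
    rw [this]
    linarith
  · have hX : e₂ + (z.2 : V) ∈ S.1 := hSe ▸ Submodule.subset_span (by simp)
    have key := norm_sub_le_of_dual_pair (X := e₂ + (z.2 : V)) (X' := e₂ + (z'.2 : V))
      (Y' := e₁ + (z'.1 : V)) h₂ h₁
      (by rw [inner_add_right, inner_pairCompl_right, i22, add_zero])
      (by rw [inner_add_right, inner_pairCompl_left, h₁₂, add_zero])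
      (by rw [inner_add_right, inner_pairCompl_right, i22, add_zero])
      (by rw [inner_add_right, inner_pairCompl_left, h₁₂, add_zero])
      (by rw [inner_add_right, inner_pairCompl_right, i21, add_zero])
      (by rw [inner_add_right, inner_pairCompl_left, i11, add_zero])
      (hle _ _ h₂ hz2') (hle _ _ h₁ hz1')
      (p := S'.1.starProjection (e₂ + (z.2 : V)))
      (by rw [Set.pair_comm]; exact hSe'.le (Submodule.starProjection_apply_mem S'.1 (e₂ + (z.2 : V))))
    have h4 := hproj _ hX (hle _ _ h₂ hz2)
    have : dist z.2 z'.2 = ‖e₂ + (z.2 : V) - (e₂ + (z'.2 : V))‖ := by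
      rw [add_sub_add_left_eq_sub, dist_eq_norm]; rfl
    rw [this]
    linarith

theorem finrank_pairCompl_prod (S₀ : Plane V) (hS₀ : S₀.1 = Submodule.span ℝ {e₁, e₂}) :
    Module.finrank ℝ (pairCompl e₁ e₂ × pairCompl e₁ e₂) = 2 * (Module.finrank ℝ V - 2) := by
  have h := Submodule.finrank_add_finrank_orthogonal (Submodule.span ℝ {e₁, e₂})
  have h2 := S₀.2
  rw [hS₀] at h2
  rw [Module.finrank_prod]
  change _ + Module.finrank ℝ (pairCompl e₁ e₂) = _ at h
  omega

end GraphChart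

instance isFiniteMeasure_fubiniStudyVolume : IsFiniteMeasure (fubiniStudyVolume V) := by
  refine ⟨isCompact_univ.measure_lt_top_of_nhdsWithin fun S₀ _ => ?_⟩
  obtain ⟨e₁, e₂, h₁, h₂, h₁₂, hS₀⟩ := exists_graph_chart S₀
  have : Nonempty (Plane V) := ⟨S₀⟩
  let _ : MeasurableSpace (pairCompl e₁ e₂) := borel _
  have : BorelSpace (pairCompl e₁ e₂) := ⟨rfl⟩
  obtain ⟨K, t, ht, hK⟩ := exists_lipschitzOnWith_graphPlane h₁ h₂ h₁₂
  refine ⟨graphPlane '' (t ∩ closedBall 0 1), ?_, ?_⟩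
  · rw [nhdsWithin_univ]
    exact graphPlane_image_mem_nhds h₁ h₂ h₁₂ S₀ hS₀
      (Filter.inter_mem ht (closedBall_mem_nhds _ one_pos))
  · unfold fubiniStudyVolume
    rw [← finrank_pairCompl_prod S₀ hS₀]
    refine ((hK.mono Set.inter_subset_left).hausdorffMeasure_image_le (Nat.cast_nonneg _)).trans_lt ?_
    refine ENNReal.mul_lt_top (ENNReal.rpow_lt_top_of_nonneg (Nat.cast_nonneg _) ENNReal.coe_ne_top) ?_
    exact (measure_mono Set.inter_subset_right).trans_lt (isCompact_closedBall _ _).measure_lt_top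

theorem fubiniStudyVolume_ne_zero (hV : 2 ≤ Module.finrank ℝ V) : fubiniStudyVolume V ≠ 0 := by
  have hne := nonempty_plane V hV
  obtain ⟨S₀⟩ := hne
  obtain ⟨e₁, e₂, h₁, h₂, h₁₂, hS₀⟩ := exists_graph_chart S₀
  have : Nonempty (Plane V) := ⟨S₀⟩
  let _ : MeasurableSpace (pairCompl e₁ e₂) := borel _
  have : BorelSpace (pairCompl e₁ e₂) := ⟨rfl⟩
  intro h0
  let B : Set (pairCompl e₁ e₂ × pairCompl e₁ e₂) := closedBall 0 1
  let f : B → Plane V := fun z => graphPlane z.1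
  have hf : AntilipschitzWith 20 f := by
    refine AntilipschitzWith.of_le_mul_dist fun z z' => ?_
    exact dist_le_dist_graphPlane h₁ h₂ h₁₂ (mem_closedBall_zero_iff.1 z.2)
      (mem_closedBall_zero_iff.1 z'.2)
  have h := hf.hausdorffMeasure_preimage_le
    (d := (Module.finrank ℝ (pairCompl e₁ e₂ × pairCompl e₁ e₂) : ℝ)) (Nat.cast_nonneg _) Set.univ
  have hz : (μH[(Module.finrank ℝ (pairCompl e₁ e₂ × pairCompl e₁ e₂) : ℝ)] : Measure (Plane V)) = 0 := by
    rw [finrank_pairCompl_prod S₀ hS₀]; exact h0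
  rw [hz, Set.preimage_univ, Measure.coe_zero, Pi.zero_apply, mul_zero, nonpos_iff_eq_zero] at h
  have himg := (isometry_subtype_coe (s := B)).hausdorffMeasure_image
    (d := (Module.finrank ℝ (pairCompl e₁ e₂ × pairCompl e₁ e₂) : ℝ)) (Or.inl (Nat.cast_nonneg _)) Set.univ
  rw [h, Set.image_univ, Subtype.range_coe] at himg
  exact (measure_closedBall_pos _ (0 : pairCompl e₁ e₂ × pairCompl e₁ e₂) one_pos).ne' himg

theorem measure_ball_eq_of_invariant {μ : Measure (Plane V)}
    (hμ : ∀ L : V ≃ₗᵢ[ℝ] V, μ.map (Plane.map L) = μ) (S T : Plane V) (r : ℝ) :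
    μ (ball S r) = μ (ball T r) := by
  obtain ⟨L, hL⟩ := Plane.exists_map_eq S T
  have h := congrArg (fun ν => ν (ball T r)) (hμ L)
  rw [Measure.map_apply (Plane.isometry_map L).continuous.measurable measurableSet_ball, ← hL,
    (Plane.isometry_map L).preimage_ball] at h
  rw [h, hL]

/-- A finite measure on the Grassmannian which is invariant under isometries is a multiple of the
volume. -/
theorem smul_eq_smul_fubiniStudyVolume {μ : Measure (Plane V)} [IsFiniteMeasure μ]
    (hμ : ∀ L : V ≃ₗᵢ[ℝ] V, μ.map (Plane.map L) = μ) (hV : 2 ≤ Module.finrank ℝ V) :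
    fubiniStudyVolume V Set.univ • μ = μ Set.univ • fubiniStudyVolume V := by
  rcases eq_or_ne μ 0 with rfl | h0
  · simp
  obtain ⟨c, hc⟩ := eq_smul_of_homogeneous h0 (fubiniStudyVolume_ne_zero hV)
    (measure_ball_eq_of_invariant hμ) (measure_ball_eq_of_invariant map_fubiniStudyVolume)
  rw [hc, Measure.smul_apply, smul_smul, smul_eq_mul, mul_comm]

end GrassmannianVolume

theorem exists_smul_addHaar_eq {E : Type*} [NormedAddCommGroup E] [NormedSpace ℝ E]
    [FiniteDimensional ℝ E] [MeasurableSpace E] [BorelSpace E] (μ ν : Measure E)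
    [μ.IsAddHaarMeasure] [ν.IsAddHaarMeasure] :
    ∃ c : ENNReal, c ≠ 0 ∧ c ≠ ⊤ ∧ μ = c • ν :=
  ⟨Measure.addHaarScalarFactor μ ν, by
    simpa using (Measure.addHaarScalarFactor_pos_of_isAddHaarMeasure μ ν).ne', ENNReal.coe_ne_top,
    Measure.isAddLeftInvariant_eq_smul μ ν⟩

section GaussianWeight

open scoped ENNReal

variable {V : Type*} [NormedAddCommGroup V] [InnerProductSpace ℝ V]

/-- The Gaussian weight `exp (-‖x‖² / 2)`. -/
def gaussianWeight (x : V) : ℝ≥0∞ := ENNReal.ofReal (Real.exp (-(1 / 2) * ‖x‖ ^ 2))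

theorem continuous_gaussianWeight : Continuous (gaussianWeight (V := V)) := by
  unfold gaussianWeight
  exact ENNReal.continuous_ofReal.comp (by fun_prop)

theorem gaussianWeight_ne_zero (x : V) : gaussianWeight x ≠ 0 := by
  simp [gaussianWeight, Real.exp_pos]

variable [FiniteDimensional ℝ V] [MeasurableSpace V] [BorelSpace V]

theorem measurable_gaussianWeight : Measurable (gaussianWeight (V := V)) :=
  continuous_gaussianWeight.measurable

theorem lintegral_gaussianWeight_ne_zero (μ : Measure V) [μ.IsAddHaarMeasure] :
    ∫⁻ x, gaussianWeight x ∂μ ≠ 0 := by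
  have h : Function.support (gaussianWeight (V := V)) = Set.univ :=
    Set.eq_univ_of_forall gaussianWeight_ne_zero
  rw [← pos_iff_ne_zero, lintegral_pos_iff_support measurable_gaussianWeight, h]
  exact isOpen_univ.measure_pos μ Set.univ_nonempty

theorem lintegral_gaussianWeight_volume_ne_top :
    ∫⁻ x : V, gaussianWeight x ≠ ⊤ := by
  have h : Integrable fun x : V => Real.exp (-(1 / 2) * ‖x‖ ^ 2) := by
    by_contra h
    have h2 := GaussianFourier.integral_rexp_neg_mul_sq_norm (V := V) (b := 1 / 2) (by norm_num)
    rw [integral_undef h] at h2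
    have : 0 < (Real.pi / (1 / 2)) ^ (Module.finrank ℝ V / 2 : ℝ) := by positivity
    linarith
  unfold gaussianWeight
  exact h.lintegral_lt_top.ne

variable (V) in
/-- The standard Gaussian probability measure. -/
def gaussian : Measure V := (∫⁻ x : V, gaussianWeight x)⁻¹ • volume.withDensity gaussianWeight

instance : IsProbabilityMeasure (gaussian V) := by
  refine ⟨?_⟩
  rw [gaussian, Measure.smul_apply, withDensity_apply _ MeasurableSet.univ, Measure.restrict_univ,
    smul_eq_mul, ENNReal.inv_mul_cancel (lintegral_gaussianWeight_ne_zero _)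
      lintegral_gaussianWeight_volume_ne_top]

theorem gaussian_absolutelyContinuous : gaussian V ≪ (volume : Measure V) :=
  (withDensity_absolutelyContinuous _ _).smul_left _

theorem gaussian_eq (μ : Measure V) [μ.IsAddHaarMeasure] :
    gaussian V = (∫⁻ x : V, gaussianWeight x ∂μ)⁻¹ • μ.withDensity gaussianWeight := by
  obtain ⟨c, hc0, hct, hc⟩ := exists_smul_addHaar_eq μ (volume : Measure V)
  rw [gaussian, hc, lintegral_smul_measure, withDensity_smul_measure, smul_smul, smul_eq_mul,
    ENNReal.mul_inv (Or.inl hc0) (Or.inl hct), mul_right_comm, ENNReal.inv_mul_cancel hc0 hct, one_mul]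

/-- The Gaussian measure in terms of linear coordinates. -/
theorem gaussian_eq_map {E : Type*} [NormedAddCommGroup E] [NormedSpace ℝ E] [MeasurableSpace E]
    [BorelSpace E] (A : E ≃L[ℝ] V) (μ : Measure E) [μ.IsAddHaarMeasure] :
    gaussian V = (∫⁻ x, gaussianWeight (A x) ∂μ)⁻¹ •
      (μ.withDensity fun x => gaussianWeight (A x)).map A := by
  have : (μ.map A).IsAddHaarMeasure := A.isAddHaarMeasure_map μ
  rw [gaussian_eq (μ.map A), lintegral_map measurable_gaussianWeight A.continuous.measurable]
  congr 1
  ext s hs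
  rw [withDensity_apply _ hs, Measure.map_apply A.continuous.measurable hs,
    withDensity_apply _ (A.continuous.measurable hs),
    setLIntegral_map hs measurable_gaussianWeight A.continuous.measurable]

theorem gaussian_map {V' : Type*} [NormedAddCommGroup V'] [InnerProductSpace ℝ V']
    [FiniteDimensional ℝ V'] [MeasurableSpace V'] [BorelSpace V'] (L : V ≃ₗᵢ[ℝ] V') :
    (gaussian V).map L = gaussian V' := by
  have hw : ∀ x, gaussianWeight (L.toContinuousLinearEquiv x) = gaussianWeight x := fun x => by
    simp [gaussianWeight]
  rw [gaussian_eq_map L.toContinuousLinearEquiv (volume : Measure V)]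
  simp only [hw]
  rw [gaussian, Measure.map_smul]
  rfl

theorem gaussian_map_prod {Z W : Type*} [NormedAddCommGroup Z] [InnerProductSpace ℝ Z]
    [FiniteDimensional ℝ Z] [MeasurableSpace Z] [BorelSpace Z] [NormedAddCommGroup W]
    [InnerProductSpace ℝ W] [FiniteDimensional ℝ W] [MeasurableSpace W] [BorelSpace W]
    (e : Z ≃L[ℝ] V × W) (he : ∀ z, ‖z‖ ^ 2 = ‖(e z).1‖ ^ 2 + ‖(e z).2‖ ^ 2) :
    (gaussian Z).map e = (gaussian V).prod (gaussian W) := by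
  have hw : ∀ x : V × W, gaussianWeight (e.symm x) = gaussianWeight x.1 * gaussianWeight x.2 := by
    intro x
    rw [gaussianWeight, gaussianWeight, gaussianWeight, he, ContinuousLinearEquiv.apply_symm_apply,
      ← ENNReal.ofReal_mul (Real.exp_pos _).le, ← Real.exp_add, mul_add]
  rw [gaussian_eq_map e.symm ((volume : Measure V).prod (volume : Measure W))]
  simp only [hw]
  rw [lintegral_prod_mul measurable_gaussianWeight.aemeasurable measurable_gaussianWeight.aemeasurable,
    ← prod_withDensity measurable_gaussianWeight measurable_gaussianWeight, Measure.map_smul,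
    Measure.map_map e.continuous.measurable e.symm.continuous.measurable]
  have : (e ∘ e.symm : V × W → V × W) = id := by ext x <;> simp
  rw [this, Measure.map_id, gaussian, gaussian, Measure.prod_smul_left, Measure.prod_smul_right,
    smul_smul, ENNReal.mul_inv (Or.inl (lintegral_gaussianWeight_ne_zero _))
      (Or.inl lintegral_gaussianWeight_volume_ne_top)]

theorem ae_gramDet_ne_zero (hV : 2 ≤ Module.finrank ℝ V) :
    ∀ᵐ z ∂(gaussian V).prod (gaussian V), gramDet z.1 z.2 ≠ 0 := by
  have hmeas : MeasurableSet {z : V × V | gramDet z.1 z.2 ≠ 0} :=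
    (isOpen_ne_fun continuous_gramDet continuous_const).measurableSet
  rw [Measure.ae_prod_iff_ae_ae hmeas]
  have : Nontrivial V := Module.nontrivial_of_finrank_pos (R := ℝ) (by omega)
  have h0 : ∀ᵐ x ∂gaussian V, x ≠ 0 := by
    refine gaussian_absolutelyContinuous.ae_le (?_ : ∀ᵐ x : V, x ≠ 0)
    rw [ae_iff]
    simp
  filter_upwards [h0] with x hx
  refine gaussian_absolutelyContinuous.ae_le (?_ : ∀ᵐ y : V, gramDet x y ≠ 0)
  have hsub : Submodule.span ℝ {x} ≠ ⊤ := by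
    intro h
    have h1 := finrank_span_singleton (K := ℝ) hx
    rw [h, finrank_top] at h1
    omega
  have hnull := Measure.addHaar_submodule (volume : Measure V) _ hsub
  rw [ae_iff]
  refine measure_mono_null (fun y hy => ?_) hnull
  simp only [Set.mem_ofPred_eq, not_not] at hy
  by_contra hmem
  refine gramDet_ne_zero_of_linearIndependent (X := x) (Y := y) ?_ hy
  rw [LinearIndependent.pair_iff' hx]
  intro a ha
  exact hmem (Submodule.mem_span_singleton.2 ⟨a, ha⟩)

theorem pairSpan_map [Nonempty (Plane V)] (L : V ≃ₗᵢ[ℝ] V) {z : V × V}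
    (hz : gramDet z.1 z.2 ≠ 0) : Plane.map L (pairSpan z) = pairSpan (L z.1, L z.2) := by
  rw [pairSpan_of_ne hz, Plane.map_ofPair, pairSpan_of_ne]

variable (V) in
/-- The uniform probability measure on the Grassmannian of planes. -/
def uniformPlane : Measure (Plane V) := (fubiniStudyVolume V Set.univ)⁻¹ • fubiniStudyVolume V

theorem fubiniStudyVolume_univ_ne_zero (hV : 2 ≤ Module.finrank ℝ V) :
    fubiniStudyVolume V Set.univ ≠ 0 :=
  fun h => fubiniStudyVolume_ne_zero hV (Measure.measure_univ_eq_zero.1 h)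

theorem isProbabilityMeasure_uniformPlane (hV : 2 ≤ Module.finrank ℝ V) :
    IsProbabilityMeasure (uniformPlane V) :=
  ⟨by rw [uniformPlane, Measure.smul_apply, smul_eq_mul,
    ENNReal.inv_mul_cancel (fubiniStudyVolume_univ_ne_zero hV) (measure_ne_top _ _)]⟩

theorem fubiniStudyVolume_eq_smul (hV : 2 ≤ Module.finrank ℝ V) :
    fubiniStudyVolume V = fubiniStudyVolume V Set.univ • uniformPlane V := by
  rw [uniformPlane, smul_smul, ENNReal.mul_inv_cancel (fubiniStudyVolume_univ_ne_zero hV)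
    (measure_ne_top _ _), one_smul]

/-- For a Gaussian pair of vectors, the plane they span is uniformly distributed and independent of
all quantities which are invariant under isometries. -/
theorem map_pairSpan_withDensity [Nonempty (Plane V)] (hV : 2 ≤ Module.finrank ℝ V)
    {f : V × V → ℝ≥0∞} (hf : Measurable f)
    (hinv : ∀ (L : V ≃ₗᵢ[ℝ] V) z, f (L z.1, L z.2) = f z)
    (hfin : ∫⁻ z, f z ∂(gaussian V).prod (gaussian V) ≠ ⊤) :
    (((gaussian V).prod (gaussian V)).withDensity f).map pairSpan =
      (∫⁻ z, f z ∂(gaussian V).prod (gaussian V)) • uniformPlane V := by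
  set Γ := (gaussian V).prod (gaussian V) with hΓ
  set μ := (Γ.withDensity f).map pairSpan with hμ
  have hμu : μ Set.univ = ∫⁻ z, f z ∂Γ := by
    rw [hμ, Measure.map_apply measurable_pairSpan MeasurableSet.univ, Set.preimage_univ,
      withDensity_apply _ MeasurableSet.univ, Measure.restrict_univ]
  have : IsFiniteMeasure μ := ⟨by rw [hμu]; exact hfin.lt_top⟩
  have hLinv : ∀ L : V ≃ₗᵢ[ℝ] V, μ.map (Plane.map L) = μ := by
    intro L
    have hLm : Measurable (Plane.map L) := (Plane.isometry_map L).continuous.measurable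
    have hLL : MeasurePreserving (Prod.map L L) Γ Γ :=
      MeasurePreserving.prod ⟨L.continuous.measurable, gaussian_map L⟩
        ⟨L.continuous.measurable, gaussian_map L⟩
    ext s hs
    rw [Measure.map_apply hLm hs, hμ, Measure.map_apply measurable_pairSpan (hLm hs),
      Measure.map_apply measurable_pairSpan hs, withDensity_apply _ (measurable_pairSpan (hLm hs)),
      withDensity_apply _ (measurable_pairSpan hs)]
    have h1 : (pairSpan ⁻¹' (Plane.map L ⁻¹' s) : Set (V × V)) =ᵐ[Γ]
        Prod.map L L ⁻¹' (pairSpan ⁻¹' s) := by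
      filter_upwards [ae_gramDet_ne_zero hV] with z hz
      change (Plane.map L (pairSpan z) ∈ s) = (pairSpan (L z.1, L z.2) ∈ s)
      rw [pairSpan_map L hz]
    rw [setLIntegral_congr h1, ← hLL.setLIntegral_comp_preimage (measurable_pairSpan hs) hf]
    refine lintegral_congr fun z => ?_
    exact (hinv L z).symm
  have key := smul_eq_smul_fubiniStudyVolume hLinv hV
  rw [uniformPlane, smul_smul, mul_comm, ← smul_smul, ← hμu, ← key, smul_smul,
    ENNReal.inv_mul_cancel (fubiniStudyVolume_univ_ne_zero hV) (measure_ne_top _ _), one_smul]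

end GaussianWeight

section CurvatureTensor

variable {V : Type*} [NormedAddCommGroup V] [InnerProductSpace ℝ V]

/-- The properties of a curvature tensor which are needed for its sectional curvature. -/
structure IsCurvatureTensor (R : V → V → V → V) : Prop where
  add_left : ∀ u u' v w, R (u + u') v w = R u v w + R u' v w
  smul_left : ∀ (c : ℝ) u v w, R (c • u) v w = c • R u v w
  antisymm : ∀ u v w, R u v w = -R v u w
  add_right : ∀ u v w w', R u v (w + w') = R u v w + R u v w'
  smul_right : ∀ (c : ℝ) u v w, R u v (c • w) = c • R u v w
  skew : ∀ u v w z, inner ℝ (R u v w) z = (-inner ℝ (R u v z) w : ℝ)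
  continuous : Continuous fun z : V × V => R z.2 z.1 z.1

/-- The sectional curvature of a pair of vectors. -/
def pairCurvature (R : V → V → V → V) (z : V × V) : ℝ :=
  inner ℝ (R z.2 z.1 z.1) z.2 / gramDet z.1 z.2

theorem IsCurvatureTensor.inner_comb {R : V → V → V → V} (hR : IsCurvatureTensor R) (X Y : V)
    (a b c d : ℝ) :
    inner ℝ (R (c • X + d • Y) (a • X + b • Y) (a • X + b • Y)) (c • X + d • Y) =
      (a * d - b * c) ^ 2 * (inner ℝ (R Y X X) Y : ℝ) := by
  have hself : ∀ u w, R u u w = 0 := fun u w => by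
    have := hR.antisymm u u w
    rwa [eq_neg_iff_add_eq_zero, ← two_smul ℝ, smul_eq_zero_iff_right (by norm_num)] at this
  have hsz : ∀ u v w, inner ℝ (R u v w) w = (0 : ℝ) := fun u v w => by
    have := hR.skew u v w w
    linarith
  have h1 : R (c • X + d • Y) (a • X + b • Y) = fun w => (a * d - b * c) • R Y X w := by
    funext w
    rw [hR.add_left, hR.smul_left, hR.smul_left, hR.antisymm X, hR.antisymm Y, hR.add_left,
      hR.add_left, hR.smul_left, hR.smul_left, hR.smul_left, hR.smul_left, hself, hself,
      hR.antisymm X Y]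
    module
  rw [h1]
  simp only [hR.add_right, hR.smul_right, inner_add_left, inner_add_right, real_inner_smul_left,
    real_inner_smul_right, hsz, hR.skew Y X Y X]
  ring

variable [FiniteDimensional ℝ V]

theorem IsCurvatureTensor.sectionalCurvature_eq {R : V → V → V → V} (hR : IsCurvatureTensor R)
    (S : Plane V) {X Y : V} (hX : X ∈ S.1) (hY : Y ∈ S.1) (h : gramDet X Y ≠ 0) :
    sectionalCurvature R S = pairCurvature R (X, Y) := by
  let b := Module.finBasisOfFinrankEq ℝ S.1 S.2
  have hli : LinearIndependent ℝ ![(b 0 : V), (b 1 : V)] := by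
    have := b.linearIndependent.map' S.1.subtype (Submodule.ker_subtype _)
    have e : ![(b 0 : V), (b 1 : V)] = S.1.subtype ∘ b := by
      funext i
      fin_cases i <;> rfl
    rw [e]
    exact this
  have hb := gramDet_ne_zero_of_linearIndependent hli
  have hS := S.eq_ofPair (b 0).2 (b 1).2 hb
  rw [hS] at hX hY
  obtain ⟨x₁, x₂, rfl⟩ := Submodule.mem_span_pair.1 hX
  obtain ⟨y₁, y₂, rfl⟩ := Submodule.mem_span_pair.1 hY
  change inner ℝ (R (b 1) (b 0) (b 0)) (b 1 : V) / gramDet (b 0 : V) (b 1 : V) = _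
  simp only [pairCurvature]
  rw [gramDet_comb] at h ⊢
  rw [hR.inner_comb, mul_div_mul_left _ _ (left_ne_zero_of_mul h)]

theorem IsCurvatureTensor.sectionalCurvature_pairSpan [Nonempty (Plane V)] {R : V → V → V → V}
    (hR : IsCurvatureTensor R) {z : V × V} (h : gramDet z.1 z.2 ≠ 0) :
    sectionalCurvature R (pairSpan z) = pairCurvature R z := by
  rw [pairSpan_of_ne h]
  exact hR.sectionalCurvature_eq _ (Submodule.subset_span (by simp)) (Submodule.subset_span (by simp)) h

theorem IsCurvatureTensor.continuousAt_pairCurvature {R : V → V → V → V} (hR : IsCurvatureTensor R)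
    {z : V × V} (h : gramDet z.1 z.2 ≠ 0) : ContinuousAt (pairCurvature R) z :=
  ((hR.continuous.inner continuous_snd).continuousAt).div continuous_gramDet.continuousAt h

theorem IsCurvatureTensor.continuous_sectionalCurvature {R : V → V → V → V}
    (hR : IsCurvatureTensor R) : Continuous (sectionalCurvature R) := by
  refine continuous_iff_continuousAt.2 fun S₀ => ?_
  obtain ⟨X, Y, hX, hY, h1, h2, h3⟩ := S₀.exists_orthonormal
  let f : Plane V → V × V := fun S => (S.1.starProjection X, S.1.starProjection Y)
  have hf : Continuous f :=
    (Plane.continuous_starProjection X).prodMk (Plane.continuous_starProjection Y)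
  have hfS : f S₀ = (X, Y) := Prod.ext (Submodule.starProjection_eq_self_iff.2 hX)
    (Submodule.starProjection_eq_self_iff.2 hY)
  have hne : gramDet (f S₀).1 (f S₀).2 ≠ 0 := by
    rw [hfS, gramDet, h1, h2, h3]; norm_num
  have hc : ContinuousAt (fun S => pairCurvature R (f S)) S₀ :=
    ContinuousAt.comp (hR.continuousAt_pairCurvature hne) hf.continuousAt
  refine hc.congr ?_
  filter_upwards [(continuous_gramDet.comp hf).continuousAt.eventually_ne hne] with S hS
  exact (hR.sectionalCurvature_eq S (Submodule.starProjection_apply_mem _ _)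
    (Submodule.starProjection_apply_mem _ _) hS).symm

theorem IsCurvatureTensor.measurable_sectionalCurvature {R : V → V → V → V}
    (hR : IsCurvatureTensor R) : Measurable (sectionalCurvature R) :=
  hR.continuous_sectionalCurvature.measurable

variable [MeasurableSpace V] [BorelSpace V]

theorem IsCurvatureTensor.measurable_pairCurvature {R : V → V → V → V} (hR : IsCurvatureTensor R) :
    Measurable (pairCurvature R) :=
  (hR.continuous.inner continuous_snd).measurable.div continuous_gramDet.measurable

theorem map_pairSpan_gaussian [Nonempty (Plane V)] (hV : 2 ≤ Module.finrank ℝ V) :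
    ((gaussian V).prod (gaussian V)).map pairSpan = uniformPlane V := by
  have h := map_pairSpan_withDensity hV (f := fun _ => 1) measurable_const (fun _ _ => rfl)
    (by simp)
  simpa using h

/-- The sectional curvature of a uniformly distributed plane has the distribution of the sectional
curvature of a Gaussian pair of vectors. -/
theorem IsCurvatureTensor.map_sectionalCurvature {R : V → V → V → V} (hR : IsCurvatureTensor R)
    (hV : 2 ≤ Module.finrank ℝ V) :
    (uniformPlane V).map (sectionalCurvature R) =
      ((gaussian V).prod (gaussian V)).map (pairCurvature R) := by
  have := nonempty_plane V hV
  rw [← map_pairSpan_gaussian hV, Measure.map_map hR.measurable_sectionalCurvature measurable_pairSpan]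
  refine Measure.map_congr ?_
  filter_upwards [ae_gramDet_ne_zero hV] with z hz
  exact hR.sectionalCurvature_pairSpan hz

/-- The squared Jacobian of a linear map on planes is the sectional curvature of this tensor. -/
def areaTensor {W : Type*} [NormedAddCommGroup W] [InnerProductSpace ℝ W] [CompleteSpace W]
    (T : V →L[ℝ] W) (u v w : V) : V :=
  ContinuousLinearMap.adjoint T
    ((inner ℝ (T v) (T w) : ℝ) • T u - (inner ℝ (T u) (T w) : ℝ) • T v)

theorem isCurvatureTensor_areaTensor {W : Type*} [NormedAddCommGroup W] [InnerProductSpace ℝ W]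
    [CompleteSpace W] (T : V →L[ℝ] W) : IsCurvatureTensor (areaTensor T) where
  add_left u u' v w := by
    simp only [areaTensor, ← map_add]
    congr 1
    simp only [map_add, inner_add_left]
    module
  smul_left c u v w := by
    simp only [areaTensor, ← map_smul]
    congr 1
    simp only [map_smul, real_inner_smul_left]
    module
  antisymm u v w := by
    simp only [areaTensor, ← map_neg]
    congr 1
    module
  add_right u v w w' := by
    simp only [areaTensor, ← map_add]
    congr 1
    simp only [map_add, inner_add_right]
    module
  smul_right c u v w := by
    simp only [areaTensor, ← map_smul]
    congr 1
    simp only [map_smul, real_inner_smul_right]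
    module
  skew u v w z := by
    simp only [areaTensor, ContinuousLinearMap.adjoint_inner_left, inner_sub_left,
      real_inner_smul_left]
    ring
  continuous := by
    unfold areaTensor
    fun_prop

theorem pairCurvature_areaTensor {W : Type*} [NormedAddCommGroup W] [InnerProductSpace ℝ W]
    [CompleteSpace W] (T : V →L[ℝ] W) (z : V × V) :
    pairCurvature (areaTensor T) z = gramDet (T z.1) (T z.2) / gramDet z.1 z.2 := by
  simp only [pairCurvature, areaTensor, ContinuousLinearMap.adjoint_inner_left, inner_sub_left,
      real_inner_smul_left]
  rw [real_inner_comm (T z.1) (T z.2)]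
  simp only [gramDet]
  ring

end CurvatureTensor

section Moments

open Set

variable {V : Type*} [NormedAddCommGroup V] [InnerProductSpace ℝ V] [FiniteDimensional ℝ V]
  [MeasurableSpace V] [BorelSpace V]

theorem integrableOn_pow_mul_exp (k : ℕ) :
    IntegrableOn (fun r : ℝ => r ^ k * Real.exp (-(1 / 2) * r ^ 2)) (Ioi 0) := by
  have h := integrable_rpow_mul_exp_neg_mul_sq (b := 1 / 2) (by norm_num) (s := k)
    (by have : (0 : ℝ) ≤ k := Nat.cast_nonneg k
        linarith)
  simpa using h.integrableOn

theorem integral_pow_mul_exp_add_two (k : ℕ) :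
    ∫ r in Ioi (0 : ℝ), r ^ (k + 2) * Real.exp (-(1 / 2) * r ^ 2) =
      (k + 1) * ∫ r in Ioi (0 : ℝ), r ^ k * Real.exp (-(1 / 2) * r ^ 2) := by
  have h : ∀ k : ℕ, ∫ r in Ioi (0 : ℝ), r ^ k * Real.exp (-(1 / 2) * r ^ 2) =
      (1 / 2 : ℝ) ^ (-((k : ℝ) + 1) / 2) * (1 / 2) * Real.Gamma (((k : ℝ) + 1) / 2) := by
    intro k
    have := integral_rpow_mul_exp_neg_mul_rpow (p := 2) (q := k) (b := 1 / 2) (by norm_num)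
      (by have : (0 : ℝ) ≤ k := Nat.cast_nonneg k
          linarith) (by norm_num)
    simpa using this
  rw [h, h]
  have e1 : ((k + 2 : ℕ) : ℝ) + 1 = ((k : ℝ) + 1) + 2 := by push_cast; ring
  have e2 : (((k : ℝ) + 1) + 2) / 2 = ((k : ℝ) + 1) / 2 + 1 := by ring
  have e3 : -(((k : ℝ) + 1) + 2) / 2 = -((k : ℝ) + 1) / 2 + (-1) := by ring
  rw [e1, e2, e3, Real.Gamma_add_one (by positivity), Real.rpow_add (by norm_num),
    Real.rpow_neg_one]
  ring

theorem lintegral_norm_pow_gaussianWeight (hV : 0 < Module.finrank ℝ V) (a : ℕ) :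
    ∫⁻ x : V, ENNReal.ofReal (‖x‖ ^ (2 * a)) * gaussianWeight x =
      ENNReal.ofReal (Module.finrank ℝ V * volume.real (Metric.ball (0 : V) 1) *
        ∫ r in Ioi (0 : ℝ), r ^ (Module.finrank ℝ V - 1 + 2 * a) * Real.exp (-(1 / 2) * r ^ 2)) := by
  have : Nontrivial V := Module.nontrivial_of_finrank_pos (R := ℝ) hV
  have h1 := integral_fun_norm_addHaar (volume : Measure V)
    (fun r => r ^ (2 * a) * Real.exp (-(1 / 2) * r ^ 2))
  have h2 := (integrable_fun_norm_addHaar (volume : Measure V)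
    (f := fun r => r ^ (2 * a) * Real.exp (-(1 / 2) * r ^ 2))).2 (by
      refine (integrableOn_pow_mul_exp (Module.finrank ℝ V - 1 + 2 * a)).congr_fun
        (fun r _ => ?_) measurableSet_Ioi
      simp only [smul_eq_mul]
      rw [pow_add, mul_assoc])
  have h3 : ∫⁻ x : V, ENNReal.ofReal (‖x‖ ^ (2 * a)) * gaussianWeight x =
      ∫⁻ x : V, ENNReal.ofReal (‖x‖ ^ (2 * a) * Real.exp (-(1 / 2) * ‖x‖ ^ 2)) := by
    refine lintegral_congr fun x => ?_
    rw [gaussianWeight, ← ENNReal.ofReal_mul (by positivity)]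
  rw [h3, ← ofReal_integral_eq_lintegral_ofReal h2 (Filter.Eventually.of_forall fun x => by positivity), h1]
  congr 1
  rw [nsmul_eq_mul, smul_eq_mul, mul_assoc]
  congr 2
  refine setIntegral_congr_fun measurableSet_Ioi fun r _ => ?_
  simp only [smul_eq_mul]
  rw [pow_add, mul_assoc]

theorem lintegral_norm_pow_gaussian (a : ℕ) :
    ∫⁻ x : V, ENNReal.ofReal (‖x‖ ^ (2 * a)) ∂gaussian V =
      ((∏ i ∈ Finset.range a, (Module.finrank ℝ V + 2 * i) : ℕ) : ENNReal) := by
  induction a with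
  | zero => simp
  | succ a ih =>
    rcases Nat.eq_zero_or_pos (Module.finrank ℝ V) with h0 | hpos
    · have := Module.finrank_zero_iff.1 h0
      have hz : ∀ x : V, ‖x‖ = 0 := fun x => by rw [Subsingleton.elim x 0, norm_zero]
      rw [Finset.prod_range_succ', h0]
      simp [hz]
    · have hmoment : ∀ b : ℕ, ∫⁻ x : V, ENNReal.ofReal (‖x‖ ^ (2 * b)) ∂gaussian V =
          (∫⁻ x : V, gaussianWeight x)⁻¹ *
            ∫⁻ x : V, ENNReal.ofReal (‖x‖ ^ (2 * b)) * gaussianWeight x := by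
        intro b
        rw [gaussian, lintegral_smul_measure, lintegral_withDensity_eq_lintegral_mul _
          measurable_gaussianWeight (by fun_prop)]
        simp only [Pi.mul_apply, mul_comm, smul_eq_mul]
      rw [Finset.prod_range_succ, Nat.cast_mul, ← ih, hmoment, hmoment,
        lintegral_norm_pow_gaussianWeight hpos, lintegral_norm_pow_gaussianWeight hpos]
      have e1 : Module.finrank ℝ V - 1 + 2 * (a + 1) = Module.finrank ℝ V - 1 + 2 * a + 2 := by ring
      have e2 : (((Module.finrank ℝ V - 1 + 2 * a : ℕ) : ℝ) + 1) = (Module.finrank ℝ V + 2 * a : ℕ) := by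
        rw [← Nat.cast_succ]; congr 1; omega
      rw [e1, integral_pow_mul_exp_add_two, e2, ← ENNReal.ofReal_natCast (Module.finrank ℝ V + 2 * a),
        mul_assoc (∫⁻ x : V, gaussianWeight x)⁻¹, ← ENNReal.ofReal_mul']
      · congr 2; ring
      · positivity

theorem lintegral_gramDet_pow_right (X : V) (a : ℕ) :
    ∫⁻ Y : V, ENNReal.ofReal (gramDet X Y ^ a) ∂gaussian V =
      ENNReal.ofReal (‖X‖ ^ (2 * a)) *
        ((∏ i ∈ Finset.range a, (Module.finrank ℝ V - 1 + 2 * i) : ℕ) : ENNReal) := by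
  rcases eq_or_ne X 0 with rfl | hX
  · rcases Nat.eq_zero_or_pos a with rfl | ha
    · simp
    · simp [gramDet, ha.ne']
  let K := Submodule.span ℝ {X}
  let e : V ≃L[ℝ] K × Kᗮ := K.orthogonalDecomposition.toContinuousLinearEquiv.trans
    (WithLp.prodContinuousLinearEquiv 2 ℝ K Kᗮ)
  have he1 : ∀ z, (e z).1 = K.orthogonalProjectionOnto z := fun z =>
    Submodule.fst_orthogonalDecomposition_apply K z
  have he2 : ∀ z, (e z).2 = Kᗮ.orthogonalProjectionOnto z := fun z =>
    Submodule.snd_orthogonalDecomposition_apply K z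
  have he : ∀ z, ‖z‖ ^ 2 = ‖(e z).1‖ ^ 2 + ‖(e z).2‖ ^ 2 := fun z => by
    rw [he1, he2]
    exact Submodule.norm_sq_eq_add_norm_sq_projection z K
  have hgram : ∀ Y, gramDet X Y = ‖X‖ ^ 2 * ‖(e Y).2‖ ^ 2 := by
    intro Y
    have hY : ((e Y).1 : V) = (inner ℝ X Y / ‖X‖ ^ 2 : ℝ) • X := by
      rw [he1]
      exact Submodule.starProjection_singleton ℝ (v := X) Y
    have hn : ‖(e Y).1‖ ^ 2 = (inner ℝ X Y) ^ 2 / ‖X‖ ^ 2 := by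
      rw [show ‖(e Y).1‖ = ‖((e Y).1 : V)‖ from rfl, hY, norm_smul, mul_pow, Real.norm_eq_abs, sq_abs]
      have : ‖X‖ ≠ 0 := norm_ne_zero_iff.2 hX
      field_simp
    have h2 : ‖(e Y).2‖ ^ 2 = ‖Y‖ ^ 2 - (inner ℝ X Y) ^ 2 / ‖X‖ ^ 2 := by rw [he Y, hn]; ring
    have : ‖X‖ ≠ 0 := norm_ne_zero_iff.2 hX
    rw [h2, gramDet, real_inner_self_eq_norm_sq, real_inner_self_eq_norm_sq]
    field_simp
  have hmap := gaussian_map_prod e he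
  calc ∫⁻ Y : V, ENNReal.ofReal (gramDet X Y ^ a) ∂gaussian V
      = ∫⁻ Y : V, ENNReal.ofReal (‖X‖ ^ (2 * a)) * ENNReal.ofReal (‖(e Y).2‖ ^ (2 * a)) ∂gaussian V := by
        refine lintegral_congr fun Y => ?_
        rw [hgram, mul_pow, ← pow_mul, ← pow_mul, ENNReal.ofReal_mul (by positivity)]
    _ = ENNReal.ofReal (‖X‖ ^ (2 * a)) * ∫⁻ Y : V, ENNReal.ofReal (‖(e Y).2‖ ^ (2 * a)) ∂gaussian V :=
        lintegral_const_mul' _ _ ENNReal.ofReal_ne_top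
    _ = ENNReal.ofReal (‖X‖ ^ (2 * a)) *
          ∫⁻ z : K × Kᗮ, ENNReal.ofReal (‖z.2‖ ^ (2 * a)) ∂(gaussian K).prod (gaussian Kᗮ) := by
        rw [← hmap, lintegral_map (by fun_prop) e.continuous.measurable]
    _ = ENNReal.ofReal (‖X‖ ^ (2 * a)) * ∫⁻ y : Kᗮ, ENNReal.ofReal (‖y‖ ^ (2 * a)) ∂gaussian Kᗮ := by
        rw [lintegral_prod _ (by fun_prop)]
        simp
    _ = _ := by
        rw [lintegral_norm_pow_gaussian]
        have h1 : Module.finrank ℝ K = 1 := finrank_span_singleton hX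
        have h2 := Submodule.finrank_add_finrank_orthogonal K
        have h3 : Module.finrank ℝ Kᗮ = Module.finrank ℝ V - 1 := by omega
        rw [h3]

variable (V) in
/-- The moments of the squared area of the parallelogram spanned by a Gaussian pair of vectors. -/
theorem lintegral_gramDet_pow (a : ℕ) :
    ∫⁻ z : V × V, ENNReal.ofReal (gramDet z.1 z.2 ^ a) ∂(gaussian V).prod (gaussian V) =
      ((∏ i ∈ Finset.range a, ((Module.finrank ℝ V + 2 * i) * (Module.finrank ℝ V - 1 + 2 * i)) : ℕ) :
        ENNReal) := by
  have hm : Measurable fun z : V × V => ENNReal.ofReal (gramDet z.1 z.2 ^ a) :=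
    (ENNReal.continuous_ofReal.comp (continuous_gramDet.pow a)).measurable
  rw [lintegral_prod _ hm.aemeasurable]
  simp only [lintegral_gramDet_pow_right]
  rw [lintegral_mul_const' _ _ (ENNReal.natCast_ne_top _), lintegral_norm_pow_gaussian,
    Finset.prod_mul_distrib, Nat.cast_mul]

end Moments

section MomentProblem

open Set

/-- Finite measures on the unit square are determined by their moments. -/
theorem ext_of_moments_unitSquare {μ ν : Measure (ℝ × ℝ)} [IsFiniteMeasure μ] [IsFiniteMeasure ν]
    (hμ : μ (Icc (0, 0) (1, 1))ᶜ = 0) (hν : ν (Icc (0, 0) (1, 1))ᶜ = 0)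
    (h : ∀ a b : ℕ, ∫ z, z.1 ^ a * z.2 ^ b ∂μ = ∫ z, z.1 ^ a * z.2 ^ b ∂ν) : μ = ν := by
  set K : Set (ℝ × ℝ) := Icc (0, 0) (1, 1) with hK
  have hKm : MeasurableSet K := measurableSet_Icc
  have hKc : CompactSpace K := isCompact_iff_compactSpace.1 isCompact_Icc
  have hint : ∀ {μ : Measure (ℝ × ℝ)}, μ Kᶜ = 0 → ∀ f : ℝ × ℝ → ℝ,
      ∫ z, f z ∂μ = ∫ z : K, f z ∂(μ.comap Subtype.val) := by
    intro μ hμ f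
    rw [integral_subtype_comap hKm, Measure.restrict_eq_self_of_ae_mem]
    exact hμ
  have hfin : ∀ (μ : Measure (ℝ × ℝ)) [IsFiniteMeasure μ],
      IsFiniteMeasure (μ.comap (Subtype.val : K → ℝ × ℝ)) := fun μ _ =>
    inferInstance
  have := hfin μ
  have := hfin ν
  let Λ : (ρ : Measure K) → [IsFiniteMeasure ρ] → C(K, ℝ) → ℝ := fun ρ _ g => ∫ z, g z ∂ρ
  have hi : ∀ (ρ : Measure K) [IsFiniteMeasure ρ] (g : C(K, ℝ)), Integrable g ρ := fun ρ _ g =>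
    (BoundedContinuousFunction.mkOfCompact g).integrable ρ
  have hΛc : ∀ (ρ : Measure K) [IsFiniteMeasure ρ], Continuous (Λ ρ) := by
    intro ρ _
    refine Metric.continuous_iff.2 fun g ε hε => ⟨ε / (ρ.real univ + 1), by positivity, fun f hf => ?_⟩
    rw [dist_eq_norm]
    simp only [Λ]
    rw [← integral_sub (hi ρ f) (hi ρ g)]
    have hb : ∀ z, ‖f z - g z‖ ≤ dist f g := fun z => by
      rw [← dist_eq_norm]; exact ContinuousMap.dist_apply_le_dist z
    refine (norm_integral_le_of_norm_le_const (Filter.Eventually.of_forall hb)).trans_lt ?_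
    rw [lt_div_iff₀ (by positivity)] at hf
    nlinarith [dist_nonneg (x := f) (y := g), measureReal_nonneg (μ := ρ) (s := univ)]
  let X : C(K, ℝ) := ⟨fun z => z.1.1, by fun_prop⟩
  let Y : C(K, ℝ) := ⟨fun z => z.1.2, by fun_prop⟩
  let A : Subalgebra ℝ C(K, ℝ) := Algebra.adjoin ℝ {X, Y}
  have hA : A.topologicalClosure = ⊤ := by
    refine ContinuousMap.subalgebra_topologicalClosure_eq_top_of_separatesPoints A fun z w hzw => ?_
    by_cases h1 : z.1.1 = w.1.1
    · have h2 : z.1.2 ≠ w.1.2 := fun h2 => hzw (Subtype.ext (Prod.ext h1 h2))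
      exact ⟨Y, ⟨Y, Algebra.subset_adjoin (by simp), rfl⟩, h2⟩
    · exact ⟨X, ⟨X, Algebra.subset_adjoin (by simp), rfl⟩, h1⟩
  have hAe : ∀ g ∈ A, Λ (μ.comap Subtype.val) g = Λ (ν.comap Subtype.val) g := by
    intro g hgA
    have hg' : g ∈ Submodule.span ℝ (Submonoid.closure {X, Y} : Set C(K, ℝ)) := by
      rw [← Algebra.adjoin_eq_span]; exact hgA
    clear hgA
    induction hg' using Submodule.span_induction with
    | mem g hg =>
      obtain ⟨a, b, rfl⟩ := (Submonoid.mem_closure_pair _ _ _).1 hg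
      have := h a b
      rw [hint hμ, hint hν] at this
      exact this
    | zero => simp [Λ]
    | add f g _ _ hf hg =>
      have hadd : ∀ (ρ : Measure K) [IsFiniteMeasure ρ], Λ ρ (f + g) = Λ ρ f + Λ ρ g :=
        fun ρ _ => integral_add (hi ρ f) (hi ρ g)
      rw [hadd, hadd, hf, hg]
    | smul c g _ hg =>
      have hsmul : ∀ (ρ : Measure K) [IsFiniteMeasure ρ], Λ ρ (c • g) = c • Λ ρ g :=
        fun ρ _ => integral_smul c _
      rw [hsmul, hsmul, hg]
  refine ext_of_forall_integral_eq_of_IsFiniteMeasure fun f => ?_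
  rw [hint hμ, hint hν]
  let g : C(K, ℝ) := ⟨fun z => f z, by fun_prop⟩
  have hg : g ∈ closure (A : Set C(K, ℝ)) := by
    rw [← Subalgebra.topologicalClosure_coe, hA]; trivial
  have hcl : IsClosed {g | Λ (μ.comap Subtype.val) g = Λ (ν.comap Subtype.val) g} :=
    isClosed_eq (hΛc _) (hΛc _)
  exact closure_minimal (fun g hg => hAe g hg) hcl hg

end MomentProblem

section Independence

variable {V : Type*} [NormedAddCommGroup V] [InnerProductSpace ℝ V] [FiniteDimensional ℝ V]
  [MeasurableSpace V] [BorelSpace V]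

/-- The span of a Gaussian pair of vectors is uniformly distributed and independent of all random
variables which are invariant under isometries. -/
theorem map_prodMk_pairSpan [Nonempty (Plane V)] (hV : 2 ≤ Module.finrank ℝ V)
    {Ω β : Type*} [MeasurableSpace Ω] [MeasurableSpace β] (κ : Measure Ω) [IsProbabilityMeasure κ]
    {g : (V × V) × Ω → β} (hg : Measurable g)
    (hinv : ∀ (L : V ≃ₗᵢ[ℝ] V) z y, g ((L z.1, L z.2), y) = g (z, y)) :
    (((gaussian V).prod (gaussian V)).prod κ).map (fun x => (pairSpan x.1, g x)) =
      (uniformPlane V).prod ((((gaussian V).prod (gaussian V)).prod κ).map g) := by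
  have hpm : Measurable fun x : (V × V) × Ω => (pairSpan x.1, g x) :=
    (measurable_pairSpan.comp measurable_fst).prodMk hg
  have := isProbabilityMeasure_uniformPlane (V := V) hV
  have hprob := Measure.isProbabilityMeasure_map
    (μ := ((gaussian V).prod (gaussian V)).prod κ) hg.aemeasurable
  symm
  refine Measure.prod_eq fun s t hs ht => ?_
  rw [Measure.map_apply hpm (hs.prod ht), Measure.map_apply hg ht,
    Measure.prod_apply_symm (hpm (hs.prod ht)), Measure.prod_apply_symm (hg ht),
    ← lintegral_const_mul' _ _ (measure_ne_top _ _)]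
  refine lintegral_congr fun y => ?_
  have htm : MeasurableSet ((fun z => (z, y)) ⁻¹' (g ⁻¹' t)) :=
    (measurable_id.prodMk measurable_const) (hg ht)
  have h := map_pairSpan_withDensity hV
    (f := ((fun z => (z, y)) ⁻¹' (g ⁻¹' t)).indicator fun _ => 1)
    (measurable_const.indicator htm) (fun L z => by
      have e : (L z.1, L z.2) ∈ (fun z => (z, y)) ⁻¹' (g ⁻¹' t) ↔ z ∈ (fun z => (z, y)) ⁻¹' (g ⁻¹' t) := by
        change g ((L z.1, L z.2), y) ∈ t ↔ g (z, y) ∈ t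
        rw [hinv]
      by_cases hz : z ∈ (fun z => (z, y)) ⁻¹' (g ⁻¹' t)
      · rw [Set.indicator_of_mem (e.2 hz), Set.indicator_of_mem hz]
      · rw [Set.indicator_of_notMem (mt e.1 hz), Set.indicator_of_notMem hz])
    (by rw [lintegral_indicator htm]; simp)
  have h2 := congrArg (fun ρ => ρ s) h
  rw [Measure.map_apply measurable_pairSpan hs, withDensity_apply _ (measurable_pairSpan hs),
    lintegral_indicator htm, lintegral_indicator htm, Measure.restrict_restrict htm] at h2
  simp only [lintegral_const, one_mul, Measure.restrict_apply MeasurableSet.univ, Set.univ_inter,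
    Measure.smul_apply, smul_eq_mul] at h2
  rw [mul_comm, ← h2, Set.inter_comm]
  rfl

end Independence

section OrthogonalSum

variable {V : Type*} [NormedAddCommGroup V] [InnerProductSpace ℝ V] [FiniteDimensional ℝ V]
  [MeasurableSpace V] [BorelSpace V]
  {W : Type*} [NormedAddCommGroup W] [InnerProductSpace ℝ W] [FiniteDimensional ℝ W]
  [MeasurableSpace W] [BorelSpace W]
  {Z : Type*} [NormedAddCommGroup Z] [InnerProductSpace ℝ Z] [FiniteDimensional ℝ Z]
  [MeasurableSpace Z] [BorelSpace Z]

theorem map_prod_prod_prod_comm {α β : Type*} [MeasurableSpace α] [MeasurableSpace β]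
    (μ : Measure α) (ν : Measure β) [SFinite μ] [SFinite ν] :
    ((μ.prod ν).prod (μ.prod ν)).map (fun z => ((z.1.1, z.2.1), (z.1.2, z.2.2))) =
      (μ.prod μ).prod (ν.prod ν) := by
  ext s hs
  have hm : Measurable fun z : (α × β) × (α × β) => ((z.1.1, z.2.1), (z.1.2, z.2.2)) := by fun_prop
  rw [Measure.map_apply hm hs, ← lintegral_indicator_one (hm hs), ← lintegral_indicator_one hs]
  have hf : Measurable (s.indicator (1 : (α × α) × (β × β) → ENNReal)) :=
    measurable_one.indicator hs
  have hf' : Measurable ((fun z : (α × β) × (α × β) => ((z.1.1, z.2.1), (z.1.2, z.2.2))) ⁻¹' s |>.indicator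
    (1 : (α × β) × (α × β) → ENNReal)) := measurable_one.indicator (hm hs)
  rw [lintegral_prod _ hf'.aemeasurable, lintegral_prod _ hf.aemeasurable,
    lintegral_prod _ hf'.lintegral_prod_right'.aemeasurable,
    lintegral_prod _ hf.lintegral_prod_right'.aemeasurable]
  refine lintegral_congr fun a => ?_
  have e1 : ∀ b, ∫⁻ y, ((fun z : (α × β) × (α × β) => ((z.1.1, z.2.1), (z.1.2, z.2.2))) ⁻¹' s).indicator
      1 ((a, b), y) ∂(μ.prod ν) = ∫⁻ a', ∫⁻ b', s.indicator 1 ((a, a'), (b, b')) ∂ν ∂μ := by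
    intro b
    exact lintegral_prod (fun y => ((fun z : (α × β) × (α × β) => ((z.1.1, z.2.1), (z.1.2, z.2.2))) ⁻¹' s).indicator
      1 ((a, b), y)) (hf'.comp measurable_prodMk_left).aemeasurable
  have e2 : ∀ a', ∫⁻ y, s.indicator (1 : (α × α) × (β × β) → ENNReal) ((a, a'), y) ∂(ν.prod ν) =
      ∫⁻ b, ∫⁻ b', s.indicator 1 ((a, a'), (b, b')) ∂ν ∂ν := by
    intro a'
    exact lintegral_prod (fun y => s.indicator (1 : (α × α) × (β × β) → ENNReal) ((a, a'), y))
      (hf.comp measurable_prodMk_left).aemeasurable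
  simp only [e1, e2]
  refine lintegral_lintegral_swap ?_
  have : Measurable fun x : (β × α) × β => s.indicator (1 : (α × α) × (β × β) → ENNReal)
      ((a, x.1.2), (x.1.1, x.2)) := hf.comp (by fun_prop)
  exact this.lintegral_prod_right'.aemeasurable

variable (e : Z ≃L[ℝ] V × W)

/-- The components of a pair of vectors in an orthogonal sum. -/
def splitPair (z : Z × Z) : (V × V) × (W × W) := (((e z.1).1, (e z.2).1), ((e z.1).2, (e z.2).2))

/-- The pair of vectors with given components in an orthogonal sum. -/
def joinPair (x : (V × V) × (W × W)) : Z × Z := (e.symm (x.1.1, x.2.1), e.symm (x.1.2, x.2.2))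

theorem joinPair_splitPair (z : Z × Z) : joinPair e (splitPair e z) = z := by
  simp [joinPair, splitPair]

theorem continuous_joinPair : Continuous (joinPair e) := by
  unfold joinPair; fun_prop

theorem continuous_splitPair : Continuous (splitPair e) := by
  unfold splitPair; fun_prop

/-- The squares of the Jacobians of the two projections of an orthogonal sum on the plane spanned by
a pair of vectors. -/
def areaRatios (x : (V × V) × (W × W)) : ℝ × ℝ :=
  (gramDet x.1.1 x.1.2 / gramDet (joinPair e x).1 (joinPair e x).2,
    gramDet x.2.1 x.2.2 / gramDet (joinPair e x).1 (joinPair e x).2)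

theorem measurable_areaRatios : Measurable (areaRatios e) := by
  have h : Measurable fun x => gramDet (joinPair e x).1 (joinPair e x).2 :=
    (continuous_gramDet.comp (continuous_joinPair e)).measurable
  refine Measurable.prodMk (Measurable.div ?_ h) (Measurable.div ?_ h)
  · exact continuous_gramDet.measurable.comp measurable_fst
  · exact continuous_gramDet.measurable.comp measurable_snd

variable {e} (he : ∀ z z', inner ℝ z z' = (inner ℝ (e z).1 (e z').1 + inner ℝ (e z).2 (e z').2 : ℝ))
include he

theorem gramDet_joinPair (x : (V × V) × (W × W)) :
    gramDet (joinPair e x).1 (joinPair e x).2 = gramDet x.1.1 x.1.2 + gramDet x.2.1 x.2.2 +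
      (inner ℝ x.1.1 x.1.1 * inner ℝ x.2.2 x.2.2 + inner ℝ x.1.2 x.1.2 * inner ℝ x.2.1 x.2.1
        - 2 * inner ℝ x.1.1 x.1.2 * inner ℝ x.2.1 x.2.2) := by
  simp only [gramDet, joinPair, he, ContinuousLinearEquiv.apply_symm_apply]
  ring

theorem gramDet_add_le (x : (V × V) × (W × W)) :
    gramDet x.1.1 x.1.2 + gramDet x.2.1 x.2.2 ≤ gramDet (joinPair e x).1 (joinPair e x).2 := by
  rw [gramDet_joinPair he]
  have h1 := real_inner_self_nonneg
    (x := ‖x.2.2‖ • x.1.1 - ‖x.2.1‖ • x.1.2)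
  have h2 := abs_real_inner_le_norm x.2.1 x.2.2
  have h3 := abs_real_inner_le_norm x.1.1 x.1.2
  simp only [real_inner_self_eq_norm_sq]
  have h4 : |(inner ℝ x.1.1 x.1.2 * inner ℝ x.2.1 x.2.2 : ℝ)| ≤
      (‖x.1.1‖ * ‖x.1.2‖) * (‖x.2.1‖ * ‖x.2.2‖) := by
    rw [abs_mul]; gcongr
  have h5 := le_abs_self (inner ℝ x.1.1 x.1.2 * inner ℝ x.2.1 x.2.2 : ℝ)
  nlinarith [sq_nonneg (‖x.1.1‖ * ‖x.2.2‖ - ‖x.1.2‖ * ‖x.2.1‖)]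

theorem areaRatios_mem (x : (V × V) × (W × W)) : areaRatios e x ∈ Set.Icc ((0, 0) : ℝ × ℝ) (1, 1) := by
  have h := gramDet_add_le he x
  have h1 := gramDet_nonneg x.1.1 x.1.2
  have h2 := gramDet_nonneg x.2.1 x.2.2
  have h0 := gramDet_nonneg (joinPair e x).1 (joinPair e x).2
  refine ⟨⟨div_nonneg h1 h0, div_nonneg h2 h0⟩, ⟨?_, ?_⟩⟩
  · exact div_le_one_of_le₀ (by linarith) h0
  · exact div_le_one_of_le₀ (by linarith) h0

theorem areaRatios_map (L : V ≃ₗᵢ[ℝ] V) (L' : W ≃ₗᵢ[ℝ] W) (x : (V × V) × (W × W)) :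
    areaRatios e ((L x.1.1, L x.1.2), (L' x.2.1, L' x.2.2)) = areaRatios e x := by
  simp only [areaRatios, gramDet_joinPair he, gramDet_map, LinearIsometryEquiv.inner_map_map]

theorem map_splitPair_gaussian : ((gaussian Z).prod (gaussian Z)).map (splitPair e) =
    ((gaussian V).prod (gaussian V)).prod ((gaussian W).prod (gaussian W)) := by
  have hn : ∀ z, ‖z‖ ^ 2 = ‖(e z).1‖ ^ 2 + ‖(e z).2‖ ^ 2 := fun z => by
    rw [← real_inner_self_eq_norm_sq, he, real_inner_self_eq_norm_sq, real_inner_self_eq_norm_sq]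
  have h1 : MeasurePreserving (Prod.map e e) ((gaussian Z).prod (gaussian Z))
      (((gaussian V).prod (gaussian W)).prod ((gaussian V).prod (gaussian W))) :=
    MeasurePreserving.prod ⟨e.continuous.measurable, gaussian_map_prod e hn⟩
      ⟨e.continuous.measurable, gaussian_map_prod e hn⟩
  rw [← map_prod_prod_prod_comm, ← h1.map_eq, Measure.map_map (by fun_prop) h1.measurable]
  rfl

/-- The moments of the squares of the Jacobians of the two projections. -/
theorem lintegral_areaRatios (hZ : 2 ≤ Module.finrank ℝ Z) (a b : ℕ) :
    (∫⁻ z : Z × Z, ENNReal.ofReal (gramDet z.1 z.2 ^ (a + b)) ∂(gaussian Z).prod (gaussian Z)) *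
      ∫⁻ x, ENNReal.ofReal ((areaRatios e x).1 ^ a * (areaRatios e x).2 ^ b)
        ∂((gaussian V).prod (gaussian V)).prod ((gaussian W).prod (gaussian W)) =
    (∫⁻ z : V × V, ENNReal.ofReal (gramDet z.1 z.2 ^ a) ∂(gaussian V).prod (gaussian V)) *
      ∫⁻ z : W × W, ENNReal.ofReal (gramDet z.1 z.2 ^ b) ∂(gaussian W).prod (gaussian W) := by
  have := nonempty_plane Z hZ
  have hsm := (continuous_splitPair e).measurable
  let T₁ : Z →L[ℝ] V := (ContinuousLinearMap.fst ℝ V W).comp (e : Z →L[ℝ] V × W)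
  let T₂ : Z →L[ℝ] W := (ContinuousLinearMap.snd ℝ V W).comp (e : Z →L[ℝ] V × W)
  let r : Plane Z → ENNReal := fun S => ENNReal.ofReal
    (sectionalCurvature (areaTensor T₁) S ^ a * sectionalCurvature (areaTensor T₂) S ^ b)
  have hr : Measurable r := ENNReal.measurable_ofReal.comp
    (((isCurvatureTensor_areaTensor T₁).measurable_sectionalCurvature.pow_const a).mul
      ((isCurvatureTensor_areaTensor T₂).measurable_sectionalCurvature.pow_const b))
  have hrs : ∀ z : Z × Z, gramDet z.1 z.2 ≠ 0 → r (pairSpan z) =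
      ENNReal.ofReal ((areaRatios e (splitPair e z)).1 ^ a * (areaRatios e (splitPair e z)).2 ^ b) := by
    intro z hz
    simp only [r]
    rw [(isCurvatureTensor_areaTensor T₁).sectionalCurvature_pairSpan hz,
      (isCurvatureTensor_areaTensor T₂).sectionalCurvature_pairSpan hz,
      pairCurvature_areaTensor, pairCurvature_areaTensor]
    simp only [areaRatios, joinPair_splitPair]
    rfl
  have hD : Measurable fun z : Z × Z => ENNReal.ofReal (gramDet z.1 z.2 ^ (a + b)) :=
    (ENNReal.continuous_ofReal.comp (continuous_gramDet.pow (a + b))).measurable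
  have hind := map_pairSpan_withDensity hZ hD (fun L z => by simp only [gramDet_map])
    (by rw [lintegral_gramDet_pow]; exact ENNReal.natCast_ne_top _)
  have hmar : Measurable fun x => ENNReal.ofReal ((areaRatios e x).1 ^ a * (areaRatios e x).2 ^ b) :=
    ENNReal.measurable_ofReal.comp (((measurable_areaRatios e).fst.pow_const a).mul
      ((measurable_areaRatios e).snd.pow_const b))
  have h1 : ∫⁻ x, ENNReal.ofReal ((areaRatios e x).1 ^ a * (areaRatios e x).2 ^ b)
      ∂((gaussian V).prod (gaussian V)).prod ((gaussian W).prod (gaussian W)) =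
      ∫⁻ S, r S ∂uniformPlane Z := by
    rw [← map_splitPair_gaussian he, lintegral_map hmar hsm, ← map_pairSpan_gaussian hZ,
      lintegral_map hr measurable_pairSpan]
    refine lintegral_congr_ae ?_
    filter_upwards [ae_gramDet_ne_zero hZ] with z hz
    exact (hrs z hz).symm
  have hrp : Measurable fun z : Z × Z => r (pairSpan z) := hr.comp measurable_pairSpan
  have h2 := congrArg (fun μ => ∫⁻ S, r S ∂μ) hind
  simp only [lintegral_smul_measure, smul_eq_mul] at h2
  rw [h1, ← h2, lintegral_map hr measurable_pairSpan,
    lintegral_withDensity_eq_lintegral_mul _ hD hrp]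
  have hmV : Measurable fun z : V × V => ENNReal.ofReal (gramDet z.1 z.2 ^ a) :=
    (ENNReal.continuous_ofReal.comp (continuous_gramDet.pow a)).measurable
  have hmW : Measurable fun z : W × W => ENNReal.ofReal (gramDet z.1 z.2 ^ b) :=
    (ENNReal.continuous_ofReal.comp (continuous_gramDet.pow b)).measurable
  have hmVW : Measurable fun z : (V × V) × (W × W) => ENNReal.ofReal (gramDet z.1.1 z.1.2 ^ a) *
      ENNReal.ofReal (gramDet z.2.1 z.2.2 ^ b) :=
    (hmV.comp measurable_fst).mul (hmW.comp measurable_snd)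
  rw [← lintegral_prod_mul hmV.aemeasurable hmW.aemeasurable, ← map_splitPair_gaussian he,
    lintegral_map hmVW hsm]
  refine lintegral_congr_ae ?_
  filter_upwards [ae_gramDet_ne_zero hZ] with z hz
  simp only [Pi.mul_apply]
  rw [hrs z hz, ← ENNReal.ofReal_mul (pow_nonneg (gramDet_nonneg _ _) _),
    ← ENNReal.ofReal_mul (pow_nonneg (gramDet_nonneg _ _) _)]
  congr 1
  simp only [areaRatios, joinPair_splitPair]
  rw [div_pow, div_pow, pow_add]
  field_simp

end OrthogonalSum

section Simplex

open Set

theorem integral_pow_mul_one_sub_pow (k l : ℕ) :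
    ∫ x in (0 : ℝ)..1, x ^ k * (1 - x) ^ l = (k ! * l ! : ℝ) / (k + l + 1)! := by
  induction l generalizing k with
  | zero =>
    simp only [pow_zero, mul_one, integral_pow, Nat.factorial_zero, Nat.cast_one, add_zero,
      Nat.factorial_succ, Nat.cast_mul]
    have : (k ! : ℝ) ≠ 0 := by positivity
    push_cast
    field_simp
    simp
  | succ l ih =>
    have hd : ∀ x ∈ uIcc (0 : ℝ) 1, HasDerivAt (fun x : ℝ => x ^ (k + 1) * (1 - x) ^ (l + 1))
        ((k + 1) * (x ^ k * (1 - x) ^ (l + 1)) - (l + 1) * (x ^ (k + 1) * (1 - x) ^ l)) x := by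
      intro x _
      have h1 := (hasDerivAt_pow (k + 1) x)
      have h2 : HasDerivAt (fun x : ℝ => (1 - x) ^ (l + 1)) ((l + 1 : ℕ) * (1 - x) ^ l * (-1)) x :=
        ((hasDerivAt_id x).const_sub 1).pow (l + 1)
      refine (h1.mul h2).congr_deriv ?_
      simp only [Nat.add_sub_cancel]
      push_cast
      ring
    have hi : ∀ a b : ℕ, IntervalIntegrable (fun x : ℝ => x ^ a * (1 - x) ^ b) volume 0 1 := fun a b =>
      Continuous.intervalIntegrable (by fun_prop) _ _
    have h := intervalIntegral.integral_eq_sub_of_hasDerivAt hd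
      (Continuous.intervalIntegrable (by fun_prop) _ _)
    rw [intervalIntegral.integral_sub ((hi _ _).const_mul _) ((hi _ _).const_mul _),
      intervalIntegral.integral_const_mul, intervalIntegral.integral_const_mul, ih] at h
    simp only [one_pow, sub_self, ne_eq, Nat.add_eq_zero_iff, one_ne_zero, and_false,
      not_false_eq_true, zero_pow, mul_zero] at h
    have e1 : (k + 1 + l + 1)! = (k + (l + 1) + 1)! := by congr 1; ring
    rw [e1, Nat.factorial_succ k] at h
    rw [Nat.factorial_succ l]
    push_cast at h ⊢
    have hk : ((k : ℝ) + 1) ≠ 0 := by positivity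
    refine mul_left_cancel₀ hk ?_
    linear_combination h

theorem lintegral_pow_mul_one_sub_pow (k l : ℕ) :
    ∫⁻ x in Icc (0 : ℝ) 1, ENNReal.ofReal (x ^ k * (1 - x) ^ l) =
      ENNReal.ofReal ((k ! * l ! : ℝ) / (k + l + 1)!) := by
  rw [← integral_pow_mul_one_sub_pow, intervalIntegral.integral_of_le zero_le_one,
    ← integral_Icc_eq_integral_Ioc, ofReal_integral_eq_lintegral_ofReal]
  · exact (Continuous.continuousOn (by fun_prop)).integrableOn_compact isCompact_Icc
  · refine (ae_restrict_iff' measurableSet_Icc).2 (Filter.Eventually.of_forall fun x hx => ?_)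
    exact mul_nonneg (pow_nonneg hx.1 _) (pow_nonneg (by linarith [hx.2]) _)

theorem lintegral_pow_Icc {r : ℝ} (hr : 0 ≤ r) (l : ℕ) :
    ∫⁻ y in Icc (0 : ℝ) r, ENNReal.ofReal (y ^ l) = ENNReal.ofReal (r ^ (l + 1) / (l + 1)) := by
  have h : ∫ y in Icc (0 : ℝ) r, y ^ l = r ^ (l + 1) / (l + 1) := by
    rw [integral_Icc_eq_integral_Ioc, ← intervalIntegral.integral_of_le hr, integral_pow]
    simp
  rw [← h, ofReal_integral_eq_lintegral_ofReal]
  · exact (Continuous.continuousOn (by fun_prop)).integrableOn_compact isCompact_Icc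
  · refine (ae_restrict_iff' measurableSet_Icc).2 (Filter.Eventually.of_forall fun x hx => ?_)
    exact pow_nonneg hx.1 _

/-- The standard simplex in the plane. -/
def planeSimplex : Set (ℝ × ℝ) := {z | 0 ≤ z.1 ∧ 0 ≤ z.2 ∧ z.1 + z.2 ≤ 1}

theorem measurableSet_planeSimplex : MeasurableSet planeSimplex := by
  refine (measurableSet_le measurable_const measurable_fst).inter
    ((measurableSet_le measurable_const measurable_snd).inter
      (measurableSet_le (measurable_fst.add measurable_snd) measurable_const))

theorem lintegral_planeSimplex {f : ℝ × ℝ → ENNReal} (hf : Measurable f) :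
    ∫⁻ z in planeSimplex, f z = ∫⁻ x in Icc (0 : ℝ) 1, ∫⁻ y in Icc (0 : ℝ) (1 - x), f (x, y) := by
  rw [← lintegral_indicator measurableSet_planeSimplex, Measure.volume_eq_prod,
    lintegral_prod _ (hf.indicator measurableSet_planeSimplex).aemeasurable,
    ← lintegral_indicator measurableSet_Icc]
  refine lintegral_congr fun x => ?_
  by_cases hx : x ∈ Icc (0 : ℝ) 1
  · rw [indicator_of_mem hx, ← lintegral_indicator measurableSet_Icc]
    refine lintegral_congr fun y => ?_
    have : (x, y) ∈ planeSimplex ↔ y ∈ Icc (0 : ℝ) (1 - x) := by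
      simp only [planeSimplex, mem_ofPred_eq, mem_Icc]
      have := hx.1
      constructor
      · rintro ⟨_, h2, h3⟩; exact ⟨h2, by linarith⟩
      · rintro ⟨h2, h3⟩; exact ⟨this, h2, by linarith⟩
    by_cases hy : y ∈ Icc (0 : ℝ) (1 - x)
    · rw [indicator_of_mem hy, indicator_of_mem (this.2 hy)]
    · rw [indicator_of_notMem hy, indicator_of_notMem (mt this.1 hy)]
  · rw [indicator_of_notMem hx]
    have : ∀ y, planeSimplex.indicator f (x, y) = 0 := fun y => by
      refine indicator_of_notMem (fun h => hx ?_) _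
      exact ⟨h.1, by linarith [h.2.1, h.2.2]⟩
    simp [this]

theorem lintegral_simplexMeasure {f : ℝ × ℝ → ENNReal} (hf : Measurable f) (m n : ℕ) :
    ∫⁻ z, f z ∂simplexMeasure m n = ENNReal.ofReal (((m + n - 2)! : ℝ) / ((m - 2)! * (n - 2)!)) *
      ∫⁻ x in Icc (0 : ℝ) 1, ENNReal.ofReal (x ^ (m - 2)) *
        ∫⁻ y in Icc (0 : ℝ) (1 - x), ENNReal.ofReal (y ^ (n - 2)) * f (x, y) := by
  have hm : Measurable fun z : ℝ × ℝ => ENNReal.ofReal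
      (((m + n - 2)! : ℝ) / ((m - 2)! * (n - 2)!) * z.1 ^ (m - 2) * z.2 ^ (n - 2)) := by fun_prop
  rw [simplexMeasure, lintegral_withDensity_eq_lintegral_mul _ hm hf]
  change ∫⁻ z in planeSimplex, _ = _
  rw [lintegral_planeSimplex (hm.mul hf), ← lintegral_const_mul' _ _ ENNReal.ofReal_ne_top]
  refine setLIntegral_congr_fun measurableSet_Icc fun x hx => ?_
  rw [← lintegral_const_mul' _ _ ENNReal.ofReal_ne_top, ← lintegral_const_mul' _ _ ENNReal.ofReal_ne_top]
  refine setLIntegral_congr_fun measurableSet_Icc fun y hy => ?_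
  have hx0 := hx.1
  simp only [Pi.mul_apply]
  rw [ENNReal.ofReal_mul (by positivity), ENNReal.ofReal_mul (by positivity)]
  ring

/-- The law of the first coordinate of the simplex. -/
def marginalMeasure (m n : ℕ) : Measure ℝ :=
  (volume.restrict (Icc 0 1)).withDensity fun x =>
    ENNReal.ofReal (((m + n - 2)! : ℝ) / ((m - 2)! * (n - 1)!) * (x ^ (m - 2) * (1 - x) ^ (n - 1)))

theorem lintegral_marginalMeasure {f : ℝ → ENNReal} (hf : Measurable f) (m n : ℕ) :
    ∫⁻ x, f x ∂marginalMeasure m n = ENNReal.ofReal (((m + n - 2)! : ℝ) / ((m - 2)! * (n - 1)!)) *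
      ∫⁻ x in Icc (0 : ℝ) 1, ENNReal.ofReal (x ^ (m - 2) * (1 - x) ^ (n - 1)) * f x := by
  rw [marginalMeasure, lintegral_withDensity_eq_lintegral_mul _ (by fun_prop) hf,
    ← lintegral_const_mul' _ _ ENNReal.ofReal_ne_top]
  refine lintegral_congr fun x => ?_
  simp only [Pi.mul_apply]
  rw [ENNReal.ofReal_mul (by positivity), mul_assoc]

theorem map_fst_simplexMeasure {m n : ℕ} (hn : 2 ≤ n) :
    (simplexMeasure m n).map Prod.fst = marginalMeasure m n := by
  refine Measure.ext_of_lintegral _ fun f hf => ?_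
  have hf1 : Measurable fun z : ℝ × ℝ => f z.1 := hf.comp measurable_fst
  rw [lintegral_map hf measurable_fst, lintegral_simplexMeasure hf1,
    lintegral_marginalMeasure hf, ← lintegral_const_mul' _ _ ENNReal.ofReal_ne_top,
    ← lintegral_const_mul' _ _ ENNReal.ofReal_ne_top]
  refine setLIntegral_congr_fun measurableSet_Icc fun x hx => ?_
  have hx0 := hx.1
  have hx1 : 0 ≤ 1 - x := by linarith [hx.2]
  change _ * (_ * ∫⁻ y in Icc (0 : ℝ) (1 - x), ENNReal.ofReal (y ^ (n - 2)) * f x) = _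
  rw [lintegral_mul_const _ (by fun_prop), lintegral_pow_Icc hx1, ← mul_assoc, ← mul_assoc,
    ← mul_assoc]
  congr 1
  rw [← ENNReal.ofReal_mul (by positivity), ← ENNReal.ofReal_mul (by positivity),
    ← ENNReal.ofReal_mul (by positivity)]
  congr 1
  obtain ⟨k, rfl⟩ : ∃ k, n = k + 2 := ⟨n - 2, by omega⟩
  have e1 : k + 2 - 1 = k + 1 := by omega
  rw [Nat.add_sub_cancel, e1, Nat.factorial_succ]
  push_cast
  have h1 : ((k ! : ℕ) : ℝ) ≠ 0 := by positivity
  have h2 : (((m - 2)! : ℕ) : ℝ) ≠ 0 := by positivity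
  have h3 : (k : ℝ) + 1 ≠ 0 := by positivity
  field_simp

theorem lintegral_pow_simplexMeasure {m n : ℕ} (hm : 2 ≤ m) (hn : 2 ≤ n) (a b : ℕ) :
    ∫⁻ z, ENNReal.ofReal (z.1 ^ a * z.2 ^ b) ∂simplexMeasure m n =
      ENNReal.ofReal (((m + n - 2)! * (m - 2 + a)! * (n - 2 + b)! : ℝ) /
        ((m - 2)! * (n - 2)! * (m + n - 2 + a + b)!)) := by
  rw [lintegral_simplexMeasure (by fun_prop)]
  have h : ∀ x ∈ Icc (0 : ℝ) 1, ENNReal.ofReal (x ^ (m - 2)) *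
      ∫⁻ y in Icc (0 : ℝ) (1 - x), ENNReal.ofReal (y ^ (n - 2)) * ENNReal.ofReal (x ^ a * y ^ b) =
      ENNReal.ofReal (1 / ((n - 2 + b : ℕ) + 1)) *
        ENNReal.ofReal (x ^ (m - 2 + a) * (1 - x) ^ (n - 2 + b + 1)) := by
    intro x hx
    have hx0 := hx.1
    have hx1 : 0 ≤ 1 - x := by linarith [hx.2]
    have : ∫⁻ y in Icc (0 : ℝ) (1 - x), ENNReal.ofReal (y ^ (n - 2)) * ENNReal.ofReal (x ^ a * y ^ b) =
        ENNReal.ofReal (x ^ a) * ∫⁻ y in Icc (0 : ℝ) (1 - x), ENNReal.ofReal (y ^ (n - 2 + b)) := by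
      rw [← lintegral_const_mul' _ _ ENNReal.ofReal_ne_top]
      refine setLIntegral_congr_fun measurableSet_Icc fun y hy => ?_
      have hy0 := hy.1
      rw [← ENNReal.ofReal_mul (by positivity), ← ENNReal.ofReal_mul (by positivity)]
      congr 1; ring
    rw [this, lintegral_pow_Icc hx1, ← ENNReal.ofReal_mul (by positivity),
      ← ENNReal.ofReal_mul (by positivity), ← ENNReal.ofReal_mul (by positivity)]
    congr 1; ring
  rw [setLIntegral_congr_fun measurableSet_Icc h, lintegral_const_mul' _ _ ENNReal.ofReal_ne_top,
    lintegral_pow_mul_one_sub_pow, ← ENNReal.ofReal_mul (by positivity),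
    ← ENNReal.ofReal_mul (by positivity)]
  congr 1
  have e : m - 2 + a + (n - 2 + b + 1) + 1 = m + n - 2 + a + b := by omega
  rw [e, Nat.factorial_succ (n - 2 + b)]
  push_cast
  have h3 : ((n - 2 + b : ℕ) : ℝ) + 1 ≠ 0 := by positivity
  push_cast at h3
  field_simp

theorem isProbabilityMeasure_simplexMeasure {m n : ℕ} (hm : 2 ≤ m) (hn : 2 ≤ n) :
    IsProbabilityMeasure (simplexMeasure m n) := by
  refine ⟨?_⟩
  have h := lintegral_pow_simplexMeasure hm hn 0 0
  simp only [pow_zero, mul_one, ENNReal.ofReal_one, lintegral_one, add_zero] at h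
  rw [h, ← ENNReal.ofReal_one]
  congr 1
  rw [div_eq_one_iff_eq (by positivity)]
  ring

theorem lintegral_pow_marginalMeasure {m n : ℕ} (hm : 2 ≤ m) (hn : 1 ≤ n) (a : ℕ) :
    ∫⁻ x, ENNReal.ofReal (x ^ a) ∂marginalMeasure m n =
      ENNReal.ofReal (((m + n - 2)! * (m - 2 + a)! : ℝ) / ((m - 2)! * (m + n - 2 + a)!)) := by
  rw [lintegral_marginalMeasure (by fun_prop)]
  have h : ∀ x ∈ Icc (0 : ℝ) 1, ENNReal.ofReal (x ^ (m - 2) * (1 - x) ^ (n - 1)) * ENNReal.ofReal (x ^ a) =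
      ENNReal.ofReal (x ^ (m - 2 + a) * (1 - x) ^ (n - 1)) := by
    intro x hx
    have hx0 := hx.1
    rw [← ENNReal.ofReal_mul' (by positivity)]
    congr 1; ring
  rw [setLIntegral_congr_fun measurableSet_Icc h, lintegral_pow_mul_one_sub_pow,
    ← ENNReal.ofReal_mul (by positivity)]
  congr 1
  have e : m - 2 + a + (n - 1) + 1 = m + n - 2 + a := by omega
  rw [e]
  have h3 : (((n - 1)! : ℕ) : ℝ) ≠ 0 := by positivity
  field_simp

theorem isProbabilityMeasure_marginalMeasure {m n : ℕ} (hm : 2 ≤ m) (hn : 1 ≤ n) :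
    IsProbabilityMeasure (marginalMeasure m n) := by
  refine ⟨?_⟩
  have h := lintegral_pow_marginalMeasure hm hn 0
  simp only [pow_zero, ENNReal.ofReal_one, lintegral_one, add_zero] at h
  rw [h, ← ENNReal.ofReal_one]
  congr 1
  rw [div_eq_one_iff_eq (by positivity)]
  ring

theorem map_marginalMeasure {m n : ℕ} (hm : 2 ≤ m) {μ : ℝ} (hμ : μ ≠ 0) :
    (marginalMeasure m n).map (fun x => x ^ 2 * μ) = axisMeasure m n μ := by
  refine Measure.ext_of_lintegral _ fun f hf => ?_
  have hfm : Measurable fun x : ℝ => f (x ^ 2 * μ) := hf.comp (by fun_prop)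
  rw [lintegral_map hf (by fun_prop), lintegral_marginalMeasure hfm, axisMeasure,
    lintegral_withDensity_eq_lintegral_mul _ (by fun_prop) hf]
  have himg : (fun x : ℝ => x ^ 2 * μ) '' Ioo 0 1 = uIoo 0 μ := by
    ext s
    constructor
    · rintro ⟨x, ⟨hx0, hx1⟩, rfl⟩
      have h1 : x ^ 2 < 1 := by nlinarith
      have h2 : 0 < x ^ 2 := by positivity
      rcases lt_or_gt_of_ne hμ with h | h
      · rw [uIoo_of_ge h.le]
        constructor <;> nlinarith
      · rw [uIoo_of_le h.le]
        constructor <;> nlinarith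
    · intro hs
      have hq : 0 < s / μ ∧ s / μ < 1 := by
        rcases lt_or_gt_of_ne hμ with h | h
        · rw [uIoo_of_ge h.le] at hs
          exact ⟨div_pos_of_neg_of_neg hs.2 h, (div_lt_one_of_neg h).2 hs.1⟩
        · rw [uIoo_of_le h.le] at hs
          exact ⟨div_pos hs.1 h, (div_lt_one h).2 hs.2⟩
      refine ⟨√(s / μ), ⟨Real.sqrt_pos.2 hq.1, ?_⟩, ?_⟩
      · rw [Real.sqrt_lt' one_pos]; simpa using hq.2
      · simp only
        rw [Real.sq_sqrt hq.1.le]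
        field_simp
  have hcv := lintegral_image_eq_lintegral_abs_deriv_mul (s := Ioo (0 : ℝ) 1) (f := fun x => x ^ 2 * μ)
    (f' := fun x => 2 * x * μ) measurableSet_Ioo
    (fun x _ => by
      have := ((hasDerivAt_pow 2 x).mul_const μ).hasDerivWithinAt (s := Ioo 0 1)
      simpa using this)
    (fun x hx y hy hxy => by
      have h2 : x ^ 2 = y ^ 2 := mul_right_cancel₀ hμ hxy
      exact (pow_left_inj₀ hx.1.le hy.1.le two_ne_zero).1 h2)
    ((fun s => ENNReal.ofReal (((m + n - 2)! : ℝ) / ((m - 2)! * (n - 1)!) *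
      √(s / μ) ^ ((m : ℤ) - 3) * (1 - √(s / μ)) ^ (n - 1) * (1 / (2 * |μ|)))) * f)
  rw [himg] at hcv
  have hae : uIcc 0 μ =ᵐ[volume] uIoo 0 μ := by
    exact Ioo_ae_eq_Icc.symm
  rw [setLIntegral_congr hae, hcv, setLIntegral_congr (Ioo_ae_eq_Icc (a := (0 : ℝ)) (b := 1)).symm,
    ← lintegral_const_mul' _ _ ENNReal.ofReal_ne_top]
  refine setLIntegral_congr_fun measurableSet_Ioo fun x hx => ?_
  have hx0 : 0 < x := hx.1
  have hx1 : 0 ≤ 1 - x := by linarith [hx.2]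
  have hsq : √(x ^ 2 * μ / μ) = x := by rw [mul_div_cancel_right₀ _ hμ, Real.sqrt_sq hx0.le]
  simp only [Pi.mul_apply]
  rw [hsq, ← mul_assoc, ← mul_assoc]
  congr 1
  rw [← ENNReal.ofReal_mul (by positivity), ← ENNReal.ofReal_mul (by positivity)]
  congr 1
  have hz : x ^ ((m : ℤ) - 3) * x = x ^ (m - 2) := by
    rw [← zpow_natCast, ← zpow_add_one₀ hx0.ne']
    congr 1
    omega
  rw [abs_mul, abs_mul, abs_of_pos hx0, abs_two, ← hz]
  have : |μ| ≠ 0 := abs_ne_zero.2 hμ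
  field_simp

end Simplex

section QuadraticKernel

/-- The law of `p μ + q ν` if `(p, q)` has the law `τ`. -/
def linearKernel (τ : Measure (ℝ × ℝ)) [SFinite τ] : Kernel (ℝ × ℝ) ℝ :=
  (Kernel.const (ℝ × ℝ) τ ×ₖ Kernel.id).map fun x => x.1.1 * x.2.1 + x.1.2 * x.2.2

variable (τ : Measure (ℝ × ℝ)) [SFinite τ]

theorem linearKernel_apply (z : ℝ × ℝ) :
    linearKernel τ z = τ.map fun p => p.1 * z.1 + p.2 * z.2 := by
  rw [linearKernel, Kernel.map_apply _ (by fun_prop), Kernel.prod_apply, Kernel.const_apply,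
    Kernel.id_apply, Measure.prod_dirac, Measure.map_map (by fun_prop) (by fun_prop)]
  rfl

end QuadraticKernel

section AreaRatioLaw

theorem factorial_mul_prod_moment {d : ℕ} (hd : 2 ≤ d) (a : ℕ) :
    (d - 2)! * ∏ i ∈ Finset.range a, ((d + 2 * i) * (d - 1 + 2 * i)) = (d - 2 + 2 * a)! := by
  induction a with
  | zero => simp
  | succ a ih =>
    rw [Finset.prod_range_succ, ← mul_assoc, ih]
    have : d - 2 + 2 * (a + 1) = (d - 2 + 2 * a) + 1 + 1 := by ring
    rw [this, Nat.factorial_succ, Nat.factorial_succ]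
    have h1 : d - 2 + 2 * a + 1 + 1 = d + 2 * a := by omega
    have h2 : d - 2 + 2 * a + 1 = d - 1 + 2 * a := by omega
    rw [h1, h2]
    ring

theorem ext_of_lintegral_moments {μ ν : Measure (ℝ × ℝ)} [IsFiniteMeasure μ] [IsFiniteMeasure ν]
    (hμ : μ (Set.Icc (0, 0) (1, 1))ᶜ = 0) (hν : ν (Set.Icc (0, 0) (1, 1))ᶜ = 0)
    (h : ∀ a b : ℕ, ∫⁻ z, ENNReal.ofReal (z.1 ^ a * z.2 ^ b) ∂μ =
      ∫⁻ z, ENNReal.ofReal (z.1 ^ a * z.2 ^ b) ∂ν) : μ = ν := by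
  refine ext_of_moments_unitSquare hμ hν fun a b => ?_
  have key : ∀ κ : Measure (ℝ × ℝ), κ (Set.Icc (0, 0) (1, 1))ᶜ = 0 →
      ∫ z, z.1 ^ a * z.2 ^ b ∂κ = (∫⁻ z, ENNReal.ofReal (z.1 ^ a * z.2 ^ b) ∂κ).toReal := by
    intro κ hκ
    refine integral_eq_lintegral_of_nonneg_ae ?_
      (Continuous.aestronglyMeasurable (by fun_prop))
    have : ∀ᵐ z ∂κ, z ∈ Set.Icc ((0, 0) : ℝ × ℝ) (1, 1) := hκ
    filter_upwards [this] with z hz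
    exact mul_nonneg (pow_nonneg hz.1.1 _) (pow_nonneg hz.1.2 _)
  rw [key μ hμ, key ν hν, h]

variable {V : Type*} [NormedAddCommGroup V] [InnerProductSpace ℝ V] [FiniteDimensional ℝ V]
  [MeasurableSpace V] [BorelSpace V]
  {W : Type*} [NormedAddCommGroup W] [InnerProductSpace ℝ W] [FiniteDimensional ℝ W]
  [MeasurableSpace W] [BorelSpace W]
  {Z : Type*} [NormedAddCommGroup Z] [InnerProductSpace ℝ Z] [FiniteDimensional ℝ Z]
  [MeasurableSpace Z] [BorelSpace Z]
  {e : Z ≃L[ℝ] V × W}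

theorem gramDet_eq_zero_of_finrank_le_one (hW : Module.finrank ℝ W ≤ 1) (X Y : W) :
    gramDet X Y = 0 := by
  by_contra h
  have := (linearIndependent_of_gramDet_ne_zero h).fintype_card_le_finrank
  simp at this
  omega

variable (he : ∀ z z', inner ℝ z z' = (inner ℝ (e z).1 (e z').1 + inner ℝ (e z).2 (e z').2 : ℝ))
include he

theorem map_areaRatios_compl :
    ((((gaussian V).prod (gaussian V)).prod ((gaussian W).prod (gaussian W))).map (areaRatios e))
      (Set.Icc (0, 0) (1, 1))ᶜ = 0 := by
  rw [Measure.map_apply (measurable_areaRatios e) measurableSet_Icc.compl]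
  refine (congrArg _ ?_).trans measure_empty
  ext x
  simpa using areaRatios_mem he x

theorem lintegral_areaRatios_eq {m n : ℕ} (hmn : 2 ≤ m + n) (hm : Module.finrank ℝ V = m)
    (hn : Module.finrank ℝ W = n) (a b : ℕ) :
    ((∏ i ∈ Finset.range (a + b), ((m + n + 2 * i) * (m + n - 1 + 2 * i)) : ℕ) : ENNReal) *
      ∫⁻ x, ENNReal.ofReal ((areaRatios e x).1 ^ a * (areaRatios e x).2 ^ b)
        ∂((gaussian V).prod (gaussian V)).prod ((gaussian W).prod (gaussian W)) =
    ((∏ i ∈ Finset.range a, ((m + 2 * i) * (m - 1 + 2 * i)) : ℕ) : ENNReal) *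
      ((∏ i ∈ Finset.range b, ((n + 2 * i) * (n - 1 + 2 * i)) : ℕ) : ENNReal) := by
  have hZ : Module.finrank ℝ Z = m + n := by
    rw [e.toLinearEquiv.finrank_eq, Module.finrank_prod, hm, hn]
  have h := lintegral_areaRatios he (by omega) a b
  rwa [lintegral_gramDet_pow, lintegral_gramDet_pow, lintegral_gramDet_pow, hZ, hm, hn] at h

theorem map_areaRatios {m n : ℕ} (hm : 2 ≤ m) (hn : 2 ≤ n) (hVm : Module.finrank ℝ V = m)
    (hWn : Module.finrank ℝ W = n) :
    (((gaussian V).prod (gaussian V)).prod ((gaussian W).prod (gaussian W))).map (areaRatios e) =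
      (simplexMeasure m n).map fun z => (z.1 ^ 2, z.2 ^ 2) := by
  have := isProbabilityMeasure_simplexMeasure hm hn
  have hmeas : Measurable fun z : ℝ × ℝ => (z.1 ^ 2, z.2 ^ 2) := by fun_prop
  refine ext_of_lintegral_moments (map_areaRatios_compl he) ?_ fun a b => ?_
  · rw [Measure.map_apply hmeas measurableSet_Icc.compl, simplexMeasure]
    refine withDensity_absolutelyContinuous _ _ ?_
    change (volume.restrict planeSimplex) _ = 0
    rw [Measure.restrict_apply' measurableSet_planeSimplex]
    refine (congrArg _ ?_).trans measure_empty
    ext z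
    simp only [Set.mem_inter_iff, Set.mem_preimage, Set.mem_compl_iff, Set.mem_empty_iff_false,
      iff_false, not_and]
    intro h hz
    apply h
    obtain ⟨h1, h2, h3⟩ := hz
    exact ⟨⟨by positivity, by positivity⟩, ⟨by simp only; nlinarith, by simp only; nlinarith⟩⟩
  · have hf : Measurable fun z : ℝ × ℝ => ENNReal.ofReal (z.1 ^ a * z.2 ^ b) := by fun_prop
    rw [lintegral_map hf (measurable_areaRatios e), lintegral_map hf hmeas]
    have h := lintegral_areaRatios_eq he (by omega) hVm hWn a b
    simp only [← pow_mul]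
    rw [lintegral_pow_simplexMeasure hm hn (2 * a) (2 * b)]
    have e0 := factorial_mul_prod_moment (d := m + n) (by omega) (a + b)
    have e1 := factorial_mul_prod_moment hm a
    have e2 := factorial_mul_prod_moment hn b
    set A := ∏ i ∈ Finset.range (a + b), ((m + n + 2 * i) * (m + n - 1 + 2 * i))
    set B := ∏ i ∈ Finset.range a, ((m + 2 * i) * (m - 1 + 2 * i))
    set C := ∏ i ∈ Finset.range b, ((n + 2 * i) * (n - 1 + 2 * i))
    have hA : (A : ENNReal) ≠ 0 := by
      have : A ≠ 0 := by
        intro h0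
        rw [h0, mul_zero] at e0
        exact (Nat.factorial_ne_zero _) e0.symm
      exact_mod_cast this
    refine (ENNReal.mul_right_inj hA (ENNReal.natCast_ne_top A)).1 (h.trans ?_)
    have e3 : m + n - 2 + 2 * a + 2 * b = m + n - 2 + 2 * (a + b) := by ring
    rw [e3, ← e0, ← e1, ← e2, ← ENNReal.ofReal_natCast A, ← ENNReal.ofReal_natCast B,
      ← ENNReal.ofReal_natCast C, ← ENNReal.ofReal_mul (by positivity),
      ← ENNReal.ofReal_mul (by positivity)]
    congr 1
    have hA' : (A : ℝ) ≠ 0 := by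
      intro h0; exact hA (by exact_mod_cast h0)
    push_cast
    have p1 : (((m - 2)! : ℕ) : ℝ) ≠ 0 := by positivity
    have p2 : (((n - 2)! : ℕ) : ℝ) ≠ 0 := by positivity
    have p3 : (((m + n - 2)! : ℕ) : ℝ) ≠ 0 := by positivity
    field_simp

theorem map_areaRatios_of_finrank_eq_one {m : ℕ} (hm : 2 ≤ m) (hVm : Module.finrank ℝ V = m)
    (hW : Module.finrank ℝ W = 1) :
    (((gaussian V).prod (gaussian V)).prod ((gaussian W).prod (gaussian W))).map (areaRatios e) =
      (marginalMeasure m 1).map fun x => (x ^ 2, 0) := by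
  have := isProbabilityMeasure_marginalMeasure hm le_rfl
  have hmeas : Measurable fun x : ℝ => (x ^ 2, (0 : ℝ)) := by fun_prop
  refine ext_of_lintegral_moments (map_areaRatios_compl he) ?_ fun a b => ?_
  · rw [Measure.map_apply hmeas measurableSet_Icc.compl, marginalMeasure]
    refine withDensity_absolutelyContinuous _ _ ?_
    rw [Measure.restrict_apply' measurableSet_Icc]
    refine (congrArg _ ?_).trans measure_empty
    ext z
    simp only [Set.mem_inter_iff, Set.mem_preimage, Set.mem_compl_iff, Set.mem_empty_iff_false,
      iff_false, not_and]
    intro h hz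
    apply h
    obtain ⟨h1, h2⟩ := hz
    exact ⟨⟨by positivity, le_rfl⟩, ⟨by simp only; nlinarith, zero_le_one⟩⟩
  · have hf : Measurable fun z : ℝ × ℝ => ENNReal.ofReal (z.1 ^ a * z.2 ^ b) := by fun_prop
    rw [lintegral_map hf (measurable_areaRatios e), lintegral_map hf hmeas]
    rcases Nat.eq_zero_or_pos b with rfl | hb
    · have h := lintegral_areaRatios_eq he (by omega) hVm hW a 0
      simp only [← pow_mul, pow_zero, mul_one] at h ⊢
      rw [lintegral_pow_marginalMeasure hm le_rfl (2 * a)]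
      have e0 := factorial_mul_prod_moment (d := m + 1) (by omega) (a + 0)
      have e1 := factorial_mul_prod_moment hm a
      set A := ∏ i ∈ Finset.range (a + 0), ((m + 1 + 2 * i) * (m + 1 - 1 + 2 * i))
      set B := ∏ i ∈ Finset.range a, ((m + 2 * i) * (m - 1 + 2 * i))
      have hA : (A : ENNReal) ≠ 0 := by
        have : A ≠ 0 := by
          intro h0
          rw [h0, mul_zero] at e0
          exact (Nat.factorial_ne_zero _) e0.symm
        exact_mod_cast this
      refine (ENNReal.mul_right_inj hA (ENNReal.natCast_ne_top A)).1 (h.trans ?_)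
      simp only [add_zero] at e0
      rw [← e0, ← e1, ← ENNReal.ofReal_natCast A, ← ENNReal.ofReal_natCast B,
        ← ENNReal.ofReal_mul (by positivity)]
      simp only [Finset.range_zero, Finset.prod_empty, Nat.cast_one, mul_one]
      congr 1
      have hA' : (A : ℝ) ≠ 0 := by
        intro h0; exact hA (by exact_mod_cast h0)
      push_cast
      have p1 : (((m - 2)! : ℕ) : ℝ) ≠ 0 := by positivity
      have p3 : (((m + 1 - 2)! : ℕ) : ℝ) ≠ 0 := by positivity
      field_simp
    · have : ∀ x, (areaRatios e x).2 = 0 := fun x => by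
        simp [areaRatios, gramDet_eq_zero_of_finrank_le_one hW.le]
      simp [this, hb.ne']

end AreaRatioLaw

section FiberLaw

variable {V : Type*} [NormedAddCommGroup V] [InnerProductSpace ℝ V]

theorem IsCurvatureTensor.inner_eq_zero {R : V → V → V → V} (hR : IsCurvatureTensor R) {X Y : V}
    (h : gramDet X Y = 0) : inner ℝ (R Y X X) Y = (0 : ℝ) := by
  have hself : ∀ u w, R u u w = 0 := fun u w => by
    have := hR.antisymm u u w
    rwa [eq_neg_iff_add_eq_zero, ← two_smul ℝ, smul_eq_zero_iff_right (by norm_num)] at this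
  have hd : ¬ LinearIndependent ℝ ![X, Y] := fun hli => gramDet_ne_zero_of_linearIndependent hli h
  rcases eq_or_ne X 0 with rfl | hX
  · have := hR.smul_right 0 Y 0 0
    rw [zero_smul, zero_smul] at this
    simp [this]
  · rw [LinearIndependent.pair_iff' hX] at hd
    push Not at hd
    obtain ⟨a, rfl⟩ := hd
    simp [hR.smul_left, hself]

theorem IsCurvatureTensor.pairCurvature_mul_gramDet {R : V → V → V → V} (hR : IsCurvatureTensor R)
    (z : V × V) : pairCurvature R z * gramDet z.1 z.2 = inner ℝ (R z.2 z.1 z.1) z.2 := by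
  by_cases h : gramDet z.1 z.2 = 0
  · rw [h, mul_zero, hR.inner_eq_zero h]
  · exact div_mul_cancel₀ _ h

variable [FiniteDimensional ℝ V]
  [MeasurableSpace V] [BorelSpace V]
  {W : Type*} [NormedAddCommGroup W] [InnerProductSpace ℝ W] [FiniteDimensional ℝ W]
  [MeasurableSpace W] [BorelSpace W]
  {Z : Type*} [NormedAddCommGroup Z] [InnerProductSpace ℝ Z] [FiniteDimensional ℝ Z]
  [MeasurableSpace Z] [BorelSpace Z]
  {e : Z ≃L[ℝ] V × W}
  (he : ∀ z z', inner ℝ z z' = (inner ℝ (e z).1 (e z').1 + inner ℝ (e z).2 (e z').2 : ℝ))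
  {RV : V → V → V → V} (hRV : IsCurvatureTensor RV)
  {RW : W → W → W → W} (hRW : IsCurvatureTensor RW)
  {RZ : Z → Z → Z → Z} (hRZ : IsCurvatureTensor RZ)
  (hR : ∀ X Y : Z, inner ℝ (RZ Y X X) Y = (inner ℝ (RV (e Y).1 (e X).1 (e X).1) (e Y).1 +
    inner ℝ (RW (e Y).2 (e X).2 (e X).2) (e Y).2 : ℝ))

include he hRV hRW hRZ hR

theorem map_pairCurvature_sum :
    ((gaussian Z).prod (gaussian Z)).map (pairCurvature RZ) =
      (((gaussian V).prod (gaussian V)).prod ((gaussian W).prod (gaussian W))).map fun x =>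
        (areaRatios e x).1 * pairCurvature RV x.1 + (areaRatios e x).2 * pairCurvature RW x.2 := by
  rw [← map_splitPair_gaussian he, Measure.map_map ?_ (continuous_splitPair e).measurable]
  · congr 1
    ext z
    obtain ⟨x, y⟩ := z
    simp only [Function.comp_apply, areaRatios, joinPair_splitPair]
    have h1 := hRV.pairCurvature_mul_gramDet (splitPair e (x, y)).1
    have h2 := hRW.pairCurvature_mul_gramDet (splitPair e (x, y)).2
    rw [div_mul_eq_mul_div, div_mul_eq_mul_div, ← add_div, mul_comm _ (pairCurvature RV _),
      mul_comm _ (pairCurvature RW _), h1, h2]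
    simp only [pairCurvature, hR, splitPair]
  · exact ((measurable_areaRatios e).fst.mul (hRV.measurable_pairCurvature.comp measurable_fst)).add
      ((measurable_areaRatios e).snd.mul (hRW.measurable_pairCurvature.comp measurable_snd))

theorem map_sectionalCurvature_sum {m n : ℕ} (hm : 2 ≤ m) (hn : 2 ≤ n)
    (hVm : Module.finrank ℝ V = m) (hWn : Module.finrank ℝ W = n) (τ : Measure (ℝ × ℝ)) [SFinite τ]
    (hτ : τ = (simplexMeasure m n).map fun z => (z.1 ^ 2, z.2 ^ 2)) :
    (uniformPlane Z).map (sectionalCurvature RZ) =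
      (((uniformPlane V).map (sectionalCurvature RV)).prod
        ((uniformPlane W).map (sectionalCurvature RW))).bind (linearKernel τ) := by
  have hV : 2 ≤ Module.finrank ℝ V := by omega
  have hW : 2 ≤ Module.finrank ℝ W := by omega
  have hZ : 2 ≤ Module.finrank ℝ Z := by
    rw [e.toLinearEquiv.finrank_eq, Module.finrank_prod]; omega
  have := nonempty_plane V hV
  have := nonempty_plane W hW
  have := isProbabilityMeasure_uniformPlane hV
  have := isProbabilityMeasure_uniformPlane hW
  have hmV := hRV.measurable_sectionalCurvature
  have hmW := hRW.measurable_sectionalCurvature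
  have := Measure.isProbabilityMeasure_map (μ := uniformPlane V) hmV.aemeasurable
  have := Measure.isProbabilityMeasure_map (μ := uniformPlane W) hmW.aemeasurable
  have h1 := map_prodMk_pairSpan hV ((gaussian W).prod (gaussian W))
    (g := fun x => (pairSpan x.2, areaRatios e x))
    ((measurable_pairSpan.comp measurable_snd).prodMk (measurable_areaRatios e))
    (fun L z y => by
      have := areaRatios_map he L (LinearIsometryEquiv.refl ℝ W) (z, y)
      simpa using this)
  have h2 := map_prodMk_pairSpan hW ((gaussian V).prod (gaussian V))
    (g := fun x => areaRatios e x.swap)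
    ((measurable_areaRatios e).comp measurable_swap)
    (fun L z y => by
      have := areaRatios_map he (LinearIsometryEquiv.refl ℝ V) L (y, z)
      simpa using this)
  have h3 : (((gaussian V).prod (gaussian V)).prod ((gaussian W).prod (gaussian W))).map
      (fun x => (pairSpan x.2, areaRatios e x)) = (uniformPlane W).prod τ := by
    have hsw : ((gaussian V).prod (gaussian V)).prod ((gaussian W).prod (gaussian W)) =
      (((gaussian W).prod (gaussian W)).prod ((gaussian V).prod (gaussian V))).map Prod.swap :=
      Measure.prod_swap.symm
    have hm3 : Measurable fun x : (V × V) × (W × W) => (pairSpan x.2, areaRatios e x) :=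
      (measurable_pairSpan.comp measurable_snd).prodMk (measurable_areaRatios e)
    rw [hτ, ← map_areaRatios he hm hn hVm hWn, hsw, Measure.map_map hm3 measurable_swap,
      Measure.map_map (measurable_areaRatios e) measurable_swap]
    exact h2
  rw [h3] at h1
  have hprobτ : IsProbabilityMeasure τ := by
    rw [hτ, ← map_areaRatios he hm hn hVm hWn]
    exact Measure.isProbabilityMeasure_map (measurable_areaRatios e).aemeasurable
  let G : Plane V × (Plane W × (ℝ × ℝ)) → ℝ := fun y =>
    y.2.2.1 * sectionalCurvature RV y.1 + y.2.2.2 * sectionalCurvature RW y.2.1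
  have hG : Measurable G :=
    (measurable_snd.snd.fst.mul (hmV.comp measurable_fst)).add
      (measurable_snd.snd.snd.mul (hmW.comp measurable_snd.fst))
  have hm1 : Measurable fun x : (V × V) × (W × W) => (pairSpan x.1, pairSpan x.2, areaRatios e x) :=
    (measurable_pairSpan.comp measurable_fst).prodMk
      ((measurable_pairSpan.comp measurable_snd).prodMk (measurable_areaRatios e))
  have h4 : (uniformPlane Z).map (sectionalCurvature RZ) =
      ((uniformPlane V).prod ((uniformPlane W).prod τ)).map G := by
    rw [hRZ.map_sectionalCurvature hZ, map_pairCurvature_sum he hRV hRW hRZ hR, ← h1,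
      Measure.map_map hG hm1]
    refine Measure.map_congr ?_
    have a1 := Measure.quasiMeasurePreserving_fst (μ := (gaussian V).prod (gaussian V))
      (ν := (gaussian W).prod (gaussian W)) |>.ae (ae_gramDet_ne_zero hV)
    have a2 := Measure.quasiMeasurePreserving_snd (μ := (gaussian V).prod (gaussian V))
      (ν := (gaussian W).prod (gaussian W)) |>.ae (ae_gramDet_ne_zero hW)
    filter_upwards [a1, a2] with x hx1 hx2
    simp only [Function.comp_apply, G, hRV.sectionalCurvature_pairSpan hx1,
      hRW.sectionalCurvature_pairSpan hx2]
  rw [h4]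
  refine Measure.ext_of_lintegral _ fun f hf => ?_
  have hfG : Measurable fun y => f (G y) := hf.comp hG
  have hk : Measurable fun z : ℝ × ℝ => ∫⁻ s, f s ∂linearKernel τ z := hf.lintegral_kernel
  have hk1 : Measurable fun x => ∫⁻ y, ∫⁻ s, f s ∂linearKernel τ (x, y)
      ∂(uniformPlane W).map (sectionalCurvature RW) := hk.lintegral_prod_right'
  rw [lintegral_map hf hG, lintegral_prod _ hfG.aemeasurable,
    Measure.lintegral_bind (linearKernel τ).measurable.aemeasurable hf.aemeasurable,
    lintegral_prod _ hk.aemeasurable, lintegral_map hk1 hmV]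
  refine lintegral_congr fun S => ?_
  have hk2 : Measurable fun y => ∫⁻ s, f s ∂linearKernel τ (sectionalCurvature RV S, y) :=
    hk.comp measurable_prodMk_left
  have hfG2 : Measurable fun y => f (G (S, y)) := hfG.comp measurable_prodMk_left
  rw [lintegral_map hk2 hmW, lintegral_prod _ hfG2.aemeasurable]
  refine lintegral_congr fun T => ?_
  rw [linearKernel_apply, lintegral_map hf (by fun_prop)]

theorem map_sectionalCurvature_sum_line {m : ℕ} (hm : 2 ≤ m)
    (hVm : Module.finrank ℝ V = m) (hW : Module.finrank ℝ W = 1) (τ : Measure (ℝ × ℝ)) [SFinite τ]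
    (hτ : τ = (marginalMeasure m 1).map fun x => (x ^ 2, 0)) :
    (uniformPlane Z).map (sectionalCurvature RZ) =
      (((uniformPlane V).map (sectionalCurvature RV)).prod (Measure.dirac 0)).bind
        (linearKernel τ) := by
  have hV : 2 ≤ Module.finrank ℝ V := by omega
  have hZ : 2 ≤ Module.finrank ℝ Z := by
    rw [e.toLinearEquiv.finrank_eq, Module.finrank_prod]; omega
  have := nonempty_plane V hV
  have := isProbabilityMeasure_uniformPlane hV
  have hmV := hRV.measurable_sectionalCurvature
  have := Measure.isProbabilityMeasure_map (μ := uniformPlane V) hmV.aemeasurable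
  have h1 := map_prodMk_pairSpan hV ((gaussian W).prod (gaussian W))
    (g := fun x => areaRatios e x) (measurable_areaRatios e)
    (fun L z y => by
      have := areaRatios_map he L (LinearIsometryEquiv.refl ℝ W) (z, y)
      simpa using this)
  rw [map_areaRatios_of_finrank_eq_one he hm hVm hW, ← hτ] at h1
  let G : Plane V × (ℝ × ℝ) → ℝ := fun y => y.2.1 * sectionalCurvature RV y.1
  have hG : Measurable G := measurable_snd.fst.mul (hmV.comp measurable_fst)
  have hm1 : Measurable fun x : (V × V) × (W × W) => (pairSpan x.1, areaRatios e x) :=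
    (measurable_pairSpan.comp measurable_fst).prodMk (measurable_areaRatios e)
  have h4 : (uniformPlane Z).map (sectionalCurvature RZ) = ((uniformPlane V).prod τ).map G := by
    rw [hRZ.map_sectionalCurvature hZ, map_pairCurvature_sum he hRV hRW hRZ hR, ← h1,
      Measure.map_map hG hm1]
    refine Measure.map_congr ?_
    have a1 := Measure.quasiMeasurePreserving_fst (μ := (gaussian V).prod (gaussian V))
      (ν := (gaussian W).prod (gaussian W)) |>.ae (ae_gramDet_ne_zero hV)
    filter_upwards [a1] with x hx1
    simp only [Function.comp_apply, G, hRV.sectionalCurvature_pairSpan hx1]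
    rw [show pairCurvature RW x.2 = 0 by
      rw [pairCurvature, gramDet_eq_zero_of_finrank_le_one hW.le, div_zero]]
    ring
  rw [h4]
  refine Measure.ext_of_lintegral _ fun f hf => ?_
  have hfG : Measurable fun y => f (G y) := hf.comp hG
  have hk : Measurable fun z : ℝ × ℝ => ∫⁻ s, f s ∂linearKernel τ z := hf.lintegral_kernel
  have hk1 : Measurable fun x => ∫⁻ y, ∫⁻ s, f s ∂linearKernel τ (x, y) ∂Measure.dirac 0 :=
    hk.lintegral_prod_right'
  rw [lintegral_map hf hG, lintegral_prod _ hfG.aemeasurable,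
    Measure.lintegral_bind (linearKernel τ).measurable.aemeasurable hf.aemeasurable,
    lintegral_prod _ hk.aemeasurable, lintegral_map hk1 hmV]
  refine lintegral_congr fun S => ?_
  rw [lintegral_dirac, linearKernel_apply, lintegral_map hf (by fun_prop)]
  simp [G]

end FiberLaw

section

set_option maxSynthPendingDepth 3

section CoordinateMetrics

variable {E : Type*} [NormedAddCommGroup E] [NormedSpace ℝ E]

/-- `G` is a smooth Riemannian metric on the open set `U`. -/
structure IsMetricOn (G : E → E →L[ℝ] E →L[ℝ] ℝ) (U : Set E) : Prop where
  isOpen : IsOpen U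
  contDiffAt : ∀ y ∈ U, ContDiffAt ℝ ∞ G y
  symm : ∀ y ∈ U, ∀ v w, G y v w = G y w v
  pos : ∀ y ∈ U, ∀ v, v ≠ 0 → 0 < G y v v

theorem IsMetricOn.mono {G : E → E →L[ℝ] E →L[ℝ] ℝ} {U V : Set E} (h : IsMetricOn G U)
    (hV : IsOpen V) (hVU : V ⊆ U) : IsMetricOn G V :=
  ⟨hV, fun y hy => h.contDiffAt y (hVU hy), fun y hy => h.symm y (hVU hy),
    fun y hy => h.pos y (hVU hy)⟩

theorem IsMetricOn.eq_of_forall {G : E → E →L[ℝ] E →L[ℝ] ℝ} {U : Set E} (h : IsMetricOn G U)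
    {y : E} (hy : y ∈ U) {a b : E} (hab : ∀ z, G y a z = G y b z) : a = b := by
  by_contra hne
  have := h.pos y hy (a - b) (sub_ne_zero.2 hne)
  rw [map_sub, map_sub (G y)] at this
  simp [hab] at this

theorem IsMetricOn.fderiv_symm {G : E → E →L[ℝ] E →L[ℝ] ℝ} {U : Set E} (h : IsMetricOn G U)
    {y : E} (hy : y ∈ U) (u v w : E) : fderiv ℝ G y u v w = fderiv ℝ G y u w v := by
  have hd := (h.contDiffAt y hy).differentiableAt (by simp)
  have key : ∀ v w, HasFDerivAt (fun y' => G y' v w)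
      ((ContinuousLinearMap.apply ℝ ℝ w).comp
        ((ContinuousLinearMap.apply ℝ (E →L[ℝ] ℝ) v).comp (fderiv ℝ G y))) y := fun v w =>
    ((ContinuousLinearMap.apply ℝ ℝ w).hasFDerivAt.comp y
      ((ContinuousLinearMap.apply ℝ (E →L[ℝ] ℝ) v).hasFDerivAt.comp y hd.hasFDerivAt))
  have he : (fun y' => G y' v w) =ᶠ[nhds y] fun y' => G y' w v := by
    filter_upwards [h.isOpen.mem_nhds hy] with y' hy' using h.symm y' hy' v w
  have := ((key v w).congr_of_eventuallyEq he.symm).unique (key w v)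
  exact DFunLike.congr_fun this u

variable [FiniteDimensional ℝ E]

theorem IsMetricOn.exists_equiv {G : E → E →L[ℝ] E →L[ℝ] ℝ} {U : Set E} (h : IsMetricOn G U)
    {y : E} (hy : y ∈ U) : ∃ e : E ≃L[ℝ] (E →L[ℝ] ℝ), (e : E →L[ℝ] E →L[ℝ] ℝ) = G y := by
  have hinj : Function.Injective (G y) := fun a b hab =>
    h.eq_of_forall hy fun z => by rw [hab]
  have hfr : Module.finrank ℝ E = Module.finrank ℝ (E →L[ℝ] ℝ) := by
    rw [← (LinearMap.toContinuousLinearMap (𝕜 := ℝ) (E := E) (F' := ℝ)).finrank_eq]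
    exact (Subspace.dual_finrank_eq (K := ℝ) (V := E)).symm
  refine ⟨(LinearEquiv.ofInjectiveOfFinrankEq (G y : E →ₗ[ℝ] E →L[ℝ] ℝ) hinj hfr).toContinuousLinearEquiv, ?_⟩
  ext a b
  rfl

theorem IsMetricOn.christoffel_spec {G : E → E →L[ℝ] E →L[ℝ] ℝ} {U : Set E} (h : IsMetricOn G U)
    {y : E} (hy : y ∈ U) (v w z : E) : G y (christoffel G y v w) z =
      1 / 2 * (fderiv ℝ G y v w z + fderiv ℝ G y w v z - fderiv ℝ G y z v w) := by
  obtain ⟨e, he⟩ := h.exists_equiv hy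
  rw [christoffel, ← he, ContinuousLinearMap.inverse_equiv]
  simp

theorem IsMetricOn.eq_christoffel {G : E → E →L[ℝ] E →L[ℝ] ℝ} {U : Set E} (h : IsMetricOn G U)
    {y : E} (hy : y ∈ U) {v w a : E} (ha : ∀ z, G y a z =
      1 / 2 * (fderiv ℝ G y v w z + fderiv ℝ G y w v z - fderiv ℝ G y z v w)) :
    a = christoffel G y v w :=
  h.eq_of_forall hy fun z => by rw [ha, h.christoffel_spec hy]

/-- The Christoffel symbols as a bilinear map. -/
def christoffelMap (G : E → E →L[ℝ] E →L[ℝ] ℝ) (y : E) : E →L[ℝ] E →L[ℝ] E :=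
  (ContinuousLinearMap.compL ℝ E (E →L[ℝ] ℝ) E (G y).inverse).comp
    ((1 / 2 : ℝ) • (fderiv ℝ G y + (fderiv ℝ G y).flip -
      ((ContinuousLinearMap.flipₗᵢ ℝ E E ℝ).toContinuousLinearEquiv :
        (E →L[ℝ] E →L[ℝ] ℝ) →L[ℝ] (E →L[ℝ] E →L[ℝ] ℝ)).comp (fderiv ℝ G y).flip))

theorem christoffelMap_apply (G : E → E →L[ℝ] E →L[ℝ] ℝ) (y v w : E) :
    christoffelMap G y v w = christoffel G y v w := rfl

variable {G : E → E →L[ℝ] E →L[ℝ] ℝ} {U : Set E}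

theorem IsMetricOn.contDiffAt_christoffelMap (h : IsMetricOn G U) {y : E} (hy : y ∈ U) :
    ContDiffAt ℝ ∞ (christoffelMap G) y := by
  have hU := h.isOpen.mem_nhds hy
  have hon : ContDiffOn ℝ ∞ (christoffelMap G) U := by
    refine contDiffOn_clm_apply.2 fun v => contDiffOn_clm_apply.2 fun w => fun y hy => ?_
    refine ContDiffAt.contDiffWithinAt ?_
    have hD : ContDiffAt ℝ ∞ (fderiv ℝ G) y := (h.contDiffAt y hy).fderiv_right (by simp)
    have hinv : ContDiffAt ℝ ∞ (fun y => (G y).inverse) y := by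
      obtain ⟨e, he⟩ := h.exists_equiv hy
      have := contDiffAt_map_inverse (n := ∞) e
      rw [he] at this
      exact this.comp y (h.contDiffAt y hy)
    have hK : ContDiffAt ℝ ∞ (fun y => (1 / 2 : ℝ) •
        (fderiv ℝ G y v w + fderiv ℝ G y w v - ((fderiv ℝ G y).flip v).flip w)) y := by
      refine ContDiffAt.const_smul _ (ContDiffAt.sub (ContDiffAt.add ?_ ?_) ?_)
      · exact (hD.clm_apply contDiffAt_const).clm_apply contDiffAt_const
      · exact (hD.clm_apply contDiffAt_const).clm_apply contDiffAt_const
      · exact ((ContinuousLinearMap.flipₗᵢ ℝ E E ℝ).contDiff.contDiffAt.comp y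
          (ContDiffAt.clm_apply ((ContinuousLinearMap.flipₗᵢ ℝ E E (E →L[ℝ] ℝ)).contDiff.contDiffAt.comp
            y hD) contDiffAt_const)).clm_apply contDiffAt_const
    exact hinv.clm_apply hK
  exact hon.contDiffAt hU

theorem IsMetricOn.hasFDerivAt_christoffelMap (h : IsMetricOn G U) {y : E} (hy : y ∈ U) :
    HasFDerivAt (christoffelMap G) (fderiv ℝ (christoffelMap G) y) y :=
  ((h.contDiffAt_christoffelMap hy).differentiableAt (by simp)).hasFDerivAt

theorem HasFDerivAt.apply_apply {F F' : Type*} [NormedAddCommGroup F] [NormedSpace ℝ F]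
    [NormedAddCommGroup F'] [NormedSpace ℝ F'] {A : F → E →L[ℝ] E →L[ℝ] F'} {A' : F →L[ℝ] E →L[ℝ] E →L[ℝ] F'}
    {y : F} (hA : HasFDerivAt A A' y) {a b : F → E} {a' b' : F →L[ℝ] E} (ha : HasFDerivAt a a' y)
    (hb : HasFDerivAt b b' y) (u : F) :
    fderiv ℝ (fun y => A y (a y) (b y)) y u =
      A' u (a y) (b y) + A y (a' u) (b y) + A y (a y) (b' u) := by
  rw [((hA.clm_apply ha).clm_apply hb).fderiv]
  simp
  abel

theorem IsMetricOn.fderiv_christoffel (h : IsMetricOn G U) {y : E} (hy : y ∈ U) (u v w : E) :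
    fderiv ℝ (fun y' => christoffel G y' v w) y u = fderiv ℝ (christoffelMap G) y u v w := by
  have := HasFDerivAt.apply_apply (h.hasFDerivAt_christoffelMap hy) (hasFDerivAt_const v y)
    (hasFDerivAt_const w y) u
  simp only [zero_apply, map_zero, add_zero] at this
  exact this

theorem IsMetricOn.coordCurvature_eq (h : IsMetricOn G U) {y : E} (hy : y ∈ U) (u v w : E) :
    coordCurvature G y u v w = fderiv ℝ (christoffelMap G) y u v w - fderiv ℝ (christoffelMap G) y v u w +
      christoffelMap G y u (christoffelMap G y v w) - christoffelMap G y v (christoffelMap G y u w) := by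
  rw [coordCurvature, h.fderiv_christoffel hy, h.fderiv_christoffel hy]
  rfl

theorem IsMetricOn.fderiv_eq (h : IsMetricOn G U) {y : E} (hy : y ∈ U) (u v w : E) :
    fderiv ℝ G y u v w = G y (christoffelMap G y u v) w + G y v (christoffelMap G y u w) := by
  rw [h.symm y hy v, christoffelMap_apply, christoffelMap_apply, h.christoffel_spec hy,
    h.christoffel_spec hy, h.fderiv_symm hy w u v, h.fderiv_symm hy v u w, h.fderiv_symm hy u v w]
  ring

theorem IsMetricOn.coordCurvature_skew (h : IsMetricOn G U) {y : E} (hy : y ∈ U) (u v w z : E) :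
    G y (coordCurvature G y u v w) z = -G y (coordCurvature G y u v z) w := by
  have hG := ((h.contDiffAt y hy).differentiableAt (by simp)).hasFDerivAt
  have hD : HasFDerivAt (fderiv ℝ G) (fderiv ℝ (fderiv ℝ G) y) y :=
    (((h.contDiffAt y hy).fderiv_right (m := ∞) (by simp)).differentiableAt (by simp)).hasFDerivAt
  have hΓ := h.hasFDerivAt_christoffelMap hy
  have hΓ2 : ∀ a b : E, HasFDerivAt (fun y' => christoffelMap G y' a b)
      (((fderiv ℝ (christoffelMap G) y).flip a).flip b) y := fun a b => by
    have := (hΓ.clm_apply (hasFDerivAt_const a y)).clm_apply (hasFDerivAt_const b y)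
    refine this.congr_fderiv ?_
    ext; simp
  have hsymm : ∀ a b, fderiv ℝ (fderiv ℝ G) y a b = fderiv ℝ (fderiv ℝ G) y b a :=
    fun a b => ((h.contDiffAt y hy).isSymmSndFDerivAt (by simp; exact WithTop.coe_le_coe.2 le_top)).eq a b
  have key : ∀ a b, fderiv ℝ (fderiv ℝ G) y a b w z =
      fderiv ℝ G y a (christoffelMap G y b w) z + G y (fderiv ℝ (christoffelMap G) y a b w) z +
      (fderiv ℝ G y a w (christoffelMap G y b z) + G y w (fderiv ℝ (christoffelMap G) y a b z)) := by
    intro a b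
    have e : (fun y' => fderiv ℝ G y' b w z) =ᶠ[nhds y] fun y' =>
        G y' (christoffelMap G y' b w) z + G y' w (christoffelMap G y' b z) := by
      filter_upwards [h.isOpen.mem_nhds hy] with y' hy' using h.fderiv_eq hy' b w z
    have h1 := ((hD.clm_apply (hasFDerivAt_const b y)).clm_apply (hasFDerivAt_const w y)).clm_apply
      (hasFDerivAt_const z y)
    have h2 := (hG.clm_apply (hΓ2 b w)).clm_apply (hasFDerivAt_const z y)
    have h3 := (hG.clm_apply (hasFDerivAt_const w y)).clm_apply (hΓ2 b z)
    have := (h1.congr_of_eventuallyEq e.symm).unique (h2.add h3)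
    have := DFunLike.congr_fun this a
    simp at this
    linarith
  have k1 := key u v
  have k2 := key v u
  rw [hsymm v u] at k2
  have k3 := k1.symm.trans k2
  simp only [h.fderiv_eq hy] at k3
  rw [h.coordCurvature_eq hy, h.coordCurvature_eq hy]
  simp only [map_add, map_sub, sub_apply, add_apply]
  simp only [h.symm y hy w] at k3
  have s1 := h.symm y hy (christoffelMap G y v w) (christoffelMap G y u z)
  have s2 := h.symm y hy (christoffelMap G y u w) (christoffelMap G y v z)
  linarith

/-- Christoffel symbols in different coordinates. -/
theorem IsMetricOn.christoffel_pullback {G' : E → E →L[ℝ] E →L[ℝ] ℝ} {U' : Set E} (h : IsMetricOn G U)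
    (h' : IsMetricOn G' U') {f : E → E} (hf : ∀ y ∈ U', ContDiffAt ℝ ∞ f y)
    (hU : ∀ y ∈ U', f y ∈ U)
    (hG : ∀ y ∈ U', ∀ v w, G' y v w = G (f y) (fderiv ℝ f y v) (fderiv ℝ f y w))
    {y : E} (hy : y ∈ U') (v w : E) :
    fderiv ℝ f y (christoffelMap G' y v w) =
      christoffelMap G (f y) (fderiv ℝ f y v) (fderiv ℝ f y w) + fderiv ℝ (fderiv ℝ f) y v w := by
  have hG0 := ((h.contDiffAt _ (hU y hy)).differentiableAt (by simp)).hasFDerivAt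
  have hG1 := ((h'.contDiffAt y hy).differentiableAt (by simp)).hasFDerivAt
  have hf1 := ((hf y hy).differentiableAt (by simp)).hasFDerivAt
  have hf2 : HasFDerivAt (fderiv ℝ f) (fderiv ℝ (fderiv ℝ f) y) y :=
    (((hf y hy).fderiv_right (m := ∞) (by simp)).differentiableAt (by simp)).hasFDerivAt
  have hsymm : ∀ a b, fderiv ℝ (fderiv ℝ f) y a b = fderiv ℝ (fderiv ℝ f) y b a :=
    fun a b => ((hf y hy).isSymmSndFDerivAt (by simp; exact WithTop.coe_le_coe.2 le_top)).eq a b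
  have key : ∀ u v w, fderiv ℝ G' y u v w =
      fderiv ℝ G (f y) (fderiv ℝ f y u) (fderiv ℝ f y v) (fderiv ℝ f y w) +
      G (f y) (fderiv ℝ (fderiv ℝ f) y u v) (fderiv ℝ f y w) +
      G (f y) (fderiv ℝ f y v) (fderiv ℝ (fderiv ℝ f) y u w) := by
    intro u v w
    have e : (fun y' => G' y' v w) =ᶠ[nhds y] fun y' =>
        G (f y') (fderiv ℝ f y' v) (fderiv ℝ f y' w) := by
      filter_upwards [h'.isOpen.mem_nhds hy] with y' hy' using hG y' hy' v w
    have h1 := (hG1.clm_apply (hasFDerivAt_const v y)).clm_apply (hasFDerivAt_const w y)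
    have h2 := ((hG0.comp y hf1).clm_apply (hf2.clm_apply (hasFDerivAt_const v y))).clm_apply
      (hf2.clm_apply (hasFDerivAt_const w y))
    have := DFunLike.congr_fun ((h1.congr_of_eventuallyEq e.symm).unique h2) u
    simp at this
    linarith
  have hinj : Function.Injective (fderiv ℝ f y) := by
    rw [injective_iff_map_eq_zero]
    intro a ha
    by_contra hne
    have := h'.pos y hy a hne
    rw [hG y hy, ha] at this
    simp at this
  have hsurj : Function.Surjective (fderiv ℝ f y) :=
    LinearMap.surjective_of_injective (f := (fderiv ℝ f y : E →ₗ[ℝ] E)) hinj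
  refine h.eq_of_forall (hU y hy) fun z => ?_
  obtain ⟨z, rfl⟩ := hsurj z
  rw [← hG y hy, christoffelMap_apply, h'.christoffel_spec hy, map_add, add_apply,
    christoffelMap_apply, h.christoffel_spec (hU y hy), key, key, key, hsymm z v, hsymm z w, hsymm w v,
    h.symm _ (hU y hy) (fderiv ℝ f y w), h.symm _ (hU y hy) (fderiv ℝ f y v)
      (fderiv ℝ (fderiv ℝ f) y w z)]
  ring

/-- The curvature tensor in different coordinates. -/
theorem IsMetricOn.coordCurvature_pullback {G' : E → E →L[ℝ] E →L[ℝ] ℝ} {U' : Set E} (h : IsMetricOn G U)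
    (h' : IsMetricOn G' U') {f : E → E} (hf : ∀ y ∈ U', ContDiffAt ℝ ∞ f y)
    (hU : ∀ y ∈ U', f y ∈ U)
    (hG : ∀ y ∈ U', ∀ v w, G' y v w = G (f y) (fderiv ℝ f y v) (fderiv ℝ f y w))
    {y : E} (hy : y ∈ U') (u v w : E) :
    fderiv ℝ f y (coordCurvature G' y u v w) =
      coordCurvature G (f y) (fderiv ℝ f y u) (fderiv ℝ f y v) (fderiv ℝ f y w) := by
  have hΓ := h.hasFDerivAt_christoffelMap (hU y hy)
  have hΓ' := h'.hasFDerivAt_christoffelMap hy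
  have hf1 := ((hf y hy).differentiableAt (by simp)).hasFDerivAt
  have hfs2 := (hf y hy).fderiv_right (m := ∞) (by simp)
  have hf2 := (hfs2.differentiableAt (by simp)).hasFDerivAt
  have hf3 := ((hfs2.fderiv_right (m := ∞) (by simp)).differentiableAt (by simp)).hasFDerivAt
  have hsymm : ∀ a b, fderiv ℝ (fderiv ℝ f) y a b = fderiv ℝ (fderiv ℝ f) y b a :=
    fun a b => ((hf y hy).isSymmSndFDerivAt (by simp; exact WithTop.coe_le_coe.2 le_top)).eq a b
  have hsymm3 : ∀ a b, fderiv ℝ (fderiv ℝ (fderiv ℝ f)) y a b = fderiv ℝ (fderiv ℝ (fderiv ℝ f)) y b a :=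
    fun a b => (hfs2.isSymmSndFDerivAt (by simp; exact WithTop.coe_le_coe.2 le_top)).eq a b
  have hΓf := fun a b => h.christoffel_pullback h' hf hU hG hy a b
  have key : ∀ a b, fderiv ℝ (fderiv ℝ f) y a (christoffelMap G' y b w) +
      fderiv ℝ f y (fderiv ℝ (christoffelMap G') y a b w) =
      fderiv ℝ (christoffelMap G) (f y) (fderiv ℝ f y a) (fderiv ℝ f y b) (fderiv ℝ f y w) +
      christoffelMap G (f y) (fderiv ℝ (fderiv ℝ f) y a b) (fderiv ℝ f y w) +
      christoffelMap G (f y) (fderiv ℝ f y b) (fderiv ℝ (fderiv ℝ f) y a w) +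
      fderiv ℝ (fderiv ℝ (fderiv ℝ f)) y a b w := by
    intro a b
    have e : (fun y' => fderiv ℝ f y' (christoffelMap G' y' b w)) =ᶠ[nhds y] fun y' =>
        christoffelMap G (f y') (fderiv ℝ f y' b) (fderiv ℝ f y' w) + fderiv ℝ (fderiv ℝ f) y' b w := by
      filter_upwards [h'.isOpen.mem_nhds hy] with y' hy' using
        h.christoffel_pullback h' hf hU hG hy' b w
    have h1 := hf2.clm_apply ((hΓ'.clm_apply (hasFDerivAt_const b y)).clm_apply (hasFDerivAt_const w y))
    have h2 := ((hΓ.comp y hf1).clm_apply (hf2.clm_apply (hasFDerivAt_const b y))).clm_apply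
      (hf2.clm_apply (hasFDerivAt_const w y))
    have h3 := (hf3.clm_apply (hasFDerivAt_const b y)).clm_apply (hasFDerivAt_const w y)
    have := DFunLike.congr_fun ((h1.congr_of_eventuallyEq e.symm).unique (h2.add h3)) a
    simp at this
    rw [add_comm, this]
    abel
  have k1 := key u v
  have k2 := key v u
  rw [hsymm v u, hsymm3 v u] at k2
  rw [h'.coordCurvature_eq hy, h.coordCurvature_eq (hU y hy), map_sub, map_add, map_sub, hΓf, hΓf, hΓf,
    hΓf, map_add, map_add, ← sub_eq_zero]
  have k3 := congrArg₂ (· - ·) k1 k2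
  rw [← sub_eq_zero] at k3
  rw [← k3]
  abel

theorem IsMetricOn.christoffel_prod {F : Type*} [NormedAddCommGroup F] [NormedSpace ℝ F]
    [FiniteDimensional ℝ F] {G₂ : F → F →L[ℝ] F →L[ℝ] ℝ} {U₂ : Set F} (h : IsMetricOn G U)
    (h₂ : IsMetricOn G₂ U₂) {K : E × F → (E × F) →L[ℝ] (E × F) →L[ℝ] ℝ} {V : Set (E × F)}
    (hK : IsMetricOn K V) (hV : ∀ y ∈ V, y.1 ∈ U ∧ y.2 ∈ U₂)
    (hKG : ∀ y ∈ V, ∀ v w, K y v w = G y.1 v.1 w.1 + G₂ y.2 v.2 w.2) {y : E × F} (hy : y ∈ V)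
    (v w : E × F) :
    christoffel K y v w = (christoffel G y.1 v.1 w.1, christoffel G₂ y.2 v.2 w.2) := by
  have hG0 := ((h.contDiffAt _ (hV y hy).1).differentiableAt (by simp)).hasFDerivAt
  have hG2 := ((h₂.contDiffAt _ (hV y hy).2).differentiableAt (by simp)).hasFDerivAt
  have hK1 := ((hK.contDiffAt y hy).differentiableAt (by simp)).hasFDerivAt
  have key : ∀ u v w, fderiv ℝ K y u v w =
      fderiv ℝ G y.1 u.1 v.1 w.1 + fderiv ℝ G₂ y.2 u.2 v.2 w.2 := by
    intro u v w
    have e : (fun y' => K y' v w) =ᶠ[nhds y] fun y' => G y'.1 v.1 w.1 + G₂ y'.2 v.2 w.2 := by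
      filter_upwards [hK.isOpen.mem_nhds hy] with y' hy' using hKG y' hy' v w
    have h1 := (hK1.clm_apply (hasFDerivAt_const v y)).clm_apply (hasFDerivAt_const w y)
    have h2 := ((hG0.comp y hasFDerivAt_fst).clm_apply (hasFDerivAt_const v.1 y)).clm_apply
      (hasFDerivAt_const w.1 y)
    have h3 := ((hG2.comp y hasFDerivAt_snd).clm_apply (hasFDerivAt_const v.2 y)).clm_apply
      (hasFDerivAt_const w.2 y)
    have := DFunLike.congr_fun ((h1.congr_of_eventuallyEq e.symm).unique (h2.add h3)) u
    simpa using this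
  symm
  refine hK.eq_christoffel hy fun z => ?_
  rw [hKG y hy, h.christoffel_spec (hV y hy).1, h₂.christoffel_spec (hV y hy).2, key, key, key]
  ring

theorem IsMetricOn.coordCurvature_prod {F : Type*} [NormedAddCommGroup F] [NormedSpace ℝ F]
    [FiniteDimensional ℝ F] {G₂ : F → F →L[ℝ] F →L[ℝ] ℝ} {U₂ : Set F} (h : IsMetricOn G U)
    (h₂ : IsMetricOn G₂ U₂) {K : E × F → (E × F) →L[ℝ] (E × F) →L[ℝ] ℝ} {V : Set (E × F)}
    (hK : IsMetricOn K V) (hV : ∀ y ∈ V, y.1 ∈ U ∧ y.2 ∈ U₂)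
    (hKG : ∀ y ∈ V, ∀ v w, K y v w = G y.1 v.1 w.1 + G₂ y.2 v.2 w.2) {y : E × F} (hy : y ∈ V)
    (u v w : E × F) :
    coordCurvature K y u v w =
      (coordCurvature G y.1 u.1 v.1 w.1, coordCurvature G₂ y.2 u.2 v.2 w.2) := by
  have hΓ := fun {y} (hy : y ∈ V) => h.christoffel_prod h₂ hK hV hKG hy
  have hd1 : ∀ v w, HasFDerivAt (fun y => christoffel G y v w)
      (fderiv ℝ (fun y => christoffel G y v w) y.1) y.1 := fun v w =>
    (((((h.contDiffAt_christoffelMap (hV y hy).1).clm_apply contDiffAt_const).clm_apply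
      contDiffAt_const)).differentiableAt (by simp)).hasFDerivAt
  have hd2 : ∀ v w, HasFDerivAt (fun y => christoffel G₂ y v w)
      (fderiv ℝ (fun y => christoffel G₂ y v w) y.2) y.2 := fun v w =>
    (((((h₂.contDiffAt_christoffelMap (hV y hy).2).clm_apply contDiffAt_const).clm_apply
      contDiffAt_const)).differentiableAt (by simp)).hasFDerivAt
  have key : ∀ u v w, fderiv ℝ (fun y' => christoffel K y' v w) y u =
      (fderiv ℝ (fun y => christoffel G y v.1 w.1) y.1 u.1,
        fderiv ℝ (fun y => christoffel G₂ y v.2 w.2) y.2 u.2) := by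
    intro u v w
    have e : (fun y' => christoffel K y' v w) =ᶠ[nhds y] fun y' =>
        (christoffel G y'.1 v.1 w.1, christoffel G₂ y'.2 v.2 w.2) := by
      filter_upwards [hK.isOpen.mem_nhds hy] with y' hy' using hΓ hy' v w
    have h1 := (((hd1 v.1 w.1).comp y hasFDerivAt_fst).prodMk
      ((hd2 v.2 w.2).comp y hasFDerivAt_snd)).congr_of_eventuallyEq e
    rw [h1.fderiv]
    rfl
  simp only [coordCurvature, key, hΓ hy]
  rfl

end CoordinateMetrics

end

section

set_option maxSynthPendingDepth 3

section ChartMetric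

variable {E : Type*} [NormedAddCommGroup E] [NormedSpace ℝ E]
  {H : Type*} [TopologicalSpace H] {I : ModelWithCorners ℝ E H} [I.Boundaryless]
  {M : Type*} [TopologicalSpace M] [ChartedSpace H M] [IsManifold I ∞ M]

/-- The derivative of the inverse of the preferred chart around `p`, as a map from the model space to
the tangent space at a point of the chart domain. -/
abbrev chartFrame (I : ModelWithCorners ℝ E H) [IsManifold I ∞ M] (p x : M) : E →L[ℝ] TangentSpace I x :=
  (trivializationAt E (TangentSpace I (M := M)) p).symmL ℝ x

theorem mfderiv_extChartAt_symm {p : M} {y : E} (hy : y ∈ (extChartAt I p).target) :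
    mfderiv 𝓘(ℝ, E) I (extChartAt I p).symm y = chartFrame I p ((extChartAt I p).symm y) := by
  have hx : (extChartAt I p).symm y ∈ (chartAt H p).source := by
    rw [← extChartAt_source (I := I)]
    exact (extChartAt I p).map_target hy
  rw [chartFrame, TangentBundle.symmL_trivializationAt hx, I.range_eq_univ, mfderivWithin_univ,
    (extChartAt I p).right_inv hy]

theorem mem_baseSet_of_mem_source {p x : M} (hx : x ∈ (extChartAt I p).source) :
    x ∈ (trivializationAt E (TangentSpace I (M := M)) p).baseSet := by
  rwa [extChartAt_source, ← TangentBundle.trivializationAt_baseSet (I := I)] at hx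

/-- The derivative of the preferred chart as an isomorphism. -/
def chartFrameEquiv (I : ModelWithCorners ℝ E H) [I.Boundaryless] [IsManifold I ∞ M] (p x : M)
    (hx : x ∈ (extChartAt I p).source) : E ≃L[ℝ] TangentSpace I x :=
  ((trivializationAt E (TangentSpace I (M := M)) p).continuousLinearEquivAt ℝ x
    (mem_baseSet_of_mem_source hx)).symm

theorem chartFrameEquiv_apply {p x : M} (hx : x ∈ (extChartAt I p).source) (v : E) :
    chartFrameEquiv I p x hx v = chartFrame I p x v := by
  rw [chartFrame, Trivialization.symmL_apply _ (mem_baseSet_of_mem_source hx)]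
  rfl

theorem chartFrame_self (p : M) (v : E) : chartFrame I p p v = v := by
  rw [chartFrame, TangentBundle.symmL_trivializationAt (mem_chart_source H p),
    mfderivWithin_range_extChartAt_symm]
  rfl

variable (g : SmoothMetric I M)

theorem SmoothMetric.inChart_apply {p : M} {y : E} (hy : y ∈ (extChartAt I p).target) (v w : E) :
    g.inChart p y v w = g.inner ((extChartAt I p).symm y) (chartFrame I p _ v) (chartFrame I p _ w) := by
  rw [← mfderiv_extChartAt_symm hy]
  rfl

theorem SmoothMetric.inChart_extChartAt {p x : M} (hx : x ∈ (extChartAt I p).source) (v w : E) :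
    g.inChart p (extChartAt I p x) v w = g.inner x (chartFrame I p x v) (chartFrame I p x w) := by
  obtain ⟨y, hy, rfl⟩ : ∃ y ∈ (extChartAt I p).target, (extChartAt I p).symm y = x :=
    ⟨_, (extChartAt I p).map_source hx, (extChartAt I p).left_inv hx⟩
  rw [(extChartAt I p).right_inv hy, g.inChart_apply hy]

theorem SmoothMetric.isMetricOn_inChart (p : M) :
    IsMetricOn (g.inChart p) (extChartAt I p).target where
  isOpen := isOpen_extChartAt_target p
  symm y hy v w := by rw [g.inChart_apply hy, g.inChart_apply hy, g.symm]
  pos y hy v hv := by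
    rw [g.inChart_apply hy]
    refine g.pos _ _ fun h => hv ?_
    rw [← chartFrameEquiv_apply ((extChartAt I p).map_target hy)] at h
    exact (chartFrameEquiv I p _ ((extChartAt I p).map_target hy)).map_eq_zero_iff.1 h
  contDiffAt y hy := by
    have hx := (extChartAt I p).map_target hy
    have hb := mem_baseSet_of_mem_source hx
    have h1 := ((trivializationAt (E →L[ℝ] E →L[ℝ] ℝ)
      (fun x : M => TangentSpace I x →L[ℝ] TangentSpace I x →L[ℝ] ℝ) p).contMDiffAt_section_iff
        (s := g.inner) (n := ∞) (x₀ := (extChartAt I p).symm y) (IB := I) ⟨hb, hb, Set.mem_univ _⟩).1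
        (g.contMDiff _)
    have h2 := h1.comp y ((contMDiffOn_extChartAt_symm (n := ∞) p).contMDiffAt
      ((isOpen_extChartAt_target p).mem_nhds hy))
    refine h2.contDiffAt.congr_of_eventuallyEq ?_
    filter_upwards [(isOpen_extChartAt_target p).mem_nhds hy] with y' hy'
    ext v w
    have hb' := mem_baseSet_of_mem_source ((extChartAt I p).map_target hy')
    rw [g.inChart_apply hy']
    simp only [Function.comp_apply, hom_trivializationAt_apply]
    rw [inCoordinates_apply_eq₂ hb' hb' (Set.mem_univ _)]
    rw [← Trivialization.symmL_apply (R := ℝ) _ hb', ← Trivialization.symmL_apply (R := ℝ) _ hb']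
    simp [chartFrame]

/-- The domain of the chart transition from the preferred chart around `p` to the one around `q`. -/
def transitionDomain (I : ModelWithCorners ℝ E H) (p q : M) : Set E :=
  (extChartAt I p).target ∩ (extChartAt I p).symm ⁻¹' (extChartAt I q).source

theorem isOpen_transitionDomain (p q : M) : IsOpen (transitionDomain I p q) :=
  (continuousOn_extChartAt_symm p).isOpen_inter_preimage (isOpen_extChartAt_target p)
    (isOpen_extChartAt_source q)

/-- The chart transition. -/
def transition (I : ModelWithCorners ℝ E H) (p q : M) (y : E) : E :=
  extChartAt I q ((extChartAt I p).symm y)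

theorem contDiffAt_transition {p q : M} {y : E} (hy : y ∈ transitionDomain I p q) :
    ContDiffAt ℝ ∞ (transition I p q) y := by
  have h1 := (contMDiffOn_extChartAt_symm (I := I) (n := ∞) p).contMDiffAt
      ((isOpen_extChartAt_target p).mem_nhds hy.1)
  have h2 : ContMDiffAt I 𝓘(ℝ, E) ∞ (extChartAt I q) ((extChartAt I p).symm y) := by
    refine contMDiffAt_extChartAt' ?_
    rw [← extChartAt_source (I := I)]
    exact hy.2
  exact (h2.comp y h1).contDiffAt

theorem transition_mem {p q : M} {y : E} (hy : y ∈ transitionDomain I p q) :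
    transition I p q y ∈ (extChartAt I q).target := (extChartAt I q).map_source hy.2

theorem symm_transition {p q : M} {y : E} (hy : y ∈ transitionDomain I p q) :
    (extChartAt I q).symm (transition I p q y) = (extChartAt I p).symm y :=
  (extChartAt I q).left_inv hy.2

theorem chartFrame_fderiv_transition {p q : M} {y : E} (hy : y ∈ transitionDomain I p q) (v : E) :
    chartFrame I q ((extChartAt I p).symm y) (fderiv ℝ (transition I p q) y v) =
      chartFrame I p ((extChartAt I p).symm y) v := by
  have hp : (extChartAt I p).symm y ∈ (chartAt H p).source := by
    rw [← extChartAt_source (I := I)]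
    exact (extChartAt I p).map_target hy.1
  have hq : (extChartAt I p).symm y ∈ (chartAt H q).source := by
    rw [← extChartAt_source (I := I)]
    exact hy.2
  have h1 : MDifferentiableAt 𝓘(ℝ, E) I (extChartAt I p).symm y :=
    ((contMDiffOn_extChartAt_symm (I := I) (n := ∞) p).contMDiffAt
      ((isOpen_extChartAt_target p).mem_nhds hy.1)).mdifferentiableAt (by simp)
  have h2 : MDifferentiableAt I 𝓘(ℝ, E) (extChartAt I q) ((extChartAt I p).symm y) :=
    mdifferentiableAt_extChartAt hq
  have h3 : fderiv ℝ (transition I p q) y = (mfderiv I 𝓘(ℝ, E) (extChartAt I q)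
      ((extChartAt I p).symm y)).comp (mfderiv 𝓘(ℝ, E) I (extChartAt I p).symm y) := by
    rw [← mfderiv_eq_fderiv]
    exact mfderiv_comp y h2 h1
  rw [h3, mfderiv_extChartAt_symm hy.1, ← TangentBundle.continuousLinearMapAt_trivializationAt hq]
  exact (trivializationAt E (TangentSpace I (M := M)) q).symmL_continuousLinearMapAt
    (mem_baseSet_of_mem_source hy.2) _

theorem SmoothMetric.inChart_transition {p q : M} {y : E} (hy : y ∈ transitionDomain I p q) (v w : E) :
    g.inChart p y v w = g.inChart q (transition I p q y) (fderiv ℝ (transition I p q) y v)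
      (fderiv ℝ (transition I p q) y w) := by
  rw [g.inChart_apply hy.1, transition, g.inChart_extChartAt hy.2, ← chartFrame_fderiv_transition hy v,
    ← chartFrame_fderiv_transition hy w]

variable [FiniteDimensional ℝ E]

/-- The curvature tensor can be computed in any chart. -/
theorem SmoothMetric.curvatureTensor_chartFrame {p x : M} (hx : x ∈ (extChartAt I p).source)
    (u v w : E) :
    g.curvatureTensor x (chartFrame I p x u) (chartFrame I p x v) (chartFrame I p x w) =
      chartFrame I p x (coordCurvature (g.inChart p) (extChartAt I p x) u v w) := by
  set y := extChartAt I p x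
  have hyx : (extChartAt I p).symm y = x := (extChartAt I p).left_inv hx
  have hy : y ∈ transitionDomain I p x :=
    ⟨(extChartAt I p).map_source hx, by
      rw [Set.mem_preimage, hyx]; exact mem_extChartAt_source x⟩
  have hyy : transition I p x y = extChartAt I x x := by rw [transition, hyx]
  have hfr : ∀ v, chartFrame I p x v = fderiv ℝ (transition I p x) y v := fun v => by
    have h := chartFrame_fderiv_transition hy v
    rw [hyx] at h
    rw [← h, chartFrame_self]
  have key := (g.isMetricOn_inChart x).coordCurvature_pullback
    ((g.isMetricOn_inChart p).mono (isOpen_transitionDomain p x) Set.inter_subset_left)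
    (f := transition I p x) (fun y hy => contDiffAt_transition hy) (fun y hy => transition_mem hy)
    (fun y hy v w => g.inChart_transition hy v w) hy u v w
  rw [hyy, ← hfr, ← hfr, ← hfr, ← hfr] at key
  exact key.symm

end ChartMetric

end

section

set_option maxSynthPendingDepth 3

section CoordinateTensor

variable {E : Type*} [NormedAddCommGroup E] [NormedSpace ℝ E] [FiniteDimensional ℝ E]
  {G : E → E →L[ℝ] E →L[ℝ] ℝ} {U : Set E}

/-- The curvature tensor of a metric in coordinates is an algebraic curvature tensor. -/
theorem IsMetricOn.isCurvatureTensor_of_equiv (h : IsMetricOn G U) {y : E} (hy : y ∈ U)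
    {V : Type*} [NormedAddCommGroup V] [InnerProductSpace ℝ V] (D : E ≃L[ℝ] V)
    (hD : ∀ a b, inner ℝ (D a) (D b) = G y a b) {R : V → V → V → V}
    (hR : ∀ u v w, R (D u) (D v) (D w) = D (coordCurvature G y u v w)) : IsCurvatureTensor R := by
  have hR' : ∀ u v w, R u v w = D (coordCurvature G y (D.symm u) (D.symm v) (D.symm w)) := by
    intro u v w
    rw [← hR]
    simp
  refine ⟨fun u u' v w => ?_, fun c u v w => ?_, fun u v w => ?_, fun u v w w' => ?_, fun c u v w => ?_,
    fun u v w z => ?_, ?_⟩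
  · simp only [hR', h.coordCurvature_eq hy, map_add, map_sub, add_apply]
    abel
  · simp only [hR', h.coordCurvature_eq hy, map_smul, smul_apply, ← smul_sub, ← smul_add]
  · simp only [hR', h.coordCurvature_eq hy, ← map_neg]
    congr 1
    abel
  · simp only [hR', h.coordCurvature_eq hy, map_add, map_sub]
    abel
  · simp only [hR', h.coordCurvature_eq hy, map_smul, ← smul_sub, ← smul_add]
  · obtain ⟨z, rfl⟩ := D.surjective z
    obtain ⟨w, rfl⟩ := D.surjective w
    rw [hR', hR', hD, hD]
    simp only [ContinuousLinearEquiv.symm_apply_apply]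
    exact h.coordCurvature_skew hy _ _ _ _
  · simp only [hR', h.coordCurvature_eq hy]
    fun_prop

end CoordinateTensor

section FormLaw

variable {E : Type*} [NormedAddCommGroup E] [NormedSpace ℝ E] [FiniteDimensional ℝ E]
  [MeasurableSpace E] [BorelSpace E]

/-- The Gaussian density of a quadratic form. -/
def formWeight (G : E →L[ℝ] E →L[ℝ] ℝ) (x : E) : ENNReal :=
  ENNReal.ofReal (Real.exp (-(1 / 2) * G x x))

/-- The distribution of the sectional curvature of a uniformly distributed plane, for a scalar product
`G` and a curvature tensor `R`. -/
def formLaw (μ : Measure E) (G : E →L[ℝ] E →L[ℝ] ℝ) (R : E → E → E → E) : Measure ℝ :=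
  ((∫⁻ x, formWeight G x ∂μ)⁻¹ * (∫⁻ x, formWeight G x ∂μ)⁻¹) •
    ((μ.prod μ).withDensity fun z => formWeight G z.1 * formWeight G z.2).map
      fun z => G (R z.2 z.1 z.1) z.2 / (G z.1 z.1 * G z.2 z.2 - G z.1 z.2 ^ 2)

theorem map_sectionalCurvature_eq_formLaw (μ : Measure E) [μ.IsAddHaarMeasure] {V : Type*}
    [NormedAddCommGroup V] [InnerProductSpace ℝ V] [FiniteDimensional ℝ V] (D : E ≃L[ℝ] V)
    {G : E →L[ℝ] E →L[ℝ] ℝ} (hD : ∀ a b, inner ℝ (D a) (D b) = G a b) {RV : V → V → V → V}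
    (hRV : IsCurvatureTensor RV) {R : E → E → E → E}
    (hR : ∀ u v w, RV (D u) (D v) (D w) = D (R u v w)) (hV : 2 ≤ Module.finrank ℝ V) :
    (uniformPlane V).map (sectionalCurvature RV) = formLaw μ G R := by
  let _ : MeasurableSpace V := borel V
  have : BorelSpace V := ⟨rfl⟩
  have hw : ∀ x, gaussianWeight (D x) = formWeight G x := fun x => by
    rw [gaussianWeight, formWeight, ← hD, real_inner_self_eq_norm_sq]
  have hwm : Measurable fun x => formWeight G x := by
    unfold formWeight
    have : Continuous fun x => G x x := by fun_prop
    exact ENNReal.measurable_ofReal.comp ((Real.measurable_exp.comp (this.measurable.const_mul _)))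
  have hZ : ∫⁻ x, formWeight G x ∂μ ≠ 0 := by
    have h1 := lintegral_gaussianWeight_ne_zero (μ.map D)
    rwa [lintegral_map measurable_gaussianWeight D.continuous.measurable, lintegral_congr hw] at h1
  have hsf : SFinite (μ.withDensity fun x => formWeight G x) := inferInstance
  have hγ : gaussian V = (∫⁻ x, formWeight G x ∂μ)⁻¹ • (μ.withDensity fun x => formWeight G x).map D := by
    rw [gaussian_eq_map D μ, lintegral_congr hw]
    congr 3
    ext x
    exact hw x
  have hDm : Measurable D := D.continuous.measurable
  have hmp := Measure.map_prod_map (μ.withDensity fun x => formWeight G x)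
    (μ.withDensity fun x => formWeight G x) hDm hDm
  rw [hRV.map_sectionalCurvature hV, hγ, Measure.prod_smul_left, Measure.prod_smul_right, hmp, prod_withDensity hwm hwm, smul_smul, Measure.map_smul,
    Measure.map_map hRV.measurable_pairCurvature (hDm.prodMap hDm), formLaw]
  congr 2
  ext z
  simp only [Function.comp_apply, pairCurvature, Prod.map_fst, Prod.map_snd, hR, hD, gramDet]

set_option maxHeartbeats 1000000 in
theorem measurable_formLaw {T : Type*} [TopologicalSpace T] [SecondCountableTopology T] [MeasurableSpace T]
    [BorelSpace T] (μ : Measure E) [SigmaFinite μ] {G : T → E →L[ℝ] E →L[ℝ] ℝ} (hG : Continuous G)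
    {R : T → E → E → E → E} (hR : Continuous fun x : T × (E × E) => R x.1 x.2.2 x.2.1 x.2.1) :
    Measurable fun y => formLaw μ (G y) (R y) := by
  have hGc : ∀ {f h : T × (E × E) → E}, Continuous f → Continuous h →
      Continuous fun x => G x.1 (f x) (h x) := fun hf hh =>
    ((hG.comp continuous_fst).clm_apply hf).clm_apply hh
  have hG1 : Continuous fun x : T × E => G x.1 x.2 x.2 :=
    ((hG.comp continuous_fst).clm_apply continuous_snd).clm_apply continuous_snd
  have hw : Measurable fun x : T × E => formWeight (G x.1) x.2 :=
    ENNReal.measurable_ofReal.comp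
      (Real.continuous_exp.comp (continuous_const.mul hG1)).measurable
  have c1 : Continuous fun x : T × (E × E) => x.2.1 := continuous_fst.comp continuous_snd
  have c2 : Continuous fun x : T × (E × E) => x.2.2 := continuous_snd.comp continuous_snd
  have hn : Continuous fun x : T × (E × E) => G x.1 (R x.1 x.2.2 x.2.1 x.2.1) x.2.2 := hGc hR c2
  have hd : Continuous fun x : T × (E × E) =>
      G x.1 x.2.1 x.2.1 * G x.1 x.2.2 x.2.2 - G x.1 x.2.1 x.2.2 ^ 2 :=
    ((hGc c1 c1).mul (hGc c2 c2)).sub ((hGc c1 c2).pow 2)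
  have hK : Measurable fun x : T × (E × E) => G x.1 (R x.1 x.2.2 x.2.1 x.2.1) x.2.2 /
      (G x.1 x.2.1 x.2.1 * G x.1 x.2.2 x.2.2 - G x.1 x.2.1 x.2.2 ^ 2) :=
    hn.measurable.div hd.measurable
  have hw2 : Measurable fun x : T × (E × E) => formWeight (G x.1) x.2.1 * formWeight (G x.1) x.2.2 :=
    (hw.comp (measurable_fst.prodMk measurable_snd.fst)).mul
      (hw.comp (measurable_fst.prodMk measurable_snd.snd))
  have hZ : Measurable fun y => ∫⁻ x, formWeight (G y) x ∂μ := hw.lintegral_prod_right'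
  refine Measure.measurable_of_measurable_coe _ fun s hs => ?_
  have he : ∀ y, formLaw μ (G y) (R y) s = ((∫⁻ x, formWeight (G y) x ∂μ)⁻¹ *
      (∫⁻ x, formWeight (G y) x ∂μ)⁻¹) * ∫⁻ z, ((fun x : T × (E × E) =>
        G x.1 (R x.1 x.2.2 x.2.1 x.2.1) x.2.2 /
      (G x.1 x.2.1 x.2.1 * G x.1 x.2.2 x.2.2 - G x.1 x.2.1 x.2.2 ^ 2)) ⁻¹' s).indicator
        (fun x => formWeight (G x.1) x.2.1 * formWeight (G x.1) x.2.2) (y, z) ∂(μ.prod μ) := by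
    intro y
    have hKy : Measurable fun z : E × E => G y (R y z.2 z.1 z.1) z.2 /
        (G y z.1 z.1 * G y z.2 z.2 - G y z.1 z.2 ^ 2) := hK.comp (measurable_prodMk_left (x := y))
    rw [formLaw, Measure.smul_apply, smul_eq_mul, Measure.map_apply hKy hs,
      withDensity_apply _ (hKy hs), ← lintegral_indicator (hKy hs)]
    rfl
  simp only [he]
  exact (hZ.inv.mul hZ.inv).mul (hw2.indicator (hK hs)).lintegral_prod_right'

end FormLaw

end

section

set_option maxSynthPendingDepth 3

section CurvatureLaw

variable {E : Type*} [NormedAddCommGroup E] [NormedSpace ℝ E] [FiniteDimensional ℝ E]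
  {H : Type*} [TopologicalSpace H] {I : ModelWithCorners ℝ E H} [I.Boundaryless]
  {M : Type*} [TopologicalSpace M] [ChartedSpace H M] [IsManifold I ∞ M]

theorem SmoothMetric.isCurvatureTensor (g : SmoothMetric I M) (p : M) :
    letI : RiemannianBundle (fun p : M => TangentSpace I p) := ⟨g.toRiemannianMetric⟩
    IsCurvatureTensor (V := TangentSpace I p) (g.curvatureTensor p) := by
  let _ : RiemannianBundle (fun p : M => TangentSpace I p) := ⟨g.toRiemannianMetric⟩
  have hp := mem_extChartAt_source (I := I) p
  refine (g.isMetricOn_inChart p).isCurvatureTensor_of_equiv (mem_extChartAt_target p)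
    (chartFrameEquiv I p p hp) (fun a b => ?_) (fun u v w => ?_)
  · rw [g.inChart_extChartAt hp, ← chartFrameEquiv_apply hp, ← chartFrameEquiv_apply hp]
    rfl
  · simp only [chartFrameEquiv_apply hp]
    exact g.curvatureTensor_chartFrame hp u v w

/-- The distribution of the sectional curvature at a point of a Riemannian manifold. -/
def SmoothMetric.curvatureLaw (g : SmoothMetric I M) (p : M) : Measure ℝ :=
  letI : RiemannianBundle (fun p : M => TangentSpace I p) := ⟨g.toRiemannianMetric⟩
  haveI : FiniteDimensional ℝ (TangentSpace I p) := inferInstanceAs (FiniteDimensional ℝ E)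
  (uniformPlane (TangentSpace I p)).map (sectionalCurvature (g.curvatureTensor p))

theorem SmoothMetric.isProbabilityMeasure_curvatureLaw (g : SmoothMetric I M)
    (hE : 2 ≤ Module.finrank ℝ E) (p : M) : IsProbabilityMeasure (g.curvatureLaw p) := by
  let _ : RiemannianBundle (fun p : M => TangentSpace I p) := ⟨g.toRiemannianMetric⟩
  have : FiniteDimensional ℝ (TangentSpace I p) := inferInstanceAs (FiniteDimensional ℝ E)
  let _ : MeasurableSpace (TangentSpace I p) := borel _
  have : BorelSpace (TangentSpace I p) := ⟨rfl⟩
  have : IsProbabilityMeasure (uniformPlane (TangentSpace I p)) :=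
    isProbabilityMeasure_uniformPlane hE
  exact Measure.isProbabilityMeasure_map
    (g.isCurvatureTensor p).measurable_sectionalCurvature.aemeasurable

/-- The volume of the Grassmannian of planes in a Euclidean space of dimension `d`. -/
def planeVolume (d : ℕ) : ENNReal := fubiniStudyVolume (EuclideanSpace ℝ (Fin d)) Set.univ

theorem fubiniStudyVolume_univ {V : Type*} [NormedAddCommGroup V] [InnerProductSpace ℝ V]
    [FiniteDimensional ℝ V] {d : ℕ} (hd : Module.finrank ℝ V = d) :
    fubiniStudyVolume V Set.univ = planeVolume d := by
  subst hd
  let L := (stdOrthonormalBasis ℝ V).repr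
  rw [planeVolume, ← map_fubiniStudyVolume L, Measure.map_apply
    (Plane.isometry_map L).continuous.measurable MeasurableSet.univ, Set.preimage_univ]

theorem SmoothMetric.map_fubiniStudyVolume_sectionalCurvature (g : SmoothMetric I M)
    (hE : 2 ≤ Module.finrank ℝ E) (p : M) :
    letI : RiemannianBundle (fun p : M => TangentSpace I p) := ⟨g.toRiemannianMetric⟩
    haveI : FiniteDimensional ℝ (TangentSpace I p) := inferInstanceAs (FiniteDimensional ℝ E)
    (fubiniStudyVolume (TangentSpace I p)).map (sectionalCurvature (g.curvatureTensor p)) =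
      planeVolume (Module.finrank ℝ E) • g.curvatureLaw p := by
  let _ : RiemannianBundle (fun p : M => TangentSpace I p) := ⟨g.toRiemannianMetric⟩
  have : FiniteDimensional ℝ (TangentSpace I p) := inferInstanceAs (FiniteDimensional ℝ E)
  let _ : MeasurableSpace (TangentSpace I p) := borel _
  have : BorelSpace (TangentSpace I p) := ⟨rfl⟩
  have h : Module.finrank ℝ (TangentSpace I p) = Module.finrank ℝ E := rfl
  have h2 := fubiniStudyVolume_eq_smul (V := TangentSpace I p) (by rwa [h])
  rw [fubiniStudyVolume_univ h] at h2
  rw [h2, Measure.map_smul]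
  rfl

variable [MeasurableSpace E] [BorelSpace E]

theorem SmoothMetric.curvatureLaw_eq_formLaw (g : SmoothMetric I M) (hE : 2 ≤ Module.finrank ℝ E)
    (μ : Measure E) [μ.IsAddHaarMeasure] {p x : M} (hx : x ∈ (extChartAt I p).source) :
    g.curvatureLaw x = formLaw μ (g.inChart p (extChartAt I p x))
      (coordCurvature (g.inChart p) (extChartAt I p x)) := by
  let _ : RiemannianBundle (fun p : M => TangentSpace I p) := ⟨g.toRiemannianMetric⟩
  have : FiniteDimensional ℝ (TangentSpace I x) := inferInstanceAs (FiniteDimensional ℝ E)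
  refine map_sectionalCurvature_eq_formLaw μ (chartFrameEquiv I p x hx) (fun a b => ?_)
    (g.isCurvatureTensor x) (fun u v w => ?_) hE
  · rw [g.inChart_extChartAt hx, ← chartFrameEquiv_apply hx, ← chartFrameEquiv_apply hx]
    rfl
  · simp only [chartFrameEquiv_apply hx]
    exact g.curvatureTensor_chartFrame hx u v w

variable [MeasurableSpace M] [BorelSpace M]

theorem SmoothMetric.measurable_curvatureLaw [SecondCountableTopology M] [CompactSpace M]
    (g : SmoothMetric I M) (hE : 2 ≤ Module.finrank ℝ E) : Measurable g.curvatureLaw := by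
  obtain ⟨t, ht⟩ := isCompact_univ.elim_finite_subcover (fun p : M => (extChartAt I p).source)
    (fun p => isOpen_extChartAt_source p) (fun x _ => Set.mem_iUnion.2 ⟨x, mem_extChartAt_source x⟩)
  have key : ∀ p : M, Measurable fun x : (extChartAt I p).source => g.curvatureLaw x := by
    intro p
    let μ := (Module.finBasis ℝ E).addHaar
    have h : (fun x : (extChartAt I p).source => g.curvatureLaw x) =
        fun x : (extChartAt I p).source => formLaw μ
        (g.inChart p (extChartAt I p x)) (coordCurvature (g.inChart p) (extChartAt I p x)) := by
      ext1 x
      exact g.curvatureLaw_eq_formLaw hE μ x.2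
    rw [h]
    have hc : Continuous fun x : (extChartAt I p).source => extChartAt I p x :=
      (continuousOn_extChartAt p).domRestrict
    have hm := g.isMetricOn_inChart p
    have hmem : ∀ x : (extChartAt I p).source, extChartAt I p x ∈ (extChartAt I p).target := fun x =>
      (extChartAt I p).map_source x.2
    refine measurable_formLaw (T := (extChartAt I p).source) μ
      (G := fun x => g.inChart p (extChartAt I p x))
      (R := fun x => coordCurvature (g.inChart p) (extChartAt I p x)) ?_ ?_
    · exact continuous_iff_continuousAt.2 fun x =>
        (hm.contDiffAt _ (hmem x)).continuousAt.comp
          (f := fun x : (extChartAt I p).source => extChartAt I p x) hc.continuousAt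
    · have hΓ : Continuous fun x : (extChartAt I p).source =>
          christoffelMap (g.inChart p) (extChartAt I p x) := continuous_iff_continuousAt.2 fun x =>
        (hm.contDiffAt_christoffelMap (hmem x)).continuousAt.comp
          (f := fun x : (extChartAt I p).source => extChartAt I p x) hc.continuousAt
      have hΓ' : Continuous fun x : (extChartAt I p).source =>
          fderiv ℝ (christoffelMap (g.inChart p)) (extChartAt I p x) := continuous_iff_continuousAt.2 fun x =>
        ((hm.contDiffAt_christoffelMap (hmem x)).fderiv_right (m := ∞) (by simp)).continuousAt.comp
          (f := fun x : (extChartAt I p).source => extChartAt I p x) hc.continuousAt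
      have he : ∀ x : (extChartAt I p).source × (E × E), coordCurvature (g.inChart p)
          (extChartAt I p x.1) x.2.2 x.2.1 x.2.1 = _ := fun x =>
        hm.coordCurvature_eq (hmem x.1) x.2.2 x.2.1 x.2.1
      simp only [he]
      have c1 : Continuous fun x : (extChartAt I p).source × (E × E) => x.2.1 :=
        continuous_fst.comp continuous_snd
      have c2 : Continuous fun x : (extChartAt I p).source × (E × E) => x.2.2 :=
        continuous_snd.comp continuous_snd
      have d1 := hΓ.comp (continuous_fst (X := (extChartAt I p).source) (Y := E × E))
      have d2 := hΓ'.comp (continuous_fst (X := (extChartAt I p).source) (Y := E × E))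
      refine Continuous.sub (Continuous.add (Continuous.sub ?_ ?_) ?_) ?_
      · exact ((d2.clm_apply c2).clm_apply c1).clm_apply c1
      · exact ((d2.clm_apply c1).clm_apply c2).clm_apply c1
      · exact (d1.clm_apply c2).clm_apply ((d1.clm_apply c1).clm_apply c1)
      · exact (d1.clm_apply c1).clm_apply ((d1.clm_apply c2).clm_apply c1)
  intro A hA
  have : g.curvatureLaw ⁻¹' A = ⋃ p ∈ t, Subtype.val ''
      ((fun x : (extChartAt I p).source => g.curvatureLaw x) ⁻¹' A) := by
    ext x
    simp only [Set.mem_iUnion]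
    constructor
    · intro hx
      obtain ⟨p, hp, hxp⟩ := Set.mem_iUnion₂.1 (ht (Set.mem_univ x))
      exact ⟨p, hp, ⟨x, hxp⟩, hx, rfl⟩
    · rintro ⟨p, hp, y, hy, rfl⟩
      exact hy
  rw [this]
  exact Finset.measurableSet_biUnion _ fun p _ =>
    (isOpen_extChartAt_source p).measurableSet.subtype_image (key p hA)

end CurvatureLaw

end

section

set_option maxSynthPendingDepth 3

section FormDet

variable {E : Type*} [NormedAddCommGroup E] [NormedSpace ℝ E]
  {ι : Type*} [Fintype ι] [DecidableEq ι]

/-- The determinant of a bilinear form in a basis. -/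
def formDet (b : Module.Basis ι ℝ E) (B : E →L[ℝ] E →L[ℝ] ℝ) : ℝ :=
  (Matrix.of fun i j => B (b i) (b j)).det

theorem formDet_pos (b : Module.Basis ι ℝ E) {B : E →L[ℝ] E →L[ℝ] ℝ} (hs : ∀ v w, B v w = B w v)
    (hB : ∀ v, v ≠ 0 → 0 < B v v) : 0 < formDet b B := by
  refine Matrix.PosDef.det_pos ⟨?_, fun x hx => ?_⟩
  · ext i j
    simp [Matrix.conjTranspose_apply, hs (b j)]
  · have hne : b.repr.symm x ≠ 0 := (LinearEquiv.map_ne_zero_iff _).2 hx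
    have h := hB _ hne
    have e := LinearMap.sum_repr_mul_repr_mul b b
      (B := (ContinuousLinearMap.coeLM ℝ).comp (B : E →ₗ[ℝ] E →L[ℝ] ℝ)) (b.repr.symm x) (b.repr.symm x)
    rw [LinearEquiv.apply_symm_apply] at e
    refine lt_of_lt_of_eq h (e.symm.trans ?_)
    refine Finset.sum_congr rfl fun i _ => Finset.sum_congr rfl fun j _ => ?_
    simp
    ring

theorem formDet_comp (b : Module.Basis ι ℝ E) {B B' : E →L[ℝ] E →L[ℝ] ℝ} (A : E →ₗ[ℝ] E)
    (h : ∀ v w, B' v w = B (A v) (A w)) : formDet b B' = LinearMap.det A ^ 2 * formDet b B := by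
  let C := (ContinuousLinearMap.coeLM ℝ).comp (B : E →ₗ[ℝ] E →L[ℝ] ℝ)
  have h1 := LinearMap.toMatrix₂_compl₁₂ b b b b C A A
  have e1 : Matrix.of (fun i j => B' (b i) (b j)) = LinearMap.toMatrix₂ b b (C.compl₁₂ A A) := by
    ext i j
    simp [LinearMap.toMatrix₂_apply, C, h]
  have e2 : Matrix.of (fun i j => B (b i) (b j)) = LinearMap.toMatrix₂ b b C := by
    ext i j
    simp [LinearMap.toMatrix₂_apply, C]
  rw [formDet, formDet, e1, e2, h1, Matrix.det_mul, Matrix.det_mul, Matrix.det_transpose,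
    LinearMap.det_toMatrix]
  ring

theorem formDet_basis {ι' : Type*} [Fintype ι'] [DecidableEq ι'] (b : Module.Basis ι ℝ E)
    (b' : Module.Basis ι' ℝ E) (σ : ι ≃ ι') (B : E →L[ℝ] E →L[ℝ] ℝ) :
    formDet b' B = LinearMap.det (b.equiv b' σ : E →ₗ[ℝ] E) ^ 2 * formDet b B := by
  have h := Matrix.det_reindex_self σ.symm (Matrix.of fun i j => B (b' i) (b' j))
  let C := (ContinuousLinearMap.coeLM ℝ).comp (B : E →ₗ[ℝ] E →L[ℝ] ℝ)
  have h1 := LinearMap.toMatrix₂_compl₁₂ b b b b C (b.equiv b' σ : E →ₗ[ℝ] E) (b.equiv b' σ : E →ₗ[ℝ] E)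
  have e1 : Matrix.reindex σ.symm σ.symm (Matrix.of fun i j => B (b' i) (b' j)) =
      LinearMap.toMatrix₂ b b (C.compl₁₂ (b.equiv b' σ : E →ₗ[ℝ] E) (b.equiv b' σ : E →ₗ[ℝ] E)) := by
    ext i j
    simp [LinearMap.toMatrix₂_apply, C]
  have e2 : Matrix.of (fun i j => B (b i) (b j)) = LinearMap.toMatrix₂ b b C := by
    ext i j
    simp [LinearMap.toMatrix₂_apply, C]
  rw [formDet, formDet, ← h, e1, e2, h1, Matrix.det_mul, Matrix.det_mul, Matrix.det_transpose,
    LinearMap.det_toMatrix]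
  ring

variable [FiniteDimensional ℝ E] [MeasurableSpace E] [BorelSpace E]

/-- The volume of a scalar product does not depend on the basis in which it is computed. -/
theorem ofReal_sqrt_formDet_smul_addHaar {ι' : Type*} [Fintype ι'] [DecidableEq ι']
    (b : Module.Basis ι ℝ E) (b' : Module.Basis ι' ℝ E) :
    ∃ c : ENNReal, c ≠ ⊤ ∧ b.addHaar = c • b'.addHaar ∧
      ∀ B : E →L[ℝ] E →L[ℝ] ℝ, 0 ≤ formDet b B →
        ENNReal.ofReal √(formDet b' B) = c * ENNReal.ofReal √(formDet b B) := by
  let σ : ι ≃ ι' := b.indexEquiv b'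
  let A := b.equiv b' σ
  have hdet : LinearMap.det (A : E →ₗ[ℝ] E) ≠ 0 := A.isUnit_det'.ne_zero
  have hmap : Measure.map A b.addHaar = b'.addHaar := by
    have h1 := b.map_addHaar A.toContinuousLinearEquiv
    have h2 : b.map (A.toContinuousLinearEquiv : E ≃ₗ[ℝ] E) = b'.reindex σ.symm := by
      ext i
      simp [A]
    rw [h2, Module.Basis.addHaar_reindex] at h1
    exact h1
  have h3 := Measure.map_linearMap_addHaar_eq_smul_addHaar b.addHaar hdet
  refine ⟨ENNReal.ofReal |LinearMap.det (A : E →ₗ[ℝ] E)|, ENNReal.ofReal_ne_top, ?_, fun B hB => ?_⟩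
  · have h4 : b'.addHaar = ENNReal.ofReal |(LinearMap.det (A : E →ₗ[ℝ] E))⁻¹| • b.addHaar := by
      rw [← h3, ← hmap]
      rfl
    rw [h4, smul_smul, ← ENNReal.ofReal_mul (abs_nonneg _), ← abs_mul, mul_inv_cancel₀ hdet, abs_one,
      ENNReal.ofReal_one, one_smul]
  · rw [← ENNReal.ofReal_mul (abs_nonneg _), formDet_basis b b' σ, Real.sqrt_mul (sq_nonneg _),
      Real.sqrt_sq_eq_abs]

end FormDet

section Volume

variable {E : Type*} [NormedAddCommGroup E] [NormedSpace ℝ E] [FiniteDimensional ℝ E]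
  [MeasurableSpace E] [BorelSpace E]
  {H : Type*} [TopologicalSpace H] {I : ModelWithCorners ℝ E H} [I.Boundaryless]
  {M : Type*} [TopologicalSpace M] [ChartedSpace H M] [IsManifold I ∞ M]
  [MeasurableSpace M] [BorelSpace M] (g : SmoothMetric I M)

/-- The volume density in the preferred chart around `p`. -/
def SmoothMetric.chartDensity (p : M) (y : E) : ENNReal :=
  ENNReal.ofReal √(formDet (Module.finBasis ℝ E) (g.inChart p y))

theorem IsMetricOn.continuousOn_sqrt_formDet {G : E → E →L[ℝ] E →L[ℝ] ℝ} {U : Set E}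
    (h : IsMetricOn G U) {ι : Type*} [Fintype ι] [DecidableEq ι] (b : Module.Basis ι ℝ E) :
    ContinuousOn (fun y => √(formDet b (G y))) U := by
  have hc : ContinuousOn G U := fun y hy => (h.contDiffAt y hy).continuousAt.continuousWithinAt
  refine Real.continuous_sqrt.comp_continuousOn ?_
  have hm : ContinuousOn (fun y => Matrix.of fun i j => G y (b i) (b j)) U :=
    continuousOn_pi.2 fun i => continuousOn_pi.2 fun j =>
      (hc.clm_apply continuousOn_const).clm_apply continuousOn_const
  exact continuous_id.matrix_det.comp_continuousOn hm

theorem aemeasurable_extChartAt_symm (μ : Measure E) (p : M) :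
    AEMeasurable (extChartAt I p).symm (μ.restrict (extChartAt I p).target) :=
  (continuousOn_extChartAt_symm p).aemeasurable (isOpen_extChartAt_target p).measurableSet

theorem measurableSet_target_inter_preimage (p : M) {S : Set M} (hS : MeasurableSet S) :
    MeasurableSet ((extChartAt I p).target ∩ (extChartAt I p).symm ⁻¹' S) := by
  have hc := (continuousOn_extChartAt_symm (I := I) p).domRestrict
  have := (isOpen_extChartAt_target (I := I) p).measurableSet.subtype_image (hc.measurable hS)
  convert this using 1
  ext y
  simp only [Set.mem_inter_iff, Set.mem_preimage, Set.mem_image, Set.domRestrict_apply, Subtype.exists,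
    exists_and_left, exists_prop, exists_eq_right_right]
  exact and_comm

theorem SmoothMetric.chartVolume_apply (p : M) {S : Set M} (hS : MeasurableSet S) :
    g.chartVolume p S = ∫⁻ y in (extChartAt I p).target ∩ (extChartAt I p).symm ⁻¹' S,
      g.chartDensity p y ∂(Module.finBasis ℝ E).addHaar := by
  rw [SmoothMetric.chartVolume]
  have h := aemeasurable_extChartAt_symm (I := I) ((Module.finBasis ℝ E).addHaar.withDensity fun y =>
    ENNReal.ofReal √(Matrix.of fun i j => g.inChart p y (Module.finBasis ℝ E i) (Module.finBasis ℝ E j)).det) p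
  rw [Measure.map_apply_of_aemeasurable h hS, Measure.restrict_apply' (isOpen_extChartAt_target p).measurableSet,
    Set.inter_comm, withDensity_apply _ (measurableSet_target_inter_preimage p hS)]
  rfl

theorem SmoothMetric.chartVolume_compl_source (p : M) : g.chartVolume p (extChartAt I p).sourceᶜ = 0 := by
  rw [g.chartVolume_apply p (isOpen_extChartAt_source p).measurableSet.compl]
  have : (extChartAt I p).target ∩ (extChartAt I p).symm ⁻¹' (extChartAt I p).sourceᶜ = ∅ := by
    ext y
    simp only [Set.mem_inter_iff, Set.mem_preimage, Set.mem_compl_iff, Set.mem_empty_iff_false,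
      iff_false, not_and, not_not]
    exact fun hy => (extChartAt I p).map_target hy
  rw [this, Measure.restrict_empty, lintegral_zero_measure]

theorem SmoothMetric.chartVolume_eq_of_subset {p q : M} {S : Set M} (hS : MeasurableSet S)
    (hp : S ⊆ (extChartAt I p).source) (hq : S ⊆ (extChartAt I q).source) :
    g.chartVolume p S = g.chartVolume q S := by
  rw [g.chartVolume_apply p hS, g.chartVolume_apply q hS]
  set A := (extChartAt I p).target ∩ (extChartAt I p).symm ⁻¹' S with hA
  have hAT : A ⊆ transitionDomain I p q := fun y hy => ⟨hy.1, hq hy.2⟩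
  have himg : (extChartAt I q).target ∩ (extChartAt I q).symm ⁻¹' S = transition I p q '' A := by
    ext y
    constructor
    · rintro ⟨hy, hyS⟩
      refine ⟨extChartAt I p ((extChartAt I q).symm y), ⟨(extChartAt I p).map_source (hp hyS), ?_⟩, ?_⟩
      · rw [Set.mem_preimage, (extChartAt I p).left_inv (hp hyS)]
        exact hyS
      · rw [transition, (extChartAt I p).left_inv (hp hyS), (extChartAt I q).right_inv hy]
    · rintro ⟨x, hx, rfl⟩
      refine ⟨transition_mem (hAT hx), ?_⟩
      rw [Set.mem_preimage, symm_transition (hAT hx)]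
      exact hx.2
  have hinj : Set.InjOn (transition I p q) A := by
    intro x hx y hy hxy
    have := congrArg (extChartAt I q).symm hxy
    rw [symm_transition (hAT hx), symm_transition (hAT hy)] at this
    exact (extChartAt I p).symm.injOn hx.1 hy.1 this
  have hAm : MeasurableSet A := measurableSet_target_inter_preimage p hS
  rw [himg, lintegral_image_eq_lintegral_abs_det_fderiv_mul _ hAm
    (f' := fderiv ℝ (transition I p q)) (fun x hx =>
      ((contDiffAt_transition (hAT hx)).differentiableAt (by simp)).hasFDerivAt.hasFDerivWithinAt) hinj]
  refine setLIntegral_congr_fun hAm fun x hx => ?_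
  simp only [SmoothMetric.chartDensity]
  rw [formDet_comp (Module.finBasis ℝ E) (fderiv ℝ (transition I p q) x : E →ₗ[ℝ] E)
    (fun v w => g.inChart_transition (hAT hx) v w), Real.sqrt_mul (sq_nonneg _), Real.sqrt_sq_eq_abs,
    ENNReal.ofReal_mul (abs_nonneg _)]

theorem SmoothMetric.chartVolume_le_volumeMeasure (p : M) : g.chartVolume p ≤ g.volumeMeasure :=
  le_iSup g.chartVolume p

theorem SmoothMetric.volumeMeasure_apply_of_subset {q : M} {S : Set M} (hS : MeasurableSet S)
    (hq : S ⊆ (extChartAt I q).source) : g.volumeMeasure S = g.chartVolume q S := by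
  refine le_antisymm ?_ (g.chartVolume_le_volumeMeasure q S)
  let ν := (g.chartVolume q).restrict S + g.volumeMeasure.restrict Sᶜ
  have hν : g.volumeMeasure ≤ ν := by
    refine iSup_le fun p => ?_
    refine Measure.le_iff.2 fun A hA => ?_
    rw [← measure_inter_add_sdiff A hS, Measure.add_apply, Measure.restrict_apply hA,
      Measure.restrict_apply hA, Set.sdiff_eq]
    refine add_le_add ?_ (g.chartVolume_le_volumeMeasure p _)
    have hs := (isOpen_extChartAt_source (I := I) p).measurableSet
    calc g.chartVolume p (A ∩ S) ≤ g.chartVolume p (A ∩ S ∩ (extChartAt I p).source) +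
          g.chartVolume p (extChartAt I p).sourceᶜ := by
          rw [← measure_inter_add_sdiff (A ∩ S) hs]
          exact add_le_add le_rfl (measure_mono fun x hx => hx.2)
      _ = g.chartVolume q (A ∩ S ∩ (extChartAt I p).source) := by
          rw [g.chartVolume_compl_source, add_zero]
          exact g.chartVolume_eq_of_subset ((hA.inter hS).inter hs) (fun x hx => hx.2)
            (fun x hx => hq hx.1.2)
      _ ≤ _ := measure_mono Set.inter_subset_left
  refine (hν S).trans ?_
  simp [ν, Measure.restrict_apply hS]

theorem SmoothMetric.volumeMeasure_restrict_source (q : M) :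
    g.volumeMeasure.restrict (extChartAt I q).source = g.chartVolume q := by
  have hs := (isOpen_extChartAt_source (I := I) q).measurableSet
  ext A hA
  rw [Measure.restrict_apply hA, g.volumeMeasure_apply_of_subset (hA.inter hs) Set.inter_subset_right,
    ← measure_inter_add_sdiff A hs, measure_mono_null (fun x hx => hx.2 : A \ _ ⊆ _)
      (g.chartVolume_compl_source q), add_zero]

theorem exists_finite_cover_source [CompactSpace M] :
    ∃ t : Finset M, ⋃ p ∈ t, (extChartAt I p).source = Set.univ := by
  obtain ⟨t, ht⟩ := isCompact_univ.elim_finite_subcover (fun p : M => (extChartAt I p).source)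
    (fun p => isOpen_extChartAt_source p) (fun x _ => Set.mem_iUnion.2 ⟨x, mem_extChartAt_source x⟩)
  exact ⟨t, Set.univ_subset_iff.1 ht⟩

theorem ext_of_restrict_source [CompactSpace M] {μ ν : Measure M}
    (h : ∀ p : M, μ.restrict (extChartAt I p).source = ν.restrict (extChartAt I p).source) : μ = ν := by
  obtain ⟨t, ht⟩ := exists_finite_cover_source (I := I) (M := M)
  have := (Measure.restrict_biUnion_congr (μ := μ) (ν := ν) (s := (t : Set M))
    (t := fun p => (extChartAt I p).source) t.countable_toSet).2 fun p _ => h p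
  simpa only [Finset.mem_coe, ht, Measure.restrict_univ] using this

theorem SmoothMetric.isFiniteMeasure_volumeMeasure [CompactSpace M] :
    IsFiniteMeasure g.volumeMeasure := by
  have : IsLocallyFiniteMeasure g.volumeMeasure := by
    refine ⟨fun p => ?_⟩
    have hp := mem_extChartAt_source (I := I) p
    obtain ⟨r, hr, hball⟩ := Metric.nhds_basis_closedBall.mem_iff.1
      ((isOpen_extChartAt_target (I := I) p).mem_nhds (mem_extChartAt_target p))
    set K := Metric.closedBall (extChartAt I p p) r
    let N := (extChartAt I p).source ∩ extChartAt I p ⁻¹' Metric.ball (extChartAt I p p) r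
    have hN : IsOpen N := (continuousOn_extChartAt p).isOpen_inter_preimage
      (isOpen_extChartAt_source p) Metric.isOpen_ball
    refine ⟨N, hN.mem_nhds ⟨hp, Metric.mem_ball_self hr⟩, ?_⟩
    rw [g.volumeMeasure_apply_of_subset hN.measurableSet Set.inter_subset_left,
      g.chartVolume_apply p hN.measurableSet]
    have hsub : (extChartAt I p).target ∩ (extChartAt I p).symm ⁻¹' N ⊆ K := by
      rintro y ⟨hy, _, hy2⟩
      rw [Set.mem_preimage, (extChartAt I p).right_inv hy] at hy2
      exact Metric.ball_subset_closedBall hy2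
    refine (lintegral_mono_set hsub).trans_lt ?_
    have hc := ((g.isMetricOn_inChart p).continuousOn_sqrt_formDet (Module.finBasis ℝ E)).mono hball
    exact (hc.integrableOn_compact (isCompact_closedBall _ _)).lintegral_lt_top
  exact ⟨isCompact_univ.measure_lt_top⟩

theorem SmoothMetric.chartDensity_pos (p : M) {y : E} (hy : y ∈ (extChartAt I p).target) :
    0 < g.chartDensity p y := by
  have h := g.isMetricOn_inChart p
  exact ENNReal.ofReal_pos.2 (Real.sqrt_pos.2 (formDet_pos _ (h.symm y hy) (h.pos y hy)))

theorem SmoothMetric.aemeasurable_chartDensity (p : M) (μ : Measure E) :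
    AEMeasurable (g.chartDensity p) (μ.restrict (extChartAt I p).target) :=
  (((g.isMetricOn_inChart p).continuousOn_sqrt_formDet (Module.finBasis ℝ E)).aemeasurable
    (isOpen_extChartAt_target p).measurableSet).ennreal_ofReal

theorem SmoothMetric.volumeMeasure_univ_ne_zero [Nonempty M] : g.volumeMeasure Set.univ ≠ 0 := by
  obtain ⟨p⟩ := ‹Nonempty M›
  intro h
  have h1 : g.chartVolume p Set.univ = 0 :=
    le_antisymm ((g.chartVolume_le_volumeMeasure p _).trans h.le) zero_le
  rw [g.chartVolume_apply p MeasurableSet.univ, Set.preimage_univ, Set.inter_univ,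
    lintegral_eq_zero_iff' (g.aemeasurable_chartDensity p _)] at h1
  have h2 : ∀ᵐ y ∂(Module.finBasis ℝ E).addHaar.restrict (extChartAt I p).target, False := by
    filter_upwards [h1, ae_restrict_mem (isOpen_extChartAt_target p).measurableSet] with y hy hy'
    exact (g.chartDensity_pos p hy').ne' hy
  rw [Filter.eventually_false_iff_eq_bot, ae_eq_bot, Measure.restrict_eq_zero] at h2
  exact ((isOpen_extChartAt_target p).measure_pos _ ⟨_, mem_extChartAt_target p⟩).ne' h2

end Volume

end

section

set_option maxSynthPendingDepth 3

section ProductMetric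

variable {E : Type*} [NormedAddCommGroup E] [NormedSpace ℝ E]
  {H : Type*} [TopologicalSpace H] {I : ModelWithCorners ℝ E H} [I.Boundaryless]
  {M : Type*} [TopologicalSpace M] [ChartedSpace H M] [IsManifold I ∞ M]
  {E' : Type*} [NormedAddCommGroup E'] [NormedSpace ℝ E']
  {H' : Type*} [TopologicalSpace H'] {I' : ModelWithCorners ℝ E' H'} [I'.Boundaryless]
  {N : Type*} [TopologicalSpace N] [ChartedSpace H' N] [IsManifold I' ∞ N]
  (g : SmoothMetric I M) (h : SmoothMetric I' N)

theorem hasMFDerivAt_extChartAt_symm {p : M} {y : E} (hy : y ∈ (extChartAt I p).target) :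
    HasMFDerivAt 𝓘(ℝ, E) I (extChartAt I p).symm y (mfderiv 𝓘(ℝ, E) I (extChartAt I p).symm y) :=
  (((contMDiffOn_extChartAt_symm (I := I) (n := ∞) p).contMDiffAt
      ((isOpen_extChartAt_target p).mem_nhds hy)).mdifferentiableAt (by simp)).hasMFDerivAt

theorem mem_target_prod {z : M × N} {y : E × E'} :
    y ∈ (extChartAt (I.prod I') z).target ↔
      y.1 ∈ (extChartAt I z.1).target ∧ y.2 ∈ (extChartAt I' z.2).target := by
  rw [extChartAt_prod]
  rfl

theorem mfderiv_extChartAt_symm_prod {z : M × N} {y : E × E'}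
    (hy : y ∈ (extChartAt (I.prod I') z).target) :
    mfderiv 𝓘(ℝ, E × E') (I.prod I') (extChartAt (I.prod I') z).symm y =
      ((mfderiv 𝓘(ℝ, E) I (extChartAt I z.1).symm y.1).comp (ContinuousLinearMap.fst ℝ E E')).prod
        ((mfderiv 𝓘(ℝ, E') I' (extChartAt I' z.2).symm y.2).comp (ContinuousLinearMap.snd ℝ E E')) := by
  have hy' := mem_target_prod.1 hy
  have h1 := (hasMFDerivAt_extChartAt_symm hy'.1).comp y
    (hasFDerivAt_fst (𝕜 := ℝ) (p := y)).hasMFDerivAt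
  have h2 := (hasMFDerivAt_extChartAt_symm hy'.2).comp y
    (hasFDerivAt_snd (𝕜 := ℝ) (p := y)).hasMFDerivAt
  exact (h1.prodMk h2).mfderiv

theorem SmoothMetric.inChart_prod {z : M × N} {y : E × E'}
    (hy : y ∈ (extChartAt (I.prod I') z).target) (v w : E × E') :
    (g.prod h).inChart z y v w = g.inChart z.1 y.1 v.1 w.1 + h.inChart z.2 y.2 v.2 w.2 := by
  have e : (g.prod h).inChart z y v w = (g.prod h).inner ((extChartAt (I.prod I') z).symm y)
      (mfderiv 𝓘(ℝ, E × E') (I.prod I') (extChartAt (I.prod I') z).symm y v)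
      (mfderiv 𝓘(ℝ, E × E') (I.prod I') (extChartAt (I.prod I') z).symm y w) := rfl
  rw [e, SmoothMetric.prod_inner, mfderiv_extChartAt_symm_prod hy]
  rfl

variable [FiniteDimensional ℝ E] [FiniteDimensional ℝ E']

theorem SmoothMetric.curvatureTensor_prod (z : M × N) (u v w : TangentSpace (I.prod I') z) :
    (g.prod h).curvatureTensor z u v w =
      (g.curvatureTensor z.1 u.1 v.1 w.1, h.curvatureTensor z.2 u.2 v.2 w.2) := by
  have hz : extChartAt (I.prod I') z z = (extChartAt I z.1 z.1, extChartAt I' z.2 z.2) := by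
    rw [extChartAt_prod]; rfl
  have := (g.isMetricOn_inChart z.1).coordCurvature_prod (h.isMetricOn_inChart z.2)
    ((g.prod h).isMetricOn_inChart z) (fun y hy => mem_target_prod.1 hy)
    (fun y hy v w => g.inChart_prod h hy v w) (mem_extChartAt_target z) u v w
  rw [hz] at this
  rw [SmoothMetric.curvatureTensor, hz]
  exact this

/-- A tangent space of a product. -/
def tangentProdEquiv (I : ModelWithCorners ℝ E H) (I' : ModelWithCorners ℝ E' H') (z : M × N) :
    TangentSpace (I.prod I') z ≃L[ℝ] TangentSpace I z.1 × TangentSpace I' z.2 :=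
  ContinuousLinearEquiv.refl ℝ (E × E')

theorem SmoothMetric.curvatureLaw_prod {m n : ℕ} (hm : 2 ≤ m) (hn : 2 ≤ n)
    (hE : Module.finrank ℝ E = m) (hE' : Module.finrank ℝ E' = n) (τ : Measure (ℝ × ℝ)) [SFinite τ]
    (hτ : τ = (simplexMeasure m n).map fun z => (z.1 ^ 2, z.2 ^ 2)) (z : M × N) :
    (g.prod h).curvatureLaw z =
      ((g.curvatureLaw z.1).prod (h.curvatureLaw z.2)).bind (linearKernel τ) := by
  let _ : RiemannianBundle (fun p : M => TangentSpace I p) := ⟨g.toRiemannianMetric⟩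
  let _ : RiemannianBundle (fun p : N => TangentSpace I' p) := ⟨h.toRiemannianMetric⟩
  let _ : RiemannianBundle (fun p : M × N => TangentSpace (I.prod I') p) :=
    ⟨(g.prod h).toRiemannianMetric⟩
  have : FiniteDimensional ℝ (TangentSpace I z.1) := inferInstanceAs (FiniteDimensional ℝ E)
  have : FiniteDimensional ℝ (TangentSpace I' z.2) := inferInstanceAs (FiniteDimensional ℝ E')
  have : FiniteDimensional ℝ (TangentSpace (I.prod I') z) :=
    inferInstanceAs (FiniteDimensional ℝ (E × E'))
  let _ : MeasurableSpace (TangentSpace I z.1) := borel _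
  have : BorelSpace (TangentSpace I z.1) := ⟨rfl⟩
  let _ : MeasurableSpace (TangentSpace I' z.2) := borel _
  have : BorelSpace (TangentSpace I' z.2) := ⟨rfl⟩
  let _ : MeasurableSpace (TangentSpace (I.prod I') z) := borel _
  have : BorelSpace (TangentSpace (I.prod I') z) := ⟨rfl⟩
  refine map_sectionalCurvature_sum (V := TangentSpace I z.1) (W := TangentSpace I' z.2)
    (Z := TangentSpace (I.prod I') z) (e := tangentProdEquiv I I' z) (fun v w => ?_)
    (g.isCurvatureTensor z.1) (h.isCurvatureTensor z.2) ((g.prod h).isCurvatureTensor z)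
    (fun X Y => ?_) hm hn hE hE' τ hτ
  · exact SmoothMetric.prod_inner g h z v w
  · rw [g.curvatureTensor_prod h]
    exact SmoothMetric.prod_inner g h z _ _

theorem SmoothMetric.curvatureLaw_prod_line {m : ℕ} (hm : 2 ≤ m)
    (hE : Module.finrank ℝ E = m) (hE' : Module.finrank ℝ E' = 1) (τ : Measure (ℝ × ℝ)) [SFinite τ]
    (hτ : τ = (marginalMeasure m 1).map fun x => (x ^ 2, 0)) (z : M × N) :
    (g.prod h).curvatureLaw z =
      ((g.curvatureLaw z.1).prod (Measure.dirac 0)).bind (linearKernel τ) := by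
  let _ : RiemannianBundle (fun p : M => TangentSpace I p) := ⟨g.toRiemannianMetric⟩
  let _ : RiemannianBundle (fun p : N => TangentSpace I' p) := ⟨h.toRiemannianMetric⟩
  let _ : RiemannianBundle (fun p : M × N => TangentSpace (I.prod I') p) :=
    ⟨(g.prod h).toRiemannianMetric⟩
  have : FiniteDimensional ℝ (TangentSpace I z.1) := inferInstanceAs (FiniteDimensional ℝ E)
  have : FiniteDimensional ℝ (TangentSpace I' z.2) := inferInstanceAs (FiniteDimensional ℝ E')
  have : FiniteDimensional ℝ (TangentSpace (I.prod I') z) :=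
    inferInstanceAs (FiniteDimensional ℝ (E × E'))
  let _ : MeasurableSpace (TangentSpace I z.1) := borel _
  have : BorelSpace (TangentSpace I z.1) := ⟨rfl⟩
  let _ : MeasurableSpace (TangentSpace I' z.2) := borel _
  have : BorelSpace (TangentSpace I' z.2) := ⟨rfl⟩
  let _ : MeasurableSpace (TangentSpace (I.prod I') z) := borel _
  have : BorelSpace (TangentSpace (I.prod I') z) := ⟨rfl⟩
  refine map_sectionalCurvature_sum_line (V := TangentSpace I z.1) (W := TangentSpace I' z.2)
    (Z := TangentSpace (I.prod I') z) (e := tangentProdEquiv I I' z) (fun v w => ?_)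
    (g.isCurvatureTensor z.1) (h.isCurvatureTensor z.2) ((g.prod h).isCurvatureTensor z)
    (fun X Y => ?_) hm hE hE' τ hτ
  · exact SmoothMetric.prod_inner g h z v w
  · rw [g.curvatureTensor_prod h]
    exact SmoothMetric.prod_inner g h z _ _

end ProductMetric

section ProductVolume

variable {E : Type*} [NormedAddCommGroup E] [NormedSpace ℝ E] [FiniteDimensional ℝ E]
  [MeasurableSpace E] [BorelSpace E]
  {H : Type*} [TopologicalSpace H] {I : ModelWithCorners ℝ E H} [I.Boundaryless]
  {M : Type*} [TopologicalSpace M] [ChartedSpace H M] [IsManifold I ∞ M]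
  [MeasurableSpace M] [BorelSpace M]
  {E' : Type*} [NormedAddCommGroup E'] [NormedSpace ℝ E'] [FiniteDimensional ℝ E']
  [MeasurableSpace E'] [BorelSpace E']
  {H' : Type*} [TopologicalSpace H'] {I' : ModelWithCorners ℝ E' H'} [I'.Boundaryless]
  {N : Type*} [TopologicalSpace N] [ChartedSpace H' N] [IsManifold I' ∞ N]
  [MeasurableSpace N] [BorelSpace N]
  (g : SmoothMetric I M) (h : SmoothMetric I' N)

theorem formDet_prod {ι ι' : Type*} [Fintype ι] [DecidableEq ι] [Fintype ι'] [DecidableEq ι']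
    (b : Module.Basis ι ℝ E) (b' : Module.Basis ι' ℝ E') {B : E →L[ℝ] E →L[ℝ] ℝ}
    {B' : E' →L[ℝ] E' →L[ℝ] ℝ} {K : (E × E') →L[ℝ] (E × E') →L[ℝ] ℝ}
    (hK : ∀ v w, K v w = B v.1 w.1 + B' v.2 w.2) :
    formDet (b.prod b') K = formDet b B * formDet b' B' := by
  have : Matrix.of (fun i j => K (b.prod b' i) (b.prod b' j)) =
      Matrix.fromBlocks (Matrix.of fun i j => B (b i) (b j)) 0 0 (Matrix.of fun i j => B' (b' i) (b' j)) := by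
    ext i j
    rcases i with i | i <;> rcases j with j | j <;> simp [hK]
  rw [formDet, this, Matrix.det_fromBlocks_zero₂₁]
  rfl

variable [SecondCountableTopology M] [SecondCountableTopology N]

theorem SmoothMetric.chartVolume_prod (z : M × N) {s : Set M} {t : Set N} (hs : MeasurableSet s)
    (ht : MeasurableSet t) :
    (g.prod h).chartVolume z (s ×ˢ t) = g.chartVolume z.1 s * h.chartVolume z.2 t := by
  rw [SmoothMetric.chartVolume_apply _ _ (hs.prod ht), g.chartVolume_apply _ hs, h.chartVolume_apply _ ht]
  set b := Module.finBasis ℝ E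
  set b' := Module.finBasis ℝ E'
  have hset : (extChartAt (I.prod I') z).target ∩ (extChartAt (I.prod I') z).symm ⁻¹' (s ×ˢ t) =
      ((extChartAt I z.1).target ∩ (extChartAt I z.1).symm ⁻¹' s) ×ˢ
        ((extChartAt I' z.2).target ∩ (extChartAt I' z.2).symm ⁻¹' t) := by
    rw [extChartAt_prod]
    ext y
    simp only [PartialEquiv.prod_target, PartialEquiv.prod_symm, PartialEquiv.prod_coe,
      Set.mem_inter_iff, Set.mem_prod, Set.mem_preimage]
    tauto
  obtain ⟨c, hc, hc1, hc2⟩ := ofReal_sqrt_formDet_smul_addHaar (b.prod b') (Module.finBasis ℝ (E × E'))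
  have hAm := measurableSet_target_inter_preimage (I := I.prod I') z (hs.prod ht)
  have hdens : ∀ y ∈ (extChartAt (I.prod I') z).target ∩ (extChartAt (I.prod I') z).symm ⁻¹' (s ×ˢ t),
      (g.prod h).chartDensity z y = c * (g.chartDensity z.1 y.1 * h.chartDensity z.2 y.2) := by
    intro y hy
    have hg := g.isMetricOn_inChart z.1
    have hh := h.isMetricOn_inChart z.2
    have hy1 := (mem_target_prod.1 hy.1).1
    have hy2 := (mem_target_prod.1 hy.1).2
    have p1 := formDet_pos b (hg.symm _ hy1) (hg.pos _ hy1)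
    have p2 := formDet_pos b' (hh.symm _ hy2) (hh.pos _ hy2)
    have hf := formDet_prod b b' (fun v w => g.inChart_prod h hy.1 v w)
    rw [SmoothMetric.chartDensity, hc2 _ (by rw [hf]; positivity), hf, Real.sqrt_mul p1.le,
      ENNReal.ofReal_mul (Real.sqrt_nonneg _)]
    rfl
  rw [setLIntegral_congr_fun hAm hdens, lintegral_const_mul' _ _ hc, ← smul_eq_mul, ← lintegral_smul_measure,
    ← Measure.restrict_smul, ← hc1, Module.Basis.prod_addHaar, hset, ← Measure.prod_restrict]
  exact lintegral_prod_mul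
    ((g.aemeasurable_chartDensity z.1 _).mono_measure (Measure.restrict_mono Set.inter_subset_left le_rfl))
    ((h.aemeasurable_chartDensity z.2 _).mono_measure (Measure.restrict_mono Set.inter_subset_left le_rfl))

variable [CompactSpace M] [CompactSpace N]

theorem SmoothMetric.isFiniteMeasure_chartVolume (p : M) : IsFiniteMeasure (g.chartVolume p) := by
  have := g.isFiniteMeasure_volumeMeasure
  exact isFiniteMeasure_of_le _ (g.chartVolume_le_volumeMeasure p)

theorem SmoothMetric.volumeMeasure_prod :
    (g.prod h).volumeMeasure = g.volumeMeasure.prod h.volumeMeasure := by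
  have := g.isFiniteMeasure_volumeMeasure
  have := h.isFiniteMeasure_volumeMeasure
  refine ext_of_restrict_source (I := I.prod I') fun z => ?_
  have := g.isFiniteMeasure_chartVolume z.1
  have := h.isFiniteMeasure_chartVolume z.2
  have hsrc : (extChartAt (I.prod I') z).source =
      (extChartAt I z.1).source ×ˢ (extChartAt I' z.2).source := by
    rw [extChartAt_prod]; rfl
  rw [SmoothMetric.volumeMeasure_restrict_source, hsrc, ← Measure.prod_restrict,
    g.volumeMeasure_restrict_source, h.volumeMeasure_restrict_source]
  exact (Measure.prod_eq fun s t hs ht => g.chartVolume_prod h z hs ht).symm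

end ProductVolume

end

section

set_option maxSynthPendingDepth 3

section Distribution

variable {E : Type*} [NormedAddCommGroup E] [NormedSpace ℝ E] [FiniteDimensional ℝ E]
  [MeasurableSpace E] [BorelSpace E]
  {H : Type*} [TopologicalSpace H] {I : ModelWithCorners ℝ E H} [I.Boundaryless]
  {M : Type*} [TopologicalSpace M] [ChartedSpace H M] [IsManifold I ∞ M]
  [MeasurableSpace M] [BorelSpace M] [SecondCountableTopology M] [CompactSpace M]
  (g : SmoothMetric I M)

theorem planeVolume_ne_zero {d : ℕ} (hd : 2 ≤ d) : planeVolume d ≠ 0 := by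
  exact fubiniStudyVolume_univ_ne_zero (by simpa using hd)

theorem planeVolume_ne_top (d : ℕ) : planeVolume d ≠ ⊤ := measure_ne_top _ _

theorem SmoothMetric.curvatureVolume_eq (hE : 2 ≤ Module.finrank ℝ E) :
    g.curvatureVolume = planeVolume (Module.finrank ℝ E) • g.volumeMeasure.bind g.curvatureLaw := by
  have hm := g.measurable_curvatureLaw hE
  have h : g.curvatureVolume = g.volumeMeasure.bind fun p =>
      planeVolume (Module.finrank ℝ E) • g.curvatureLaw p := by
    rw [SmoothMetric.curvatureVolume]
    congr 1
    ext1 p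
    exact g.map_fubiniStudyVolume_sectionalCurvature hE p
  have hm' : Measurable fun p => planeVolume (Module.finrank ℝ E) • g.curvatureLaw p :=
    Measure.measurable_of_measurable_coe _ fun s hs =>
      ((Measure.measurable_coe hs).comp hm).const_mul _
  ext s hs
  rw [h, Measure.bind_apply hs hm'.aemeasurable, Measure.smul_apply,
    Measure.bind_apply hs hm.aemeasurable, smul_eq_mul,
    ← lintegral_const_mul' _ _ (planeVolume_ne_top _)]
  rfl

theorem SmoothMetric.curvatureDistribution_eq (hE : 2 ≤ Module.finrank ℝ E) :
    g.curvatureDistribution =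
      (g.volumeMeasure Set.univ)⁻¹ • g.volumeMeasure.bind g.curvatureLaw := by
  have hm := g.measurable_curvatureLaw hE
  have := g.isProbabilityMeasure_curvatureLaw hE
  have h : (g.volumeMeasure.bind g.curvatureLaw) Set.univ = g.volumeMeasure Set.univ := by
    rw [Measure.bind_apply MeasurableSet.univ hm.aemeasurable]
    simp
  rw [SmoothMetric.curvatureDistribution, g.curvatureVolume_eq hE, Measure.smul_apply, h, smul_eq_mul,
    ENNReal.mul_inv (Or.inl (planeVolume_ne_zero hE)) (Or.inl (planeVolume_ne_top _)), mul_comm,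
    ← smul_smul, smul_smul _ (planeVolume _), ENNReal.inv_mul_cancel (planeVolume_ne_zero hE)
      (planeVolume_ne_top _), one_smul]

theorem SmoothMetric.lintegral_curvatureDistribution (hE : 2 ≤ Module.finrank ℝ E) {f : ℝ → ENNReal}
    (hf : Measurable f) : ∫⁻ s, f s ∂g.curvatureDistribution =
      (g.volumeMeasure Set.univ)⁻¹ * ∫⁻ p, ∫⁻ s, f s ∂g.curvatureLaw p ∂g.volumeMeasure := by
  rw [g.curvatureDistribution_eq hE, lintegral_smul_measure, smul_eq_mul,
    Measure.lintegral_bind (g.measurable_curvatureLaw hE).aemeasurable hf.aemeasurable]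

theorem SmoothMetric.isProbabilityMeasure_curvatureDistribution [Nonempty M]
    (hE : 2 ≤ Module.finrank ℝ E) : IsProbabilityMeasure g.curvatureDistribution := by
  have := g.isFiniteMeasure_volumeMeasure
  have := g.isProbabilityMeasure_curvatureLaw hE
  refine ⟨?_⟩
  have h := g.lintegral_curvatureDistribution hE (f := fun _ => 1) measurable_const
  simp only [lintegral_const, one_mul, measure_univ] at h
  rw [h]
  exact ENNReal.inv_mul_cancel g.volumeMeasure_univ_ne_zero (measure_ne_top _ _)

/-- The distribution of the sectional curvature at the points of a manifold, as a kernel. -/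
def SmoothMetric.curvatureKernel (hE : 2 ≤ Module.finrank ℝ E) : Kernel M ℝ :=
  ⟨g.curvatureLaw, g.measurable_curvatureLaw hE⟩

variable {E' : Type*} [NormedAddCommGroup E'] [NormedSpace ℝ E'] [FiniteDimensional ℝ E']
  [MeasurableSpace E'] [BorelSpace E']
  {H' : Type*} [TopologicalSpace H'] {I' : ModelWithCorners ℝ E' H'} [I'.Boundaryless]
  {N : Type*} [TopologicalSpace N] [ChartedSpace H' N] [IsManifold I' ∞ N]
  [MeasurableSpace N] [BorelSpace N] [SecondCountableTopology N] [CompactSpace N]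
  [Nonempty M] [Nonempty N] (h : SmoothMetric I' N)

theorem SmoothMetric.volumeMeasure_prod_univ_inv :
    ((g.prod h).volumeMeasure Set.univ)⁻¹ =
      (g.volumeMeasure Set.univ)⁻¹ * (h.volumeMeasure Set.univ)⁻¹ := by
  have := g.isFiniteMeasure_volumeMeasure
  have := h.isFiniteMeasure_volumeMeasure
  rw [g.volumeMeasure_prod h, ← Set.univ_prod_univ, Measure.prod_prod,
    ENNReal.mul_inv (Or.inl g.volumeMeasure_univ_ne_zero) (Or.inl (measure_ne_top _ _))]

theorem Measurable.lintegral_kernel_fst {X Y Z : Type*} [MeasurableSpace X] [MeasurableSpace Y]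
    [MeasurableSpace Z] {f : Z × Y → ENNReal} (hf : Measurable f) (κ : Kernel X Z) [IsSFiniteKernel κ] :
    Measurable fun z : X × Y => ∫⁻ x, f (x, z.2) ∂κ z.1 := by
  have hm : Measurable fun x : (X × Y) × Z => f (x.2, x.1.2) :=
    hf.comp (measurable_snd.prodMk (measurable_snd.comp measurable_fst))
  exact Measurable.lintegral_kernel_prod_right' (κ := κ.comap Prod.fst (measurable_fst (β := Y))) hm

theorem Measurable.lintegral_swap_pair {X Y : Type*} [MeasurableSpace X] [MeasurableSpace Y]
    {f : X × Y → ENNReal} (hf : Measurable f) (μ : Measure X) (ν : Measure Y) [SFinite μ] [SFinite ν] :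
    ∫⁻ y, ∫⁻ x, f (x, y) ∂μ ∂ν = ∫⁻ x, ∫⁻ y, f (x, y) ∂ν ∂μ :=
  (lintegral_lintegral_swap (f := fun x y => f (x, y)) hf.aemeasurable).symm

theorem SmoothMetric.curvatureDistribution_prod {m n : ℕ} (hm : 2 ≤ m) (hn : 2 ≤ n)
    (hE : Module.finrank ℝ E = m) (hE' : Module.finrank ℝ E' = n) (τ : Measure (ℝ × ℝ)) [SFinite τ]
    (hτ : τ = (simplexMeasure m n).map fun z => (z.1 ^ 2, z.2 ^ 2)) :
    (g.prod h).curvatureDistribution =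
      (g.curvatureDistribution.prod h.curvatureDistribution).bind (linearKernel τ) := by
  have h2 : 2 ≤ Module.finrank ℝ E := by omega
  have h2' : 2 ≤ Module.finrank ℝ E' := by omega
  have h3 : 2 ≤ Module.finrank ℝ (E × E') := by rw [Module.finrank_prod]; omega
  have := g.isFiniteMeasure_volumeMeasure
  have := h.isFiniteMeasure_volumeMeasure
  have hp1 := g.isProbabilityMeasure_curvatureLaw h2
  have hp2 := h.isProbabilityMeasure_curvatureLaw h2'
  have := g.isProbabilityMeasure_curvatureDistribution h2
  have := h.isProbabilityMeasure_curvatureDistribution h2'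
  have hm1 := g.measurable_curvatureLaw h2
  have hm2 := h.measurable_curvatureLaw h2'
  have : IsMarkovKernel (h.curvatureKernel h2') := ⟨hp2⟩
  have : IsMarkovKernel (g.curvatureKernel h2) := ⟨hp1⟩
  refine Measure.ext_of_lintegral _ fun f hf => ?_
  have hF : Measurable fun z : ℝ × ℝ => ∫⁻ s, f s ∂linearKernel τ z := hf.lintegral_kernel
  have hF1 : Measurable fun x => ∫⁻ y, ∫⁻ s, f s ∂linearKernel τ (x, y) ∂h.curvatureDistribution :=
    hF.lintegral_prod_right'
  have hF2 : Measurable fun x : ℝ × N =>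
      ∫⁻ y, ∫⁻ s, f s ∂linearKernel τ (x.1, y) ∂h.curvatureLaw x.2 := by
    have := Measurable.lintegral_kernel_prod_right' (κ := (h.curvatureKernel h2').comap Prod.snd
      (measurable_snd (α := ℝ)))
      (f := fun x : (ℝ × N) × ℝ => ∫⁻ s, f s ∂linearKernel τ (x.1.1, x.2))
      (hF.comp ((measurable_fst.comp measurable_fst).prodMk measurable_snd))
    exact this
  have e1 : ∀ z : M × N, ∫⁻ s, f s ∂(g.prod h).curvatureLaw z =
      ∫⁻ x, ∫⁻ y, ∫⁻ s, f s ∂linearKernel τ (x, y) ∂h.curvatureLaw z.2 ∂g.curvatureLaw z.1 := by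
    intro z
    rw [g.curvatureLaw_prod h hm hn hE hE' τ hτ,
      Measure.lintegral_bind (linearKernel τ).measurable.aemeasurable hf.aemeasurable,
      lintegral_prod _ hF.aemeasurable]
  have hF3 : Measurable fun z : M × N =>
      ∫⁻ x, ∫⁻ y, ∫⁻ s, f s ∂linearKernel τ (x, y) ∂h.curvatureLaw z.2 ∂g.curvatureLaw z.1 := by
    exact hF2.lintegral_kernel_fst (g.curvatureKernel h2)
  have l1 : ∫⁻ s, f s ∂(g.prod h).curvatureDistribution =
      (g.volumeMeasure Set.univ)⁻¹ * (h.volumeMeasure Set.univ)⁻¹ *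
        ∫⁻ p, ∫⁻ q, ∫⁻ x, ∫⁻ y, ∫⁻ s, f s ∂linearKernel τ (x, y) ∂h.curvatureLaw q ∂g.curvatureLaw p
          ∂h.volumeMeasure ∂g.volumeMeasure := by
    refine ((g.prod h).lintegral_curvatureDistribution h3 hf).trans ?_
    rw [g.volumeMeasure_prod_univ_inv h, lintegral_congr e1, g.volumeMeasure_prod h,
      lintegral_prod _ hF3.aemeasurable]
  have l2 : ∫⁻ s, f s ∂(g.curvatureDistribution.prod h.curvatureDistribution).bind (linearKernel τ) =
      (g.volumeMeasure Set.univ)⁻¹ * ∫⁻ p, ∫⁻ x, ∫⁻ y, ∫⁻ s, f s ∂linearKernel τ (x, y)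
        ∂h.curvatureDistribution ∂g.curvatureLaw p ∂g.volumeMeasure := by
    rw [Measure.lintegral_bind (linearKernel τ).measurable.aemeasurable hf.aemeasurable,
      lintegral_prod _ hF.aemeasurable]
    exact g.lintegral_curvatureDistribution h2 hF1
  rw [l1, l2, mul_assoc]
  congr 1
  have hfin : (h.volumeMeasure Set.univ)⁻¹ ≠ ⊤ := ENNReal.inv_ne_top.2 h.volumeMeasure_univ_ne_zero
  rw [← lintegral_const_mul' _ _ hfin]
  refine lintegral_congr fun p => ?_
  have e2 : ∀ x, ∫⁻ y, ∫⁻ s, f s ∂linearKernel τ (x, y) ∂h.curvatureDistribution =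
      (h.volumeMeasure Set.univ)⁻¹ *
        ∫⁻ q, ∫⁻ y, ∫⁻ s, f s ∂linearKernel τ (x, y) ∂h.curvatureLaw q ∂h.volumeMeasure :=
    fun x => h.lintegral_curvatureDistribution h2' (hF.comp measurable_prodMk_left)
  simp only [e2]
  rw [lintegral_const_mul' _ _ hfin]
  congr 1
  exact hF2.lintegral_swap_pair _ _

theorem SmoothMetric.curvatureDistribution_prod_line {m : ℕ} (hm : 2 ≤ m)
    (hE : Module.finrank ℝ E = m) (hE' : Module.finrank ℝ E' = 1) (τ : Measure (ℝ × ℝ)) [SFinite τ]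
    (hτ : τ = (marginalMeasure m 1).map fun x => (x ^ 2, 0)) :
    (g.prod h).curvatureDistribution =
      g.curvatureDistribution.bind ((linearKernel τ).comap (fun x : ℝ => (x, (0 : ℝ))) (by fun_prop)) := by
  have h2 : 2 ≤ Module.finrank ℝ E := by omega
  have h3 : 2 ≤ Module.finrank ℝ (E × E') := by rw [Module.finrank_prod]; omega
  have := g.isFiniteMeasure_volumeMeasure
  have := h.isFiniteMeasure_volumeMeasure
  have hp1 := g.isProbabilityMeasure_curvatureLaw h2
  have : IsMarkovKernel (g.curvatureKernel h2) := ⟨hp1⟩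
  refine Measure.ext_of_lintegral _ fun f hf => ?_
  set σ : Kernel ℝ ℝ := (linearKernel τ).comap (fun x : ℝ => (x, (0 : ℝ))) (by fun_prop) with hσ
  have hF : Measurable fun z : ℝ × ℝ => ∫⁻ s, f s ∂linearKernel τ z := hf.lintegral_kernel
  have hF0 : Measurable fun x : ℝ => ∫⁻ s, f s ∂σ x := hf.lintegral_kernel
  have e1 : ∀ z : M × N, ∫⁻ s, f s ∂(g.prod h).curvatureLaw z =
      ∫⁻ x, ∫⁻ s, f s ∂σ x ∂g.curvatureLaw z.1 := by
    intro z
    rw [g.curvatureLaw_prod_line h hm hE hE' τ hτ,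
      Measure.lintegral_bind (linearKernel τ).measurable.aemeasurable hf.aemeasurable,
      lintegral_prod _ hF.aemeasurable]
    refine lintegral_congr fun x => ?_
    rw [lintegral_dirac, hσ, Kernel.comap_apply]
  have hF1 : Measurable fun p => ∫⁻ x, ∫⁻ s, f s ∂σ x ∂g.curvatureLaw p :=
    Measurable.lintegral_kernel (κ := g.curvatureKernel h2) hF0
  have hF3 : Measurable fun z : M × N => ∫⁻ x, ∫⁻ s, f s ∂σ x ∂g.curvatureLaw z.1 :=
    hF1.comp measurable_fst
  have l1 : ∫⁻ s, f s ∂(g.prod h).curvatureDistribution =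
      (g.volumeMeasure Set.univ)⁻¹ * (h.volumeMeasure Set.univ)⁻¹ *
        ∫⁻ p, ∫⁻ _, ∫⁻ x, ∫⁻ s, f s ∂σ x ∂g.curvatureLaw p ∂h.volumeMeasure ∂g.volumeMeasure := by
    refine ((g.prod h).lintegral_curvatureDistribution h3 hf).trans ?_
    rw [g.volumeMeasure_prod_univ_inv h, lintegral_congr e1, g.volumeMeasure_prod h,
      lintegral_prod _ hF3.aemeasurable]
  rw [l1, Measure.lintegral_bind σ.measurable.aemeasurable hf.aemeasurable,
    g.lintegral_curvatureDistribution h2 hF0]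
  simp only [lintegral_const]
  rw [lintegral_mul_const _ hF1, mul_comm _ (h.volumeMeasure Set.univ), mul_assoc,
    ← mul_assoc (h.volumeMeasure Set.univ)⁻¹, ENNReal.inv_mul_cancel h.volumeMeasure_univ_ne_zero
      (measure_ne_top _ _), one_mul]

end Distribution

end

section

set_option maxSynthPendingDepth 3

section ProductKernel

theorem map_sq_linear {τ : Measure (ℝ × ℝ)} [SFinite τ] {σ : Measure (ℝ × ℝ)}
    (hτ : τ = σ.map fun z => (z.1 ^ 2, z.2 ^ 2)) (μ ν : ℝ) :
    linearKernel τ (μ, ν) = σ.map fun z => z.1 ^ 2 * μ + z.2 ^ 2 * ν := by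
  rw [linearKernel_apply, hτ, Measure.map_map (by fun_prop) (by fun_prop)]
  rfl

/-- The kernel of the laws of `x ^ 2 μ + y ^ 2 ν`, where `(x, y)` is distributed on the simplex. -/
def simplexKernel (m n : ℕ) : Kernel (ℝ × ℝ) ℝ :=
  haveI : SFinite (simplexMeasure m n) := by unfold simplexMeasure; infer_instance
  linearKernel ((simplexMeasure m n).map fun z => (z.1 ^ 2, z.2 ^ 2))

theorem simplexKernel_apply (m n : ℕ) (μ ν : ℝ) :
    simplexKernel m n (μ, ν) = (simplexMeasure m n).map fun z => z.1 ^ 2 * μ + z.2 ^ 2 * ν := by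
  have : SFinite (simplexMeasure m n) := by unfold simplexMeasure; infer_instance
  exact map_sq_linear rfl μ ν

theorem isMarkovKernel_simplexKernel {m n : ℕ} (hm : 2 ≤ m) (hn : 2 ≤ n) :
    IsMarkovKernel (simplexKernel m n) := by
  have := isProbabilityMeasure_simplexMeasure hm hn
  refine ⟨fun z => ?_⟩
  rw [show z = (z.1, z.2) from rfl, simplexKernel_apply]
  exact Measure.isProbabilityMeasure_map (by fun_prop)

theorem ae_mem_planeSimplex (m n : ℕ) : ∀ᵐ z ∂simplexMeasure m n, z ∈ planeSimplex :=
  (withDensity_absolutelyContinuous _ _).ae_le (ae_restrict_mem measurableSet_planeSimplex)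

theorem support_simplexKernel_subset (m n : ℕ) (μ ν : ℝ) :
    (simplexKernel m n (μ, ν)).support ⊆ convexHull ℝ {μ, ν, 0} := by
  have hc : IsClosed (convexHull ℝ ({μ, ν, 0} : Set ℝ)) :=
    ((Set.toFinite _).isCompact_convexHull (𝕜 := ℝ)).isClosed
  refine Measure.support_subset_of_isClosed hc ?_
  rw [simplexKernel_apply]
  refine (ae_map_iff (by fun_prop) hc.measurableSet).2 ?_
  filter_upwards [ae_mem_planeSimplex m n] with z hz
  obtain ⟨h1, h2, h3⟩ := hz
  have hx : z.1 ^ 2 ≤ z.1 := by nlinarith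
  have hy : z.2 ^ 2 ≤ z.2 := by nlinarith
  have hconv := convex_convexHull ℝ ({μ, ν, 0} : Set ℝ)
  have := hconv.sum_mem (t := Finset.univ) (w := ![z.1 ^ 2, z.2 ^ 2, 1 - z.1 ^ 2 - z.2 ^ 2])
    (z := ![μ, ν, 0]) ?_ ?_ ?_
  · simp only [Fin.sum_univ_three, Matrix.cons_val_zero, Matrix.cons_val_one, Matrix.cons_val,
      smul_eq_mul, mul_zero, add_zero] at this
    exact this
  · intro i _
    fin_cases i <;> simp <;> nlinarith
  · simp [Fin.sum_univ_three]
  · intro i _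
    apply subset_convexHull
    fin_cases i <;> simp

theorem simplexKernel_axis {m n : ℕ} (hm : 2 ≤ m) (hn : 2 ≤ n) {μ : ℝ} (hμ : μ ≠ 0) :
    simplexKernel m n (μ, 0) = axisMeasure m n μ := by
  rw [simplexKernel_apply, ← map_marginalMeasure hm hμ, ← map_fst_simplexMeasure hn,
    Measure.map_map (by fun_prop) (by fun_prop)]
  congr 1
  ext z
  simp

/-- The kernel of the laws of `x ^ 2 μ`, where `x` has the law of the first coordinate. -/
def marginalKernel (m n : ℕ) : Kernel ℝ ℝ :=
  haveI : SFinite (marginalMeasure m n) := by unfold marginalMeasure; infer_instance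
  (linearKernel ((marginalMeasure m n).map fun x => (x ^ 2, (0 : ℝ)))).comap
    (fun x : ℝ => (x, (0 : ℝ))) (by fun_prop)

theorem marginalKernel_apply (m n : ℕ) (μ : ℝ) :
    marginalKernel m n μ = (marginalMeasure m n).map fun x => x ^ 2 * μ := by
  have : SFinite (marginalMeasure m n) := by unfold marginalMeasure; infer_instance
  rw [marginalKernel, Kernel.comap_apply, linearKernel_apply,
    Measure.map_map (by fun_prop) (by fun_prop)]
  congr 1
  ext z
  simp

theorem isMarkovKernel_marginalKernel {m n : ℕ} (hm : 2 ≤ m) (hn : 1 ≤ n) :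
    IsMarkovKernel (marginalKernel m n) := by
  have := isProbabilityMeasure_marginalMeasure hm hn
  refine ⟨fun z => ?_⟩
  rw [marginalKernel_apply]
  exact Measure.isProbabilityMeasure_map (by fun_prop)

theorem computesProductCurvature_simplexKernel {m n : ℕ} (hm : 2 ≤ m) (hn : 2 ≤ n) :
    ComputesProductCurvature.{u, v} m n (simplexKernel m n) := by
  intro M _ _ _ _ _ _ _ _ g N _ _ _ _ _ _ _ _ h
  have : SecondCountableTopology M :=
    ChartedSpace.secondCountable_of_sigmaCompact (EuclideanSpace ℝ (Fin m)) M
  have : SecondCountableTopology N :=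
    ChartedSpace.secondCountable_of_sigmaCompact (EuclideanSpace ℝ (Fin n)) N
  have : SFinite (simplexMeasure m n) := by unfold simplexMeasure; infer_instance
  exact g.curvatureDistribution_prod h hm hn (by simp) (by simp) _ rfl

theorem curvatureDistribution_prod_line {m : ℕ} (hm : 2 ≤ m)
    {M : Type*} [TopologicalSpace M] [ChartedSpace (EuclideanSpace ℝ (Fin m)) M]
    [IsManifold (𝓡 m) ∞ M] [T2Space M] [CompactSpace M] [Nonempty M]
    [MeasurableSpace M] [BorelSpace M] (g : SmoothMetric (𝓡 m) M)
    {N : Type*} [TopologicalSpace N] [ChartedSpace (EuclideanSpace ℝ (Fin 1)) N]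
    [IsManifold (𝓡 1) ∞ N] [T2Space N] [CompactSpace N] [Nonempty N]
    [MeasurableSpace N] [BorelSpace N] (h : SmoothMetric (𝓡 1) N) :
    (g.prod h).curvatureDistribution = g.curvatureDistribution.bind (marginalKernel m 1) := by
  have : SecondCountableTopology M :=
    ChartedSpace.secondCountable_of_sigmaCompact (EuclideanSpace ℝ (Fin m)) M
  have : SecondCountableTopology N :=
    ChartedSpace.secondCountable_of_sigmaCompact (EuclideanSpace ℝ (Fin 1)) N
  have : SFinite (marginalMeasure m 1) := by unfold marginalMeasure; infer_instance
  exact g.curvatureDistribution_prod_line h hm (by simp) (by simp) _ rfl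

end ProductKernel

end

section

set_option maxSynthPendingDepth 3

section SpaceForm

variable {E : Type*} [NormedAddCommGroup E] [InnerProductSpace ℝ E] [FiniteDimensional ℝ E]
  {G : E → E →L[ℝ] E →L[ℝ] ℝ} {U : Set E} {c : ℝ}

theorem hasFDerivAt_one_add_mul_norm_sq (c : ℝ) (y : E) :
    HasFDerivAt (fun y : E => 1 + c * ‖y‖ ^ 2) ((2 * c) • innerSL ℝ y) y := by
  have h := (((hasStrictFDerivAt_norm_sq y).hasFDerivAt).const_mul c).const_add 1
  refine h.congr_fderiv ?_
  ext v
  simp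
  ring

theorem IsMetricOn.fderiv_of_conformal (h : IsMetricOn G U)
    (hG : ∀ y ∈ U, ∀ v w, G y v w = ((1 + c * ‖y‖ ^ 2) ^ 2)⁻¹ * inner ℝ v w)
    (hq : ∀ y ∈ U, 1 + c * ‖y‖ ^ 2 ≠ 0) {y : E} (hy : y ∈ U) (u v w : E) :
    fderiv ℝ G y u v w = -(4 * c) * inner ℝ y u / (1 + c * ‖y‖ ^ 2) ^ 3 * inner ℝ v w := by
  have hd := (h.contDiffAt y hy).differentiableAt (by simp)
  have h1 := HasFDerivAt.apply_apply hd.hasFDerivAt (hasFDerivAt_const v y) (hasFDerivAt_const w y) u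
  simp only [zero_apply, map_zero, add_zero] at h1
  rw [← h1]
  have he : (fun y' => G y' v w) =ᶠ[nhds y] fun y' => ((1 + c * ‖y'‖ ^ 2) ^ 2)⁻¹ * inner ℝ v w := by
    filter_upwards [h.isOpen.mem_nhds hy] with y' hy' using hG y' hy' v w
  have hq' := hq y hy
  have h2 := ((((hasDerivAt_pow 2 (1 + c * ‖y‖ ^ 2)).inv (by positivity)).comp_hasFDerivAt y
    (hasFDerivAt_one_add_mul_norm_sq c y)).mul_const (inner ℝ v w)).congr_of_eventuallyEq he
  rw [h2.fderiv]
  simp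
  field_simp
  ring

theorem IsMetricOn.christoffel_of_conformal (h : IsMetricOn G U)
    (hG : ∀ y ∈ U, ∀ v w, G y v w = ((1 + c * ‖y‖ ^ 2) ^ 2)⁻¹ * inner ℝ v w)
    (hq : ∀ y ∈ U, 1 + c * ‖y‖ ^ 2 ≠ 0) {y : E} (hy : y ∈ U) (v w : E) :
    christoffel G y v w = (-(2 * c) * (1 + c * ‖y‖ ^ 2)⁻¹) •
      ((inner ℝ v y : ℝ) • w + (inner ℝ w y : ℝ) • v - (inner ℝ v w : ℝ) • y) := by
  refine (h.eq_christoffel hy fun z => ?_).symm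
  have hq' := hq y hy
  rw [hG y hy]
  simp only [h.fderiv_of_conformal hG hq hy, inner_smul_left, inner_sub_left, inner_add_left,
    real_inner_comm y]
  simp only [RCLike.conj_to_real]
  rw [real_inner_comm z v, real_inner_comm z w, real_inner_comm w v]
  field_simp
  ring

theorem IsMetricOn.coordCurvature_of_conformal (h : IsMetricOn G U)
    (hG : ∀ y ∈ U, ∀ v w, G y v w = ((1 + c * ‖y‖ ^ 2) ^ 2)⁻¹ * inner ℝ v w)
    (hq : ∀ y ∈ U, 1 + c * ‖y‖ ^ 2 ≠ 0) {y : E} (hy : y ∈ U) (u v w : E) :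
    coordCurvature G y u v w = (4 * c) • (G y v w • u - G y u w • v) := by
  have hq' := hq y hy
  set a : ℝ := -(2 * c) * (1 + c * ‖y‖ ^ 2)⁻¹ with ha
  have hda : HasFDerivAt (fun y : E => -(2 * c) * (1 + c * ‖y‖ ^ 2)⁻¹) ((a ^ 2) • innerSL ℝ y) y := by
    have h2 := (((hasDerivAt_inv hq').comp_hasFDerivAt y
      (hasFDerivAt_one_add_mul_norm_sq c y))).const_mul (-(2 * c))
    refine h2.congr_fderiv ?_
    ext v
    simp [ha]
    field_simp
  have key : ∀ u v w, fderiv ℝ (fun y' => christoffel G y' v w) y u =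
      a • ((inner ℝ v u : ℝ) • w + (inner ℝ w u : ℝ) • v - (inner ℝ v w : ℝ) • u) +
      (a ^ 2 * inner ℝ u y) • ((inner ℝ v y : ℝ) • w + (inner ℝ w y : ℝ) • v - (inner ℝ v w : ℝ) • y) := by
    intro u v w
    have he : (fun y' => christoffel G y' v w) =ᶠ[nhds y] fun y' =>
        (-(2 * c) * (1 + c * ‖y'‖ ^ 2)⁻¹) • (innerSL ℝ v y' • w + innerSL ℝ w y' • v
          - (inner ℝ v w : ℝ) • y') := by
      filter_upwards [h.isOpen.mem_nhds hy] with y' hy' using h.christoffel_of_conformal hG hq hy' v w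
    have hB : HasFDerivAt (fun y' : E => innerSL ℝ v y' • w + innerSL ℝ w y' • v
          - (inner ℝ v w : ℝ) • y') ((innerSL ℝ v).smulRight w + (innerSL ℝ w).smulRight v -
          (inner ℝ v w : ℝ) • ContinuousLinearMap.id ℝ E) y :=
      (((innerSL ℝ v).smulRight w).hasFDerivAt.add ((innerSL ℝ w).smulRight v).hasFDerivAt).sub
        ((hasFDerivAt_id y).const_smul _)
    rw [((hda.smul hB).congr_of_eventuallyEq he).fderiv]
    simp [← ha, real_inner_comm y u]
  have hA : 2 * a + ‖y‖ ^ 2 * a ^ 2 = -(4 * c) * ((1 + c * ‖y‖ ^ 2) ^ 2)⁻¹ := by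
    rw [ha]; field_simp; ring
  rw [coordCurvature, key, key]
  simp only [h.christoffel_of_conformal hG hq hy, ← ha, hG y hy, inner_smul_left, inner_smul_right,
    inner_sub_left, inner_add_left, inner_sub_right, inner_add_right,
    real_inner_self_eq_norm_sq, RCLike.conj_to_real]
  rw [real_inner_comm w u, real_inner_comm w v, real_inner_comm v u]
  rw [← sub_eq_zero]
  match_scalars
  · ring
  · linear_combination (inner ℝ w u) * hA
  · linear_combination -(inner ℝ w v) * hA
  · ring

end SpaceForm

end

section

set_option maxSynthPendingDepth 3

section ConstantCurvature

theorem sectionalCurvature_eq_of_forall {V : Type*} [NormedAddCommGroup V] [InnerProductSpace ℝ V]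
    [FiniteDimensional ℝ V] {R : V → V → V → V} {κ : ℝ}
    (hR : ∀ u v w, R u v w = κ • ((inner ℝ v w : ℝ) • u - (inner ℝ u w : ℝ) • v)) (S : Plane V) :
    sectionalCurvature R S = κ := by
  let b := Module.finBasisOfFinrankEq ℝ S.1 S.2
  have hli : LinearIndependent ℝ ![(b 0 : V), (b 1 : V)] := by
    have := b.linearIndependent.map' S.1.subtype (Submodule.ker_subtype _)
    have e : ![(b 0 : V), (b 1 : V)] = S.1.subtype ∘ b := by
      funext i
      fin_cases i <;> rfl
    rw [e]
    exact this
  have hb := gramDet_ne_zero_of_linearIndependent hli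
  change inner ℝ (R (b 1) (b 0) (b 0)) (b 1 : V) / gramDet (b 0 : V) (b 1 : V) = _
  rw [div_eq_iff hb, hR, gramDet, real_inner_smul_left, inner_sub_left, real_inner_smul_left,
    real_inner_smul_left, real_inner_comm (b 1 : V) (b 0 : V)]
  ring

variable {E : Type*} [NormedAddCommGroup E] [NormedSpace ℝ E] [FiniteDimensional ℝ E]
  {H : Type*} [TopologicalSpace H] {I : ModelWithCorners ℝ E H} [I.Boundaryless]
  {M : Type*} [TopologicalSpace M] [ChartedSpace H M] [IsManifold I ∞ M] (g : SmoothMetric I M)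

theorem SmoothMetric.curvatureLaw_eq_dirac (hE : 2 ≤ Module.finrank ℝ E) {p x : M}
    (hx : x ∈ (extChartAt I p).source) {κ : ℝ}
    (hR : ∀ u v w, coordCurvature (g.inChart p) (extChartAt I p x) u v w =
      κ • (g.inChart p (extChartAt I p x) v w • u - g.inChart p (extChartAt I p x) u w • v)) :
    g.curvatureLaw x = Measure.dirac κ := by
  have hprob := g.isProbabilityMeasure_curvatureLaw hE x
  let _ : RiemannianBundle (fun p : M => TangentSpace I p) := ⟨g.toRiemannianMetric⟩
  have : FiniteDimensional ℝ (TangentSpace I x) := inferInstanceAs (FiniteDimensional ℝ E)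
  have hD : ∀ a b, inner ℝ (chartFrameEquiv I p x hx a) (chartFrameEquiv I p x hx b) =
      g.inChart p (extChartAt I p x) a b := fun a b => by
    rw [g.inChart_extChartAt hx, ← chartFrameEquiv_apply hx, ← chartFrameEquiv_apply hx]
    rfl
  have hsec : sectionalCurvature (V := TangentSpace I x) (g.curvatureTensor x) = fun _ => κ := by
    funext S
    refine sectionalCurvature_eq_of_forall (fun u v w => ?_) S
    obtain ⟨u, rfl⟩ := (chartFrameEquiv I p x hx).surjective u
    obtain ⟨v, rfl⟩ := (chartFrameEquiv I p x hx).surjective v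
    obtain ⟨w, rfl⟩ := (chartFrameEquiv I p x hx).surjective w
    rw [hD, hD, ← map_smul, ← map_smul, ← map_sub, ← map_smul, ← hR]
    simp only [chartFrameEquiv_apply hx]
    exact g.curvatureTensor_chartFrame hx u v w
  have h1 : g.curvatureLaw x = (uniformPlane (TangentSpace I x)).map fun _ => κ := by
    rw [SmoothMetric.curvatureLaw, hsec]
  rw [Measure.map_const] at h1
  rw [h1] at hprob ⊢
  have := hprob.measure_univ
  rw [Measure.smul_apply, Measure.dirac_apply_of_mem (Set.mem_univ _), smul_eq_mul, mul_one] at this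
  rw [this, one_smul]

variable [MeasurableSpace E] [BorelSpace E] [MeasurableSpace M] [BorelSpace M]

theorem SmoothMetric.volumeMeasure_singleton [Nontrivial E] (x : M) [MeasurableSingletonClass M] :
    g.volumeMeasure {x} = 0 := by
  rw [g.volumeMeasure_apply_of_subset (measurableSet_singleton x)
    (Set.singleton_subset_iff.2 (mem_extChartAt_source (I := I) x)),
    g.chartVolume_apply x (measurableSet_singleton x)]
  refine setLIntegral_measure_zero _ _ (measure_mono_null (t := {extChartAt I x x}) ?_ (measure_singleton _))
  rintro y ⟨hy, hyx⟩
  rw [Set.mem_preimage, Set.mem_singleton_iff] at hyx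
  rw [Set.mem_singleton_iff]
  exact ((extChartAt I x).right_inv hy).symm.trans (congrArg _ hyx)

variable [SecondCountableTopology M] [CompactSpace M]

theorem SmoothMetric.le_curvatureDistribution_singleton (hE : 2 ≤ Module.finrank ℝ E) {κ : ℝ} {S : Set M}
    (hS : MeasurableSet S) (h : ∀ x ∈ S, g.curvatureLaw x = Measure.dirac κ) :
    (g.volumeMeasure Set.univ)⁻¹ * g.volumeMeasure S ≤ g.curvatureDistribution {κ} := by
  rw [g.curvatureDistribution_eq hE, Measure.smul_apply, smul_eq_mul,
    Measure.bind_apply (measurableSet_singleton κ) (g.measurable_curvatureLaw hE).aemeasurable]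
  refine mul_le_mul_right ?_ _
  calc g.volumeMeasure S = ∫⁻ x in S, 1 ∂g.volumeMeasure := (setLIntegral_one S).symm
    _ = ∫⁻ x in S, g.curvatureLaw x {κ} ∂g.volumeMeasure := by
        refine setLIntegral_congr_fun hS fun x hx => ?_
        rw [h x hx, Measure.dirac_apply_of_mem (Set.mem_singleton κ)]
    _ ≤ _ := setLIntegral_le_lintegral _ _

end ConstantCurvature

section KernelLimit

theorem tendsto_bind_of_tendsto_singleton {X Y : Type*} [MeasurableSpace X] [MeasurableSingletonClass X]
    [MeasurableSpace Y] {P : ℕ → Measure X} [∀ k, IsProbabilityMeasure (P k)] {x : X}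
    (hP : Filter.Tendsto (fun k => P k {x}) Filter.atTop (nhds 1)) (ρ : Kernel X Y) [IsMarkovKernel ρ]
    {A : Set Y} (hA : MeasurableSet A) :
    Filter.Tendsto (fun k => (P k).bind ρ A) Filter.atTop (nhds (ρ x A)) := by
  have hle : ∀ z, ρ z A ≤ 1 := fun z => prob_le_one
  have hsplit : ∀ k, (P k).bind ρ A = P k {x} * ρ x A + ∫⁻ z in {x}ᶜ, ρ z A ∂P k := by
    intro k
    rw [Measure.bind_apply hA ρ.measurable.aemeasurable,
      ← lintegral_add_compl _ (measurableSet_singleton x), lintegral_singleton, mul_comm]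
  have h1 : Filter.Tendsto (fun k => P k {x} * ρ x A) Filter.atTop (nhds (ρ x A)) := by
    simpa using ENNReal.Tendsto.mul_const hP (Or.inl one_ne_zero)
  have h2 : Filter.Tendsto (fun k => P k {x} * ρ x A + (1 - P k {x})) Filter.atTop (nhds (ρ x A)) := by
    have := h1.add (ENNReal.Tendsto.sub (tendsto_const_nhds (x := (1 : ENNReal))) hP (Or.inl ENNReal.one_ne_top))
    simpa using this
  refine tendsto_of_tendsto_of_tendsto_of_le_of_le h1 h2 (fun k => ?_) (fun k => ?_)
  · simp only
    rw [hsplit]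
    exact le_self_add
  · simp only
    rw [hsplit]
    refine add_le_add le_rfl ?_
    calc ∫⁻ z in {x}ᶜ, ρ z A ∂P k ≤ ∫⁻ _ in {x}ᶜ, 1 ∂P k := lintegral_mono fun z => hle z
      _ = 1 - P k {x} := by
        rw [setLIntegral_one, prob_compl_eq_one_sub (measurableSet_singleton x)]

end KernelLimit

end

section

set_option maxSynthPendingDepth 3

section SphereMetric

open Metric Module

variable {E : Type*} [NormedAddCommGroup E] [InnerProductSpace ℝ E] {m : ℕ}

/-- The flat metric of a Euclidean vector space. -/
def flatMetric (E : Type*) [NormedAddCommGroup E] [InnerProductSpace ℝ E] : SmoothMetric 𝓘(ℝ, E) E where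
  inner := (riemannianMetricVectorSpace E).inner
  symm := (riemannianMetricVectorSpace E).symm
  pos := (riemannianMetricVectorSpace E).pos
  isVonNBounded := (riemannianMetricVectorSpace E).isVonNBounded
  contMDiff := (riemannianMetricVectorSpace E).contMDiff.of_le le_top

variable [Fact (finrank ℝ E = m + 1)]

/-- The round metric of the unit sphere, as a family of bilinear forms. -/
def sphereForm (x : sphere (0 : E) 1) :
    TangentSpace (𝓡 m) x →L[ℝ] TangentSpace (𝓡 m) x →L[ℝ] ℝ :=
  let D : TangentSpace (𝓡 m) x →L[ℝ] E := mfderiv (𝓡 m) 𝓘(ℝ, E) ((↑) : sphere (0 : E) 1 → E) x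
  (D.precomp ℝ).comp ((innerSL ℝ : E →L[ℝ] E →L[ℝ] ℝ).comp D)

theorem sphereForm_apply (x : sphere (0 : E) 1) (v w : TangentSpace (𝓡 m) x) :
    sphereForm x v w = inner ℝ (E := E) (mfderiv (𝓡 m) 𝓘(ℝ, E) ((↑) : sphere (0 : E) 1 → E) x v)
      (mfderiv (𝓡 m) 𝓘(ℝ, E) ((↑) : sphere (0 : E) 1 → E) x w) := rfl

theorem sphereForm_pos (x : sphere (0 : E) 1) {v : TangentSpace (𝓡 m) x} (hv : v ≠ 0) :
    0 < sphereForm x v v := by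
  rw [sphereForm_apply]
  refine real_inner_self_pos.2 fun h => hv ?_
  refine injective_mvfderiv_subtypeVal_sphere x ?_
  rw [map_zero]
  exact h

/-- The metric on the unit sphere which is conformal to the round metric with the factor `f`. -/
def conformalSphereMetric (f : sphere (0 : E) 1 → ℝ) (hf : ContMDiff (𝓡 m) 𝓘(ℝ, ℝ) ∞ f)
    (hpos : ∀ x, 0 < f x) : SmoothMetric (𝓡 m) (sphere (0 : E) 1) where
  inner x := f x • sphereForm x
  symm x v w := congrArg (f x * ·) (real_inner_comm (F := E) _ _)
  pos x v hv := mul_pos (hpos x) (sphereForm_pos x hv)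
  isVonNBounded x := by
    let D : EuclideanSpace ℝ (Fin m) →L[ℝ] E := mfderiv (𝓡 m) 𝓘(ℝ, E) ((↑) : sphere (0 : E) 1 → E) x
    have hD : (D : EuclideanSpace ℝ (Fin m) →ₗ[ℝ] E).ker = ⊥ :=
      LinearMap.ker_eq_bot.2 (injective_mvfderiv_subtypeVal_sphere x)
    obtain ⟨K, hK, hKD⟩ := LinearMap.exists_antilipschitzWith _ hD
    change Bornology.IsVonNBounded ℝ {v : EuclideanSpace ℝ (Fin m) | f x * inner ℝ (D v) (D v) < 1}
    refine NormedSpace.isVonNBounded_of_isBounded _ ((Metric.isBounded_closedBall (x := 0)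
      (r := K * √(1 / f x))).subset fun v hv => ?_)
    rw [Set.mem_ofPred_eq, real_inner_self_eq_norm_sq] at hv
    rw [mem_closedBall_zero_iff]
    have h1 : ‖v‖ ≤ K * ‖D v‖ := by
      have := hKD.le_mul_dist v 0
      simpa using this
    refine h1.trans (mul_le_mul_of_nonneg_left (Real.le_sqrt_of_sq_le ?_) K.2)
    rw [le_div_iff₀ (hpos x), mul_comm]
    exact hv.le
  contMDiff := hf.smul_section (SmoothMetric.contMDiff_pullback (flatMetric E) (contMDiff_coe_sphere (n := m)))

end SphereMetric

section Stereographic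

open Metric Module

variable {E : Type*} [NormedAddCommGroup E] [InnerProductSpace ℝ E]

/-- The inverse stereographic projection is conformal. -/
theorem inner_fderiv_stereoInvFunAux {q w u u' : E} (hq : ‖q‖ = 1) (hw : inner ℝ w q = (0 : ℝ))
    (hu : inner ℝ u q = (0 : ℝ)) (hu' : inner ℝ u' q = (0 : ℝ)) :
    inner ℝ (fderiv ℝ (stereoInvFunAux q) w u) (fderiv ℝ (stereoInvFunAux q) w u') =
      16 / (‖w‖ ^ 2 + 4) ^ 2 * (inner ℝ u u' : ℝ) := by
  have hN : ‖w‖ ^ 2 + 4 ≠ 0 := by positivity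
  have key : ∀ u, fderiv ℝ (stereoInvFunAux q) w u = (4 / (‖w‖ ^ 2 + 4)) • u -
      (8 * inner ℝ w u / (‖w‖ ^ 2 + 4) ^ 2) • w + (16 * inner ℝ w u / (‖w‖ ^ 2 + 4) ^ 2) • q := by
    intro u
    have h0 := (hasStrictFDerivAt_norm_sq w).hasFDerivAt
    have h1 : HasFDerivAt (fun w : E => (‖w‖ ^ 2 + 4)⁻¹) _ w :=
      (hasDerivAt_inv hN).comp_hasFDerivAt w (h0.add_const 4)
    have h2 := ((hasFDerivAt_id w).const_smul (4 : ℝ)).add ((h0.sub_const 4).smul_const q)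
    have h3 := (h1.smul h2).fderiv
    have h4 : fderiv ℝ (stereoInvFunAux q) w = _ := h3
    rw [h4]
    simp
    match_scalars
    · field_simp
    · field_simp
      ring
    · field_simp
      ring
  rw [key, key]
  have hqq : inner ℝ q q = (1 : ℝ) := by rw [real_inner_self_eq_norm_sq, hq]; norm_num
  simp only [inner_sub_left, inner_add_left, inner_sub_right, inner_add_right, real_inner_smul_left,
    real_inner_smul_right, real_inner_comm u' q, real_inner_comm w q, hw, hu, hu',
    hqq, real_inner_self_eq_norm_sq w, real_inner_comm w u]
  field_simp
  ring

end Stereographic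

end

section

set_option maxSynthPendingDepth 3

section SphereChart

open Metric Module

variable {E : Type*} [NormedAddCommGroup E] [InnerProductSpace ℝ E] {m : ℕ}
  [Fact (finrank ℝ E = m + 1)]

/-- The isometry of the model space with the complement of the pole of the stereographic chart. -/
def sphereModelEquiv (p : sphere (0 : E) 1) :
    EuclideanSpace ℝ (Fin m) ≃ₗᵢ[ℝ] (ℝ ∙ ((-p : sphere (0 : E) 1) : E))ᗮ :=
  (OrthonormalBasis.fromOrthogonalSpanSingleton (𝕜 := ℝ) m (ne_zero_of_mem_unit_sphere (-p))).repr.symm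

theorem inner_sphereModelEquiv (p : sphere (0 : E) 1) (y : EuclideanSpace ℝ (Fin m)) :
    inner ℝ (sphereModelEquiv p y : E) ((-p : sphere (0 : E) 1) : E) = (0 : ℝ) :=
  Submodule.mem_orthogonal_singleton_iff_inner_left.1 (sphereModelEquiv p y).2

theorem coe_extChartAt_symm_sphere (p : sphere (0 : E) 1) (y : EuclideanSpace ℝ (Fin m)) :
    ((extChartAt (𝓡 m) p).symm y : E) =
      stereoInvFunAux ((-p : sphere (0 : E) 1) : E) (sphereModelEquiv p y : E) := by
  change ((stereographic' m (-p)).symm y : E) = _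
  rw [stereographic'_symm_apply, stereoInvFunAux_apply, smul_add]
  rfl

theorem extChartAt_target_sphere (p : sphere (0 : E) 1) : (extChartAt (𝓡 m) p).target = Set.univ := by
  rw [extChartAt_target]
  change (stereographic' m (-p)).target ∩ _ = _
  simp

theorem extChartAt_source_sphere (p : sphere (0 : E) 1) :
    (extChartAt (𝓡 m) p).source = {-p}ᶜ := by
  rw [extChartAt_source]
  change (stereographic' m (-p)).source = _
  simp

theorem one_add_inner_extChartAt_symm (p : sphere (0 : E) 1) (y : EuclideanSpace ℝ (Fin m)) :
    1 + inner ℝ (p : E) ((extChartAt (𝓡 m) p).symm y : E) = 8 / (‖y‖ ^ 2 + 4) := by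
  have h := inner_sphereModelEquiv p y
  have hp : inner ℝ (p : E) (p : E) = (1 : ℝ) := by simp
  have hn : ‖(sphereModelEquiv p y : E)‖ = ‖y‖ := (sphereModelEquiv p).norm_map y
  have hN : ‖y‖ ^ 2 + 4 ≠ 0 := by positivity
  rw [coe_extChartAt_symm_sphere, stereoInvFunAux_apply, hn]
  generalize (sphereModelEquiv p y : E) = w at h
  rw [coe_neg_sphere, inner_neg_right, neg_eq_zero, real_inner_comm] at h
  rw [coe_neg_sphere, inner_smul_right, inner_add_right, inner_smul_right, inner_smul_right,
    inner_neg_right, h, hp]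
  field_simp
  ring

theorem conformalSphereMetric_inChart (f : sphere (0 : E) 1 → ℝ) (hf : ContMDiff (𝓡 m) 𝓘(ℝ, ℝ) ∞ f)
    (hpos : ∀ x, 0 < f x) (p : sphere (0 : E) 1) (y v w : EuclideanSpace ℝ (Fin m)) :
    (conformalSphereMetric f hf hpos).inChart p y v w =
      f ((extChartAt (𝓡 m) p).symm y) * (16 / (‖y‖ ^ 2 + 4) ^ 2) * inner ℝ v w := by
  have hy : y ∈ (extChartAt (𝓡 m) p).target := by rw [extChartAt_target_sphere]; trivial
  have hd1 : MDifferentiableAt 𝓘(ℝ, EuclideanSpace ℝ (Fin m)) (𝓡 m) (extChartAt (𝓡 m) p).symm y :=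
    ((contMDiffOn_extChartAt_symm (I := 𝓡 m) (n := ∞) p).contMDiffAt
      ((isOpen_extChartAt_target p).mem_nhds hy)).mdifferentiableAt (by simp)
  have hd2 : MDifferentiableAt (𝓡 m) 𝓘(ℝ, E) ((↑) : sphere (0 : E) 1 → E) ((extChartAt (𝓡 m) p).symm y) :=
    (contMDiff_coe_sphere (m := ∞) _).mdifferentiableAt (by simp)
  have hfun : ((↑) : sphere (0 : E) 1 → E) ∘ (extChartAt (𝓡 m) p).symm =
      fun y => stereoInvFunAux ((-p : sphere (0 : E) 1) : E) (sphereModelEquiv p y : E) :=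
    funext (coe_extChartAt_symm_sphere p)
  have hstereo : ∀ z : E, DifferentiableAt ℝ (stereoInvFunAux ((-p : sphere (0 : E) 1) : E)) z := fun z =>
    (contDiff_stereoInvFunAux (m := 1)).contDiffAt.differentiableAt (by simp)
  have hlin := ((ℝ ∙ ((-p : sphere (0 : E) 1) : E))ᗮ.subtypeL.comp
    ((sphereModelEquiv (m := m) p).toContinuousLinearEquiv :
      EuclideanSpace ℝ (Fin m) →L[ℝ] (ℝ ∙ ((-p : sphere (0 : E) 1) : E))ᗮ)).hasFDerivAt (x := y)
  have key : ∀ v, mfderiv (𝓡 m) 𝓘(ℝ, E) ((↑) : sphere (0 : E) 1 → E) ((extChartAt (𝓡 m) p).symm y)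
      (mfderiv 𝓘(ℝ, EuclideanSpace ℝ (Fin m)) (𝓡 m) (extChartAt (𝓡 m) p).symm y v) =
      fderiv ℝ (stereoInvFunAux ((-p : sphere (0 : E) 1) : E)) (sphereModelEquiv p y : E)
        (sphereModelEquiv p v : E) := by
    intro v
    have h1 := mfderiv_comp y hd2 hd1
    rw [hfun, mfderiv_eq_fderiv] at h1
    have h2 := ((hstereo (sphereModelEquiv p y : E)).hasFDerivAt.comp y hlin).fderiv
    exact (DFunLike.congr_fun h1 v).symm.trans (DFunLike.congr_fun h2 v)
  change f _ * inner ℝ (E := E) (mfderiv (𝓡 m) 𝓘(ℝ, E) ((↑) : sphere (0 : E) 1 → E) _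
    (mfderiv 𝓘(ℝ, EuclideanSpace ℝ (Fin m)) (𝓡 m) (extChartAt (𝓡 m) p).symm y v))
    (mfderiv (𝓡 m) 𝓘(ℝ, E) ((↑) : sphere (0 : E) 1 → E) _
    (mfderiv 𝓘(ℝ, EuclideanSpace ℝ (Fin m)) (𝓡 m) (extChartAt (𝓡 m) p).symm y w)) = _
  have hn : ‖(sphereModelEquiv p y : E)‖ = ‖y‖ := (sphereModelEquiv p).norm_map y
  have hi : inner ℝ (sphereModelEquiv p v : E) (sphereModelEquiv p w : E) = (inner ℝ v w : ℝ) :=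
    (sphereModelEquiv p).inner_map_map v w
  have h := inner_fderiv_stereoInvFunAux (q := ((-p : sphere (0 : E) 1) : E)) (norm_eq_of_mem_sphere _)
    (inner_sphereModelEquiv p y) (inner_sphereModelEquiv p v) (inner_sphereModelEquiv p w)
  rw [hn, hi] at h
  rw [mul_assoc, ← h]
  exact congrArg (f _ * ·) (congrArg₂ (inner ℝ) (key v) (key w))

end SphereChart

end

section

set_option maxSynthPendingDepth 3

section Profile

/-- A positive function on `(-∞, 2]` which is `((1 - 4c) s + 8c) / 2` near `2` and equal to `A` away
from `2`. -/
def pinchProfile (c A s : ℝ) : ℝ :=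
  (1 - Real.smoothTransition (2 * (1 + 4 * |c|) * (2 - s) - 1)) * (((1 - 4 * c) * s + 8 * c) / 2) +
    A * Real.smoothTransition (2 * (1 + 4 * |c|) * (2 - s) - 1)

theorem contDiff_pinchProfile (c A : ℝ) : ContDiff ℝ ∞ (pinchProfile c A) := by
  have h : ContDiff ℝ ∞ fun s : ℝ => Real.smoothTransition (2 * (1 + 4 * |c|) * (2 - s) - 1) :=
    Real.smoothTransition.contDiff.comp (by fun_prop)
  unfold pinchProfile
  fun_prop

theorem pinchProfile_pos (c : ℝ) {A s : ℝ} (hA : 0 < A) (hs : s ≤ 2) : 0 < pinchProfile c A s := by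
  rw [pinchProfile]
  set S := Real.smoothTransition (2 * (1 + 4 * |c|) * (2 - s) - 1) with hS
  have h0 : 0 ≤ S := Real.smoothTransition.nonneg _
  have h1 : S ≤ 1 := Real.smoothTransition.le_one _
  by_cases h : 1 ≤ 2 * (1 + 4 * |c|) * (2 - s) - 1
  · rw [hS, Real.smoothTransition.one_of_one_le h]
    simpa using hA
  · have hD : 0 < ((1 - 4 * c) * s + 8 * c) / 2 := by
      have := mul_le_mul_of_nonneg_right (neg_abs_le c) (sub_nonneg.2 hs)
      nlinarith
    rcases h0.eq_or_lt with h0 | h0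
    · rw [← h0]
      simpa using hD
    · have : 0 ≤ (1 - S) * (((1 - 4 * c) * s + 8 * c) / 2) := mul_nonneg (by linarith) hD.le
      positivity

theorem pinchProfile_of_le (c A : ℝ) {s : ℝ} (h : 2 * (1 + 4 * |c|) * (2 - s) ≤ 1) :
    pinchProfile c A s = ((1 - 4 * c) * s + 8 * c) / 2 := by
  rw [pinchProfile, Real.smoothTransition.zero_of_nonpos (by linarith)]
  ring

theorem pinchProfile_mono (c s : ℝ) : Monotone fun A => pinchProfile c A s := fun _ _ h =>
  add_le_add le_rfl (mul_le_mul_of_nonneg_right h (Real.smoothTransition.nonneg _))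

theorem tendsto_pinchProfile (c : ℝ) {s : ℝ} (h : 1 < 2 * (1 + 4 * |c|) * (2 - s)) :
    Filter.Tendsto (fun A => pinchProfile c A s) Filter.atTop Filter.atTop :=
  Filter.tendsto_atTop_add_const_left _ _ (Filter.tendsto_id.atTop_mul_const
    (Real.smoothTransition.pos_of_pos (by linarith)))

end Profile

section PinchedMetric

open Metric Module

variable {E : Type*} [NormedAddCommGroup E] [InnerProductSpace ℝ E] {m : ℕ}
  [Fact (finrank ℝ E = m + 1)]

theorem one_add_inner_sphere_le (p x : sphere (0 : E) 1) : 1 + inner ℝ (p : E) (x : E) ≤ 2 := by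
  have := real_inner_le_norm (p : E) (x : E)
  rw [norm_eq_of_mem_sphere, norm_eq_of_mem_sphere] at this
  linarith

theorem contMDiff_inner_sphere (p : sphere (0 : E) 1) :
    ContMDiff (𝓡 m) 𝓘(ℝ, ℝ) ∞ fun x : sphere (0 : E) 1 => 1 + (inner ℝ (p : E) (x : E) : ℝ) := by
  have h : ContDiff ℝ ∞ fun x : E => 1 + (inner ℝ (p : E) x : ℝ) :=
    contDiff_const.add (contDiff_const.inner ℝ contDiff_id)
  exact h.contMDiff.comp contMDiff_coe_sphere

/-- A metric on the sphere which has the curvature `4 c` in a neighbourhood of `p`, and is small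
away from `p` if `A` is large. -/
def pinchedMetric (p : sphere (0 : E) 1) (c : ℝ) {A : ℝ} (hA : 0 < A) :
    SmoothMetric (𝓡 m) (sphere (0 : E) 1) :=
  conformalSphereMetric (fun x => (pinchProfile c A (1 + inner ℝ (p : E) (x : E)) ^ 2)⁻¹)
    (((((contDiff_pinchProfile c A).pow 2).contMDiff).comp (contMDiff_inner_sphere p)).inv₀ fun x =>
      pow_ne_zero 2 (pinchProfile_pos c hA (one_add_inner_sphere_le p x)).ne')
    fun x => inv_pos.2 (pow_pos (pinchProfile_pos c hA (one_add_inner_sphere_le p x)) 2)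

/-- The conformal factor of the pinched metric in the stereographic chart. -/
def pinchWeight (c A : ℝ) (y : EuclideanSpace ℝ (Fin m)) : ℝ :=
  (pinchProfile c A (8 / (‖y‖ ^ 2 + 4)) ^ 2)⁻¹ * (16 / (‖y‖ ^ 2 + 4) ^ 2)

theorem pinchedMetric_inChart (p : sphere (0 : E) 1) (c : ℝ) {A : ℝ} (hA : 0 < A)
    (y v w : EuclideanSpace ℝ (Fin m)) :
    (pinchedMetric p c hA).inChart p y v w = pinchWeight c A y * inner ℝ v w := by
  rw [pinchedMetric, conformalSphereMetric_inChart, one_add_inner_extChartAt_symm]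
  rfl

/-- The coordinate ball on which the pinched metric has constant curvature. -/
def pinchBall (m : ℕ) (c : ℝ) : Set (EuclideanSpace ℝ (Fin m)) :=
  {y | 2 * (1 + 4 * |c|) * (2 - 8 / (‖y‖ ^ 2 + 4)) < 1}

theorem isOpen_pinchBall (c : ℝ) : IsOpen (pinchBall m c) := by
  refine isOpen_lt ?_ continuous_const
  refine continuous_const.mul (continuous_const.sub (continuous_const.div (by fun_prop) fun y => ?_))
  positivity

theorem eight_div_le (y : EuclideanSpace ℝ (Fin m)) : 8 / (‖y‖ ^ 2 + 4) ≤ 2 := by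
  rw [div_le_iff₀ (by positivity)]
  nlinarith [sq_nonneg ‖y‖]

theorem pinchProfile_pinchBall {c : ℝ} (A : ℝ) {y : EuclideanSpace ℝ (Fin m)} (hy : y ∈ pinchBall m c) :
    pinchProfile c A (8 / (‖y‖ ^ 2 + 4)) = 4 * (1 + c * ‖y‖ ^ 2) / (‖y‖ ^ 2 + 4) := by
  rw [pinchProfile_of_le c A (le_of_lt hy)]
  have : ‖y‖ ^ 2 + 4 ≠ 0 := by positivity
  field_simp
  ring

theorem one_add_ne_zero_of_mem_pinchBall {c : ℝ} {y : EuclideanSpace ℝ (Fin m)}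
    (hy : y ∈ pinchBall m c) : 1 + c * ‖y‖ ^ 2 ≠ 0 := by
  intro h
  have := pinchProfile_pos c one_pos (eight_div_le y)
  rw [pinchProfile_pinchBall 1 hy, h] at this
  simp at this

theorem pinchWeight_pinchBall {c : ℝ} (A : ℝ) {y : EuclideanSpace ℝ (Fin m)} (hy : y ∈ pinchBall m c) :
    pinchWeight c A y = ((1 + c * ‖y‖ ^ 2) ^ 2)⁻¹ := by
  have h1 : ‖y‖ ^ 2 + 4 ≠ 0 := by positivity
  have h2 := one_add_ne_zero_of_mem_pinchBall hy
  rw [pinchWeight, pinchProfile_pinchBall A hy]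
  field_simp
  norm_num

theorem coordCurvature_pinchedMetric (p : sphere (0 : E) 1) {c : ℝ} {A : ℝ} (hA : 0 < A)
    {y : EuclideanSpace ℝ (Fin m)} (hy : y ∈ pinchBall m c) (u v w : EuclideanSpace ℝ (Fin m)) :
    coordCurvature ((pinchedMetric p c hA).inChart p) y u v w =
      (4 * c) • ((pinchedMetric p c hA).inChart p y v w • u - (pinchedMetric p c hA).inChart p y u w • v) :=
  (((pinchedMetric p c hA).isMetricOn_inChart p).mono (isOpen_pinchBall c) (by
    rw [extChartAt_target_sphere]; exact Set.subset_univ _)).coordCurvature_of_conformal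
    (fun y hy v w => by rw [pinchedMetric_inChart, pinchWeight_pinchBall A hy])
    (fun y hy => one_add_ne_zero_of_mem_pinchBall hy) hy u v w

end PinchedMetric

end

section

set_option maxSynthPendingDepth 3

section Concentration

open Metric Module Filter Topology

variable {m : ℕ}

theorem pinchWeight_pos (c : ℝ) {A : ℝ} (hA : 0 < A) (y : EuclideanSpace ℝ (Fin m)) :
    0 < pinchWeight c A y := by
  have := pinchProfile_pos c hA (eight_div_le y)
  unfold pinchWeight
  positivity

theorem pinchWeight_anti (c : ℝ) {A B : ℝ} (hA : 0 < A) (hAB : A ≤ B) (y : EuclideanSpace ℝ (Fin m)) :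
    pinchWeight c B y ≤ pinchWeight c A y := by
  have h1 := pinchProfile_pos c hA (eight_div_le y)
  have h2 := pinchProfile_mono c (8 / (‖y‖ ^ 2 + 4)) hAB
  unfold pinchWeight
  simp only at h2
  gcongr

theorem tendsto_pinchWeight {c : ℝ} {y : EuclideanSpace ℝ (Fin m)}
    (h : 1 < 2 * (1 + 4 * |c|) * (2 - 8 / (‖y‖ ^ 2 + 4))) :
    Tendsto (fun A => pinchWeight c A y) atTop (𝓝 0) := by
  have h1 := (tendsto_pow_atTop two_ne_zero).comp (tendsto_pinchProfile c h)
  have h2 := (tendsto_inv_atTop_zero.comp h1).mul_const (16 / (‖y‖ ^ 2 + 4) ^ 2)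
  rw [zero_mul] at h2
  exact h2

variable {E : Type*} [NormedAddCommGroup E] [InnerProductSpace ℝ E] [Fact (finrank ℝ E = m + 1)]
  [MeasurableSpace E] [BorelSpace E]

theorem chartDensity_pinchedMetric (p : sphere (0 : E) 1) (c : ℝ) {A : ℝ} (hA : 0 < A)
    (y : EuclideanSpace ℝ (Fin m)) :
    (pinchedMetric p c hA).chartDensity p y = ENNReal.ofReal √(pinchWeight c A y ^ m *
      formDet (finBasis ℝ (EuclideanSpace ℝ (Fin m))) (innerSL ℝ)) := by
  have h : Matrix.of (fun i j => (pinchedMetric p c hA).inChart p y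
      (finBasis ℝ (EuclideanSpace ℝ (Fin m)) i) (finBasis ℝ (EuclideanSpace ℝ (Fin m)) j)) =
      pinchWeight c A y • Matrix.of fun i j => innerSL ℝ
        (finBasis ℝ (EuclideanSpace ℝ (Fin m)) i) (finBasis ℝ (EuclideanSpace ℝ (Fin m)) j) := by
    ext i j
    exact pinchedMetric_inChart p c hA y _ _
  rw [SmoothMetric.chartDensity, formDet, h, Matrix.det_smul, Fintype.card_fin,
    show pinchWeight c A y ^ finrank ℝ (EuclideanSpace ℝ (Fin m)) = pinchWeight c A y ^ m by
      rw [finrank_euclideanSpace_fin]]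
  rfl

theorem volume_pinchBall_boundary (hm : 2 ≤ m) (c : ℝ) (μ : Measure (EuclideanSpace ℝ (Fin m)))
    [μ.IsAddHaarMeasure] :
    ∀ᵐ y ∂μ, 2 * (1 + 4 * |c|) * (2 - 8 / (‖y‖ ^ 2 + 4)) ≠ 1 := by
  have : Nontrivial (EuclideanSpace ℝ (Fin m)) :=
    Module.nontrivial_of_finrank_pos (R := ℝ) (by rw [finrank_euclideanSpace_fin]; omega)
  set r : ℝ := 8 / (2 - 1 / (2 * (1 + 4 * |c|))) - 4
  refine measure_mono_null (t := sphere 0 √r) ?_ (Measure.addHaar_sphere μ 0 _)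
  intro y hy
  rw [Set.mem_compl_iff, Set.mem_ofPred_eq, not_not] at hy
  have hc : 0 < 1 + 4 * |c| := by positivity
  have hN : 0 < ‖y‖ ^ 2 + 4 := by positivity
  have h1 : 8 / (‖y‖ ^ 2 + 4) = 2 - 1 / (2 * (1 + 4 * |c|)) := by
    field_simp at hy ⊢
    linarith
  have h2 : ‖y‖ ^ 2 = r := by
    simp only [r]
    rw [← h1]
    field_simp
    ring
  rw [mem_sphere_zero_iff_norm, ← h2, Real.sqrt_sq (norm_nonneg y)]

theorem tendsto_lintegral_chartDensity (hm : 2 ≤ m) (p : sphere (0 : E) 1) (c : ℝ) [CompactSpace (sphere (0 : E) 1)] :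
    Tendsto (fun k : ℕ => ∫⁻ y in (pinchBall m c)ᶜ,
      (pinchedMetric (m := m) p c (A := k + 1) (by positivity)).chartDensity p y
        ∂(finBasis ℝ (EuclideanSpace ℝ (Fin m))).addHaar) atTop (𝓝 0) := by
  set μ := (finBasis ℝ (EuclideanSpace ℝ (Fin m))).addHaar
  have hdet : 0 ≤ formDet (finBasis ℝ (EuclideanSpace ℝ (Fin m))) (innerSL ℝ) :=
    (formDet_pos _ (fun v w => real_inner_comm w v) fun v hv => real_inner_self_pos.2 hv).le
  have hmeas : ∀ {A : ℝ} (hA : 0 < A), AEMeasurable ((pinchedMetric p c hA).chartDensity p)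
      (μ.restrict (pinchBall m c)ᶜ) := fun hA => by
    have := (pinchedMetric p c hA).aemeasurable_chartDensity p μ
    rw [extChartAt_target_sphere, Measure.restrict_univ] at this
    exact this.restrict
  have hfin : ∫⁻ y in (pinchBall m c)ᶜ, (pinchedMetric (m := m) p c one_pos).chartDensity p y ∂μ ≠ ⊤ := by
    have := (pinchedMetric (m := m) p c one_pos).isFiniteMeasure_volumeMeasure
    refine ne_top_of_le_ne_top (measure_ne_top (pinchedMetric (m := m) p c one_pos).volumeMeasure Set.univ) ?_
    refine (setLIntegral_le_lintegral _ _).trans (le_trans (le_of_eq ?_)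
      ((pinchedMetric (m := m) p c one_pos).chartVolume_le_volumeMeasure p Set.univ))
    rw [SmoothMetric.chartVolume_apply _ _ MeasurableSet.univ, extChartAt_target_sphere, Set.preimage_univ,
      Set.inter_univ, Measure.restrict_univ]
  have hlim := tendsto_lintegral_of_dominated_convergence' (μ := μ.restrict (pinchBall m c)ᶜ)
    (F := fun k : ℕ => (pinchedMetric p c (A := (k : ℝ) + 1) (by positivity)).chartDensity p)
    (f := fun _ => 0) _ (fun k => hmeas _) (fun k => Eventually.of_forall fun y => ?_) hfin ?_
  · simpa using hlim
  · simp only [chartDensity_pinchedMetric]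
    have := pinchWeight_anti c one_pos (show (1 : ℝ) ≤ (k : ℝ) + 1 by simp) y
    have := (pinchWeight_pos c (A := (k : ℝ) + 1) (by positivity) y).le
    gcongr
  · filter_upwards [ae_restrict_mem (isOpen_pinchBall c).measurableSet.compl,
      ae_restrict_of_ae (volume_pinchBall_boundary hm c μ)] with y hy hy'
    have h : 1 < 2 * (1 + 4 * |c|) * (2 - 8 / (‖y‖ ^ 2 + 4)) := lt_of_le_of_ne (not_lt.1 hy) hy'.symm
    have h1 := (tendsto_pinchWeight h).comp
      (tendsto_atTop_add_const_right _ (1 : ℝ) tendsto_natCast_atTop_atTop)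
    have h2 := ((h1.pow m).mul_const (formDet (finBasis ℝ (EuclideanSpace ℝ (Fin m))) (innerSL ℝ))).sqrt
    rw [zero_pow (by omega), zero_mul, Real.sqrt_zero] at h2
    have h3 := ENNReal.tendsto_ofReal h2
    rw [ENNReal.ofReal_zero] at h3
    simp only [chartDensity_pinchedMetric]
    exact h3

theorem tendsto_curvatureDistribution_pinchedMetric (hm : 2 ≤ m) (p : sphere (0 : E) 1) (c : ℝ)
    [CompactSpace (sphere (0 : E) 1)] [SecondCountableTopology (sphere (0 : E) 1)] :
    Tendsto (fun k : ℕ => (pinchedMetric (m := m) p c (A := k + 1) (by positivity)).curvatureDistribution {4 * c})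
      atTop (𝓝 1) := by
  have : Nonempty (sphere (0 : E) 1) := ⟨p⟩
  have hd : 2 ≤ finrank ℝ (EuclideanSpace ℝ (Fin m)) := by simpa using hm
  have : Nontrivial (EuclideanSpace ℝ (Fin m)) := Module.nontrivial_of_finrank_pos (R := ℝ) (by omega)
  let g : ℕ → SmoothMetric (𝓡 m) (sphere (0 : E) 1) := fun k => pinchedMetric p c (A := k + 1) (by positivity)
  have hfm : ∀ k, IsFiniteMeasure (g k).volumeMeasure := fun k => (g k).isFiniteMeasure_volumeMeasure
  set μ := (finBasis ℝ (EuclideanSpace ℝ (Fin m))).addHaar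
  have hU := (isOpen_pinchBall (m := m) c).measurableSet
  let S : Set (sphere (0 : E) 1) := {x | 2 * (1 + 4 * |c|) * (2 - (1 + inner ℝ (p : E) (x : E))) < 1}
  have hS : MeasurableSet S := by
    refine (isOpen_lt ?_ continuous_const).measurableSet
    exact continuous_const.mul (continuous_const.sub (contMDiff_inner_sphere (m := m) p).continuous)
  have hpre : (extChartAt (𝓡 m) p).symm ⁻¹' S = pinchBall m c := by
    ext y
    simp only [S, Set.mem_preimage, Set.mem_ofPred_eq, one_add_inner_extChartAt_symm]
    rfl
  have hsource : S ⊆ (extChartAt (𝓡 m) p).source := by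
    rw [extChartAt_source_sphere]
    rintro x hx rfl
    have hp : inner ℝ (p : E) (p : E) = (1 : ℝ) := by simp
    simp only [S, Set.mem_ofPred_eq, coe_neg_sphere, inner_neg_right, hp] at hx
    linarith [abs_nonneg c]
  have hvS : ∀ k, (g k).volumeMeasure S = ∫⁻ y in pinchBall m c, (g k).chartDensity p y ∂μ := by
    intro k
    rw [(g k).volumeMeasure_apply_of_subset hS hsource, (g k).chartVolume_apply p hS,
      extChartAt_target_sphere, Set.univ_inter, hpre]
  have hconst : ∀ k, (g k).volumeMeasure S = (g 0).volumeMeasure S := by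
    intro k
    rw [hvS, hvS]
    refine setLIntegral_congr_fun hU fun y hy => ?_
    simp only [g, chartDensity_pinchedMetric, pinchWeight_pinchBall _ hy]
  have hvSc : ∀ k, (g k).volumeMeasure Sᶜ ≤ ∫⁻ y in (pinchBall m c)ᶜ, (g k).chartDensity p y ∂μ := by
    intro k
    have hs := (isOpen_extChartAt_source (I := 𝓡 m) p).measurableSet
    rw [← measure_inter_add_sdiff Sᶜ hs, ← Measure.restrict_apply hS.compl,
      (g k).volumeMeasure_restrict_source p, (g k).chartVolume_apply p hS.compl,
      extChartAt_target_sphere, Set.univ_inter, Set.preimage_compl, hpre]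
    rw [measure_mono_null (t := {-p}) ?_ ((g k).volumeMeasure_singleton (-p)), add_zero]
    intro x hx
    have hx2 := hx.2
    rwa [extChartAt_source_sphere, Set.mem_compl_iff, not_not] at hx2
  have hpos : (g 0).volumeMeasure S ≠ 0 := by
    rw [hvS]
    intro h0
    have hm' : AEMeasurable ((g 0).chartDensity p) (μ.restrict (pinchBall m c)) := by
      have := (g 0).aemeasurable_chartDensity p μ
      rw [extChartAt_target_sphere, Measure.restrict_univ] at this
      exact this.restrict
    rw [lintegral_eq_zero_iff' hm'] at h0
    have h2 : ∀ᵐ y ∂μ.restrict (pinchBall m c), False := by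
      filter_upwards [h0] with y hy
      exact ((g 0).chartDensity_pos p (by rw [extChartAt_target_sphere]; trivial)).ne' hy
    rw [Filter.eventually_false_iff_eq_bot, ae_eq_bot, Measure.restrict_eq_zero] at h2
    refine ((isOpen_pinchBall c).measure_pos μ ⟨0, ?_⟩).ne' h2
    simp [pinchBall]
    norm_num
  have hlim : Tendsto (fun k => (g k).volumeMeasure Sᶜ) atTop (𝓝 0) :=
    tendsto_of_tendsto_of_tendsto_of_le_of_le tendsto_const_nhds (tendsto_lintegral_chartDensity hm p c)
      (fun k => zero_le) hvSc
  have huniv : ∀ k, (g k).volumeMeasure Set.univ = (g 0).volumeMeasure S + (g k).volumeMeasure Sᶜ := by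
    intro k
    rw [← measure_add_measure_compl hS, hconst]
  have hlow : ∀ k, ((g 0).volumeMeasure S + (g k).volumeMeasure Sᶜ)⁻¹ * (g 0).volumeMeasure S ≤
      (g k).curvatureDistribution {4 * c} := by
    intro k
    rw [← huniv]
    nth_rw 1 [← hconst k]
    refine (g k).le_curvatureDistribution_singleton hd hS fun x hx => ?_
    refine (g k).curvatureLaw_eq_dirac hd (hsource hx) fun u v w => ?_
    refine coordCurvature_pinchedMetric p _ ?_ u v w
    rw [← hpre, Set.mem_preimage, (extChartAt (𝓡 m) p).left_inv (hsource hx)]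
    exact hx
  have htop : (g 0).volumeMeasure S ≠ ⊤ := measure_ne_top _ _
  have h1 : Tendsto (fun k => ((g 0).volumeMeasure S + (g k).volumeMeasure Sᶜ)⁻¹ * (g 0).volumeMeasure S)
      atTop (𝓝 1) := by
    have h2 := (tendsto_const_nhds (x := (g 0).volumeMeasure S)).add hlim
    rw [add_zero] at h2
    have h3 := ENNReal.Tendsto.mul_const (b := (g 0).volumeMeasure S) (tendsto_inv_iff.2 h2)
      (Or.inr htop)
    rwa [ENNReal.inv_mul_cancel hpos htop] at h3
  refine tendsto_of_tendsto_of_tendsto_of_le_of_le h1 tendsto_const_nhds hlow fun k => ?_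
  have := (g k).isProbabilityMeasure_curvatureDistribution hd
  exact prob_le_one

end Concentration

end

section

set_option maxSynthPendingDepth 3

section Uniqueness

open Filter Topology

theorem prod_singleton_pair {X Y : Type*} [MeasurableSpace X] [MeasurableSpace Y] (μ : Measure X)
    (ν : Measure Y) [SFinite ν] (x : X) (y : Y) : μ.prod ν {(x, y)} = μ {x} * ν {y} := by
  rw [← Set.singleton_prod_singleton, Measure.prod_prod]

theorem ComputesProductCurvature.unique {m n : ℕ} (hm : 2 ≤ m) (hn : 2 ≤ n) {ρ ρ' : Kernel (ℝ × ℝ) ℝ}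
    [IsMarkovKernel ρ] [IsMarkovKernel ρ'] (h : ComputesProductCurvature.{0, 0} m n ρ)
    (h' : ComputesProductCurvature.{0, 0} m n ρ') : ρ' = ρ := by
  have fact : ∀ d : ℕ, Fact (Module.finrank ℝ (EuclideanSpace ℝ (Fin (d + 1))) = d + 1) :=
    fun d => ⟨finrank_euclideanSpace_fin⟩
  have hpole : ∀ d : ℕ, Nonempty (Metric.sphere (0 : EuclideanSpace ℝ (Fin (d + 1))) 1) := fun d =>
    ⟨⟨EuclideanSpace.single 0 1, by simp⟩⟩
  obtain ⟨p⟩ := hpole m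
  obtain ⟨q⟩ := hpole n
  ext ⟨μ, ν⟩ A hA
  let g : ℕ → SmoothMetric (𝓡 m) (Metric.sphere (0 : EuclideanSpace ℝ (Fin (m + 1))) 1) := fun k =>
    pinchedMetric p (μ / 4) (A := k + 1) (by positivity)
  let f : ℕ → SmoothMetric (𝓡 n) (Metric.sphere (0 : EuclideanSpace ℝ (Fin (n + 1))) 1) := fun k =>
    pinchedMetric q (ν / 4) (A := k + 1) (by positivity)
  have hg : Tendsto (fun k => (g k).curvatureDistribution {μ}) atTop (𝓝 1) := by
    have := tendsto_curvatureDistribution_pinchedMetric hm p (μ / 4)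
    rwa [mul_div_cancel₀ μ (by norm_num : (4 : ℝ) ≠ 0)] at this
  have hf : Tendsto (fun k => (f k).curvatureDistribution {ν}) atTop (𝓝 1) := by
    have := tendsto_curvatureDistribution_pinchedMetric hn q (ν / 4)
    rwa [mul_div_cancel₀ ν (by norm_num : (4 : ℝ) ≠ 0)] at this
  have hgp : ∀ k, IsProbabilityMeasure (g k).curvatureDistribution := fun k =>
    have : Nonempty (Metric.sphere (0 : EuclideanSpace ℝ (Fin (m + 1))) 1) := ⟨p⟩
    (g k).isProbabilityMeasure_curvatureDistribution (by simpa using hm)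
  have hfp : ∀ k, IsProbabilityMeasure (f k).curvatureDistribution := fun k =>
    have : Nonempty (Metric.sphere (0 : EuclideanSpace ℝ (Fin (n + 1))) 1) := ⟨q⟩
    (f k).isProbabilityMeasure_curvatureDistribution (by simpa using hn)
  have hP : Tendsto (fun k => ((g k).curvatureDistribution.prod (f k).curvatureDistribution) {(μ, ν)})
      atTop (𝓝 1) := by
    simp only [prod_singleton_pair]
    simpa using ENNReal.Tendsto.mul hg (Or.inl one_ne_zero) hf (Or.inl one_ne_zero)
  have hbind : ∀ k, ((g k).curvatureDistribution.prod (f k).curvatureDistribution).bind ρ =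
      ((g k).curvatureDistribution.prod (f k).curvatureDistribution).bind ρ' := by
    intro k
    have : Nonempty (Metric.sphere (0 : EuclideanSpace ℝ (Fin (m + 1))) 1) := ⟨p⟩
    have : Nonempty (Metric.sphere (0 : EuclideanSpace ℝ (Fin (n + 1))) 1) := ⟨q⟩
    rw [← h _ (g k) _ (f k), ← h' _ (g k) _ (f k)]
  have h1 := tendsto_bind_of_tendsto_singleton hP ρ hA
  have h2 := tendsto_bind_of_tendsto_singleton hP ρ' hA
  simp only [hbind] at h1
  exact tendsto_nhds_unique h2 h1

end Uniqueness

end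

end

theorem corollary4p2 (m n : ℕ) (hm : 2 ≤ m) (hn : 2 ≤ n) :
    ∃ ρ : Kernel (ℝ × ℝ) ℝ,
      -- probability measures with support in the convex hull, which compute curvature densities
      (IsMarkovKernel ρ ∧
        (∀ μ ν : ℝ, (ρ (μ, ν)).support ⊆ convexHull ℝ {μ, ν, 0}) ∧
        ComputesProductCurvature.{u, v} m n ρ) ∧
      -- uniqueness
      (∀ ρ' : Kernel (ℝ × ℝ) ℝ, IsMarkovKernel ρ' →
        (∀ μ ν : ℝ, (ρ' (μ, ν)).support ⊆ convexHull ℝ {μ, ν, 0}) →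
        ComputesProductCurvature.{0, 0} m n ρ' → ρ' = ρ) ∧
      -- description by a random variable on the simplex
      (IsProbabilityMeasure (simplexMeasure m n) ∧
        ∀ μ ν : ℝ, ρ (μ, ν) = (simplexMeasure m n).map fun z => z.1 ^ 2 * μ + z.2 ^ 2 * ν) ∧
      -- explicit density for `ν = 0`
      (∀ μ : ℝ, μ ≠ 0 → ρ (μ, 0) = axisMeasure m n μ) ∧
      -- products with a one-dimensional manifold, for example a circle
      ∃ σ : Kernel ℝ ℝ, IsMarkovKernel σ ∧ σ 0 = Measure.dirac 0 ∧
        (∀ μ : ℝ, μ ≠ 0 → σ μ = axisMeasure m 1 μ) ∧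
        ∀ (M : Type u) [TopologicalSpace M] [ChartedSpace (EuclideanSpace ℝ (Fin m)) M]
          [IsManifold (𝓡 m) ∞ M] [T2Space M] [CompactSpace M] [Nonempty M]
          [MeasurableSpace M] [BorelSpace M] (g : SmoothMetric (𝓡 m) M)
          (N : Type v) [TopologicalSpace N] [ChartedSpace (EuclideanSpace ℝ (Fin 1)) N]
          [IsManifold (𝓡 1) ∞ N] [T2Space N] [CompactSpace N] [Nonempty N]
          [MeasurableSpace N] [BorelSpace N] (h : SmoothMetric (𝓡 1) N),
          (g.prod h).curvatureDistribution = g.curvatureDistribution.bind σ := by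
  have hρ := isMarkovKernel_simplexKernel hm hn
  refine ⟨simplexKernel m n, ⟨hρ, support_simplexKernel_subset m n,
    computesProductCurvature_simplexKernel hm hn⟩, ?_,
    ⟨isProbabilityMeasure_simplexMeasure hm hn, simplexKernel_apply m n⟩,
    fun μ hμ => simplexKernel_axis hm hn hμ,
    marginalKernel m 1, isMarkovKernel_marginalKernel hm le_rfl, ?_, ?_, ?_⟩
  · intro ρ' _ _ h'
    exact (computesProductCurvature_simplexKernel hm hn).unique hm hn h'
  · have := isProbabilityMeasure_marginalMeasure (n := 1) hm le_rfl
    simp [marginalKernel_apply, Measure.map_const]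
  · intro μ hμ
    rw [marginalKernel_apply, map_marginalMeasure hm hμ]
  · intro M _ _ _ _ _ _ _ _ g N _ _ _ _ _ _ _ _ h
    exact curvatureDistribution_prod_line hm g h
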